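/- Let $\Gamma$ be a (discrete) group. $C^*$-algebras are complex and not assumed to be unital, and $\hat\otimes$ denotes the maximal tensor product. The full group $C^*$-algebra $C^*(\Gamma)$ carries the comultiplication $\Delta\colon C^*(\Gamma)\to C^*(\Gamma)\hat\otimes C^*(\Gamma)$, $\gamma\mapsto\gamma\otimes\gamma$. A $(\mathbb{C},\Gamma)$-$C^*$-algebra is a $C^*$-algebra $A$ with injective $*$-homomorphisms $\delta_A\colon A\to C^*(\Gamma)\hat\otimes A$ and $\bar\delta_A\colon A\to A\hat\otimes C^*(\Gamma)$ such that $$(\mathrm{id}\hat\otimes\delta_A)\delta_A=(\Delta\hat\otimes\mathrm{id})\delta_A,\qquad (\bar\delta_A\hat\otimes\mathrm{id})\bar\delta_A=(\mathrm{id}\hat\otimes\Delta)\bar\delta_A,\qquad (\delta_A\hat\otimes\mathrm{id})\bar\delta_A=(\mathrm{id}\hat\otimes\bar\delta_A)\delta_A .$$ A morphism $\pi\colon A\to C$ is a $*$-homomorphism with $\delta_C\pi=(\mathrm{id}\hat\otimes\pi)\delta_A$ and $\bar\delta_C\pi=(\pi\hat\otimes\mathrm{id})\bar\delta_A$. A short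 exact sequence of $(\mathbb{C},\Gamma)$-$C^*$-algebras is a sequence of morphisms $J\xrightarrow{\iota}A\xrightarrow{\pi}C$ with $\ker\iota=0$, $\iota(J)=\ker\pi$ and $\pi(A)=C$. The maximal cotensor product of $A$ and $C$ is the $C^*$-subalgebra $$A\hat\otimes^{\Gamma}C:=\{x\in A\hat\otimes C:(\bar\delta_A\hat\otimes\mathrm{id})(x)=(\mathrm{id}\hat\otimes\delta_C)(x)\}\subseteq A\hat\otimes C ,$$ and, for morphisms $\phi\colon A\to A'$ and $\psi\colon C\to C'$, the map $\phi\hat\otimes^{\Gamma}\psi\colon A\hat\otimes^\Gamma C\to A'\hat\otimes^\Gamma C'$ is the restriction of $\phi\hat\otimes\psi$. Proposition. Let $D$ be a $(\mathbb{C},\Gamma)$-$C^*$-algebra. (1) For every $(\mathbb{C},\Gamma)$-$C^*$-algebra $X$, there is exactly one structure of a $(\mathbb{C},\Gamma)$-$C^*$-algebra on $X\hat\otimes^{\Gamma}D$ whose coactions are the restrictions of $\delta_X\hat\otimes\mathrm{id}$ and $\mathrm{id}\hat\otimes\bar\delta_D$, and exactly one on $D\hat\otimes^{\Gamma}X$ whose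 coactions are the restrictions of $\delta_D\hat\otimes\mathrm{id}$ and $\mathrm{id}\hat\otimes\bar\delta_X$. (2) With respect to these structures, the functors $-\hat\otimes^{\Gamma}D$ and $D\hat\otimes^{\Gamma}-$ are exact: if $J\xrightarrow{\iota}A\xrightarrow{\pi}C$ is a short exact sequence of $(\mathbb{C},\Gamma)$-$C^*$-algebras, then so are $$J\hat\otimes^{\Gamma}D\xrightarrow{\iota\hat\otimes^{\Gamma}\mathrm{id}}A\hat\otimes^{\Gamma}D\xrightarrow{\pi\hat\otimes^{\Gamma}\mathrm{id}}C\hat\otimes^{\Gamma}D \quad\text{and}\quad D\hat\otimes^{\Gamma}J\xrightarrow{\mathrm{id}\hat\otimes^{\Gamma}\iota}D\hat\otimes^{\Gamma}A\xrightarrow{\mathrm{id}\hat\otimes^{\Gamma}\pi}D\hat\otimes^{\Gamma}C .$$ -/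

import Mathlib

open scoped TensorProduct

universe u v w

set_option linter.unusedSectionVars false

noncomputable section

namespace CGamma

/-! ### Enveloping C⋆-algebras -/

section Seminorms

variable (X : Type*) [NonUnitalRing X] [StarRing X] [Module ℂ X]

/-- A C⋆-seminorm on a complex ⋆-algebra. These are exactly the functions `x ↦ ‖π x‖`, where `π` is
a ⋆-homomorphism from `X` into some C⋆-algebra. -/
structure CStarSeminorm extends Seminorm ℂ X where
  mul_le' : ∀ x y, toFun (x * y) ≤ toFun x * toFun y
  star_mul_self' : ∀ x, toFun (star x * x) = toFun x ^ 2

variable {X}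

instance : CoeFun (CStarSeminorm X) fun _ => X → ℝ := ⟨fun p => p.toSeminorm⟩

theorem CStarSeminorm.mul_le (p : CStarSeminorm X) (x y : X) : p (x * y) ≤ p x * p y :=
  p.mul_le' x y

theorem CStarSeminorm.star_mul_self (p : CStarSeminorm X) (x : X) :
    p (star x * x) = p x ^ 2 := p.star_mul_self' x

theorem CStarSeminorm.nonneg (p : CStarSeminorm X) (x : X) : 0 ≤ p x := apply_nonneg _ x

theorem CStarSeminorm.star_le (p : CStarSeminorm X) (x : X) : p x ≤ p (star x) := by
  by_contra! h
  have h1 := p.star_mul_self x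
  have h2 := p.mul_le (star x) x
  nlinarith [p.nonneg (star x), p.nonneg x]

theorem CStarSeminorm.star_eq (p : CStarSeminorm X) (x : X) : p (star x) = p x :=
  le_antisymm (by simpa using p.star_le (star x)) (p.star_le x)

/-- The C⋆-seminorm `x ↦ ‖π x‖` of a representation `π`. -/
def CStarSeminorm.ofHom {E : Type*} [NonUnitalCStarAlgebra E] (π : X →⋆ₙₐ[ℂ] E) :
    CStarSeminorm X where
  toFun x := ‖π x‖
  map_zero' := by simp
  add_le' x y := by simpa using norm_add_le (π x) (π y)
  neg' x := by simp
  smul' c x := by simp [norm_smul]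
  mul_le' x y := by simpa using norm_mul_le (π x) (π y)
  star_mul_self' x := by
    rw [map_mul, map_star, CStarRing.norm_star_mul_self, sq]

theorem CStarSeminorm.ofHom_apply {E : Type*} [NonUnitalCStarAlgebra E] (π : X →⋆ₙₐ[ℂ] E) (x : X) :
    CStarSeminorm.ofHom π x = ‖π x‖ := rfl

/-- `X`, regarded as a seminormed ⋆-algebra with respect to a C⋆-seminorm. -/
def CStarSeminorm.Pre (_p : CStarSeminorm X) : Type _ := X

end Seminorms

section Completion

variable {X : Type*} [NonUnitalRing X] [StarRing X] [Module ℂ X] [IsScalarTower ℂ X X]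
  [SMulCommClass ℂ X X] [StarModule ℂ X] (p : CStarSeminorm X)

instance : NonUnitalSeminormedRing p.Pre :=
  { (inferInstance : NonUnitalRing X), p.toSeminorm.toAddGroupSeminorm.toSeminormedAddCommGroup with
    norm_mul_le := p.mul_le }

instance : StarRing p.Pre := (inferInstance : StarRing X)
instance : Module ℂ p.Pre := (inferInstance : Module ℂ X)
instance : IsScalarTower ℂ p.Pre p.Pre := (inferInstance : IsScalarTower ℂ X X)
instance : SMulCommClass ℂ p.Pre p.Pre := (inferInstance : SMulCommClass ℂ X X)
instance : StarModule ℂ p.Pre := (inferInstance : StarModule ℂ X)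

instance : NormedSpace ℂ p.Pre where
  norm_smul_le c x := (map_smul_eq_mul p.toSeminorm c x).le

/-- The identity map from `X` to `p.Pre`. -/
def CStarSeminorm.toPre : X →⋆ₙₐ[ℂ] p.Pre where
  toFun x := x
  map_smul' _ _ := rfl
  map_zero' := rfl
  map_add' _ _ := rfl
  map_mul' _ _ := rfl
  map_star' _ := rfl

theorem norm_toPre (x : X) : ‖p.toPre x‖ = p x := rfl

theorem norm_star_pre (x : p.Pre) : ‖star x‖ = ‖x‖ := p.star_eq (show X from x)

theorem norm_star_mul_self_pre (x : p.Pre) : ‖star x * x‖ = ‖x‖ ^ 2 :=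
  p.star_mul_self (show X from x)

theorem continuous_star_pre : UniformContinuous (star : p.Pre → p.Pre) :=
  (AddMonoidHomClass.isometry_of_norm (starAddEquiv : p.Pre ≃+ p.Pre)
    (norm_star_pre p)).uniformContinuous

open UniformSpace UniformSpace.Completion

instance : Mul (Completion p.Pre) :=
  ⟨Function.curry <| (isDenseInducing_coe.prodMap isDenseInducing_coe).extend
    ((↑) ∘ Function.uncurry (· * · : p.Pre → p.Pre → p.Pre))⟩

theorem coe_mul (a b : p.Pre) : ((a * b : p.Pre) : Completion p.Pre) = a * b :=
  ((isDenseInducing_coe.prodMap isDenseInducing_coe).extend_eq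
    ((continuous_coe p.Pre).comp (continuous_mul (M := p.Pre))) (a, b)).symm

instance : ContinuousMul (Completion p.Pre) where
  continuous_mul := by
    let m := (AddMonoidHom.mul : p.Pre →+ p.Pre →+ p.Pre).compr₂ toCompl
    have : Continuous fun q : p.Pre × p.Pre => m q.1 q.2 :=
      (continuous_coe p.Pre).comp continuous_mul
    have di : IsDenseInducing (toCompl : p.Pre → Completion p.Pre) := isDenseInducing_coe
    exact (di.extend_Z_bilin di this :)

instance : NonUnitalNormedRing (Completion p.Pre) :=
  { (inferInstance : NormedAddCommGroup (Completion p.Pre)) with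
    mul := (· * ·)
    zero_mul := fun a =>
      Completion.induction_on a (isClosed_eq (by fun_prop) continuous_const)
        fun a => by rw [← coe_zero, ← coe_mul, zero_mul]
    mul_zero := fun a =>
      Completion.induction_on a (isClosed_eq (by fun_prop) continuous_const)
        fun a => by rw [← coe_zero, ← coe_mul, mul_zero]
    mul_assoc := fun a b c =>
      Completion.induction_on₃ a b c (isClosed_eq (by fun_prop) (by fun_prop))
        fun a b c => by rw [← coe_mul, ← coe_mul, ← coe_mul, ← coe_mul, mul_assoc]
    left_distrib := fun a b c =>
      Completion.induction_on₃ a b c (isClosed_eq (by fun_prop) (by fun_prop))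
        fun a b c => by rw [← coe_add, ← coe_mul, ← coe_mul, ← coe_mul, ← coe_add, mul_add]
    right_distrib := fun a b c =>
      Completion.induction_on₃ a b c (isClosed_eq (by fun_prop) (by fun_prop))
        fun a b c => by rw [← coe_add, ← coe_mul, ← coe_mul, ← coe_mul, ← coe_add, add_mul]
    norm_mul_le := fun a b =>
      Completion.induction_on₂ a b (isClosed_le (by fun_prop) (by fun_prop))
        fun a b => by simpa only [← coe_mul, norm_coe] using norm_mul_le a b }

instance : Star (Completion p.Pre) := ⟨Completion.map star⟩

theorem coe_star (a : p.Pre) : ((star a : p.Pre) : Completion p.Pre) = star (a : Completion p.Pre) :=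
  (Completion.map_coe (continuous_star_pre p) a).symm

theorem continuous_star_completion : Continuous (star : Completion p.Pre → Completion p.Pre) :=
  Completion.continuous_map

instance : StarRing (Completion p.Pre) where
  star_involutive a :=
    have := continuous_star_completion p
    Completion.induction_on a (isClosed_eq (this.comp this) continuous_id)
      fun a => by rw [← coe_star, ← coe_star, star_star]
  star_mul a b :=
    have := continuous_star_completion p
    Completion.induction_on₂ a b (isClosed_eq (by fun_prop) (by fun_prop))
      fun a b => by rw [← coe_mul, ← coe_star, ← coe_star, ← coe_star, ← coe_mul, star_mul]
  star_add a b :=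
    have := continuous_star_completion p
    Completion.induction_on₂ a b (isClosed_eq (by fun_prop) (by fun_prop))
      fun a b => by rw [← coe_add, ← coe_star, ← coe_star, ← coe_star, ← coe_add, star_add]

instance : CStarRing (Completion p.Pre) where
  norm_mul_self_le a :=
    have := continuous_star_completion p
    Completion.induction_on a (isClosed_le (by fun_prop) (by fun_prop))
      fun a => by
        rw [← coe_star, ← coe_mul, norm_coe, norm_coe, norm_star_mul_self_pre, sq]

instance : IsScalarTower ℂ (Completion p.Pre) (Completion p.Pre) where
  smul_assoc c a b :=
    Completion.induction_on₂ a b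
      (isClosed_eq ((continuous_fst.const_smul c).mul continuous_snd)
        ((continuous_fst.mul continuous_snd).const_smul c))
      fun a b => by
        rw [smul_eq_mul, smul_eq_mul, ← coe_smul, ← coe_mul, ← coe_mul, ← coe_smul, smul_mul_assoc]

instance : SMulCommClass ℂ (Completion p.Pre) (Completion p.Pre) where
  smul_comm c a b :=
    Completion.induction_on₂ a b
      (isClosed_eq ((continuous_fst.mul continuous_snd).const_smul c)
        (continuous_fst.mul (continuous_snd.const_smul c)))
      fun a b => by
        rw [smul_eq_mul, smul_eq_mul, ← coe_smul, ← coe_mul, ← coe_mul, ← coe_smul, mul_smul_comm]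

instance : StarModule ℂ (Completion p.Pre) where
  star_smul c a :=
    have := continuous_star_completion p
    Completion.induction_on a
      (isClosed_eq (this.comp (continuous_id.const_smul c)) (this.const_smul (star c)))
      fun a => by rw [← coe_smul, ← coe_star, ← coe_star, ← coe_smul, star_smul]

instance : NonUnitalCStarAlgebra (Completion p.Pre) where

/-- The representation with C⋆-seminorm `p`. -/
def toCompletion : X →⋆ₙₐ[ℂ] Completion p.Pre where
  toFun x := ((p.toPre x : p.Pre) : Completion p.Pre)
  map_smul' c x := by rw [map_smul]; exact coe_smul c (p.toPre x)
  map_zero' := by rw [map_zero, coe_zero]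
  map_add' x y := by rw [map_add, coe_add]
  map_mul' x y := by rw [map_mul, coe_mul]
  map_star' x := by rw [map_star, coe_star]

theorem norm_toCompletion (x : X) : ‖toCompletion p x‖ = p x := norm_coe (p.toPre x)

theorem denseRange_toCompletion : DenseRange (toCompletion p) := denseRange_coe (α := p.Pre)

/-- Bounded linear extension to the completion. -/
def completionExtend {E : Type*} [NormedAddCommGroup E] [NormedSpace ℂ E] [CompleteSpace E]
    (f : X →ₗ[ℂ] E) (C : ℝ) (h : ∀ x, ‖f x‖ ≤ C * p x) : Completion p.Pre →L[ℂ] E :=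
  ContinuousLinearMap.extend
    (LinearMap.mkContinuous
      ({ toFun := fun x => f x, map_add' := map_add f, map_smul' := map_smul f } :
        p.Pre →ₗ[ℂ] E) C h) (toComplL : p.Pre →L[ℂ] Completion p.Pre)

theorem completionExtend_apply {E : Type*} [NormedAddCommGroup E] [NormedSpace ℂ E]
    [CompleteSpace E] (f : X →ₗ[ℂ] E) (C : ℝ) (h : ∀ x, ‖f x‖ ≤ C * p x) (x : X) :
    completionExtend p f C h (toCompletion p x) = f x :=
  ContinuousLinearMap.extend_eq _ denseRange_coe (isUniformInducing_coe _) (p.toPre x)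

/-- Extension of a representation that is dominated by `p`. -/
def completionLift {E : Type*} [NonUnitalCStarAlgebra E] (π : X →⋆ₙₐ[ℂ] E)
    (h : ∀ x, ‖π x‖ ≤ p x) : Completion p.Pre →⋆ₙₐ[ℂ] E :=
  let g := completionExtend p (π : X →ₗ[ℂ] E) 1 (by simpa using! h)
  have hg : ∀ x, g (toCompletion p x) = π x := completionExtend_apply p _ _ _
  have hd := denseRange_toCompletion p
  { toFun := g
    map_smul' := map_smul g
    map_zero' := map_zero g
    map_add' := map_add g
    map_mul' := fun x y => by
      refine hd.induction_on₂ (p := fun x y => g (x * y) = g x * g y)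
        (isClosed_eq (by fun_prop) (by fun_prop)) (fun x y => ?_) x y
      rw [← map_mul, hg, hg, hg, map_mul]
    map_star' := fun x => by
      refine hd.induction_on (p := fun x => g (star x) = star (g x)) x
        (isClosed_eq (by fun_prop) (by fun_prop)) (fun x => ?_)
      rw [← map_star, hg, hg, map_star] }

theorem completionLift_toCompletion {E : Type*} [NonUnitalCStarAlgebra E] (π : X →⋆ₙₐ[ℂ] E)
    (h : ∀ x, ‖π x‖ ≤ p x) (x : X) : completionLift p π h (toCompletion p x) = π x :=
  completionExtend_apply p _ _ _ x

end Completion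

section Env

variable (X : Type*) [NonUnitalRing X] [StarRing X] [Module ℂ X]

/-- The condition that `|x| = sup {‖π x‖}`, the supremum over all representations `π` of `X`, is
finite for all `x`, that is, that `X` has an enveloping C⋆-algebra. -/
class HasEnvelope : Prop where
  bddAbove : ∀ x : X, BddAbove (Set.range fun p : CStarSeminorm X => p x)

instance : Inhabited (CStarSeminorm X) where
  default := { (0 : Seminorm ℂ X) with
    mul_le' := fun x y => by
      change (0 : Seminorm ℂ X) (x * y) ≤ (0 : Seminorm ℂ X) x * (0 : Seminorm ℂ X) y
      simp
    star_mul_self' := fun x => by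
      change (0 : Seminorm ℂ X) (star x * x) = (0 : Seminorm ℂ X) x ^ 2
      simp }

variable [HasEnvelope X]

variable {X} in
theorem le_iSup_seminorm (p : CStarSeminorm X) (x : X) : p x ≤ ⨆ q : CStarSeminorm X, q x :=
  le_ciSup (f := fun q : CStarSeminorm X => q x) (HasEnvelope.bddAbove x) p

variable {X} in
theorem iSup_seminorm_nonneg (x : X) : 0 ≤ ⨆ q : CStarSeminorm X, q x :=
  Real.iSup_nonneg fun q => q.nonneg x

/-- The largest C⋆-seminorm `x ↦ |x|`. -/
def maxSeminorm : CStarSeminorm X where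
  toFun x := ⨆ p : CStarSeminorm X, p x
  map_zero' := by simp
  add_le' x y := ciSup_le fun p => (map_add_le_add p.toSeminorm x y).trans
    (add_le_add (le_iSup_seminorm p x) (le_iSup_seminorm p y))
  neg' x := by simp
  smul' c x := by
    simp_rw [map_smul_eq_mul, Real.mul_iSup_of_nonneg (norm_nonneg c)]
  mul_le' x y := ciSup_le fun p => (p.mul_le x y).trans
    (mul_le_mul (le_iSup_seminorm p x) (le_iSup_seminorm p y) (p.nonneg y)
      (iSup_seminorm_nonneg x))
  star_mul_self' x := by
    refine le_antisymm (ciSup_le fun p => ?_) ?_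
    · rw [p.star_mul_self]
      exact pow_le_pow_left₀ (p.nonneg x) (le_iSup_seminorm p x) 2
    · rw [← Real.le_sqrt (iSup_seminorm_nonneg x) (iSup_seminorm_nonneg _)]
      refine ciSup_le fun p => Real.le_sqrt_of_sq_le ?_
      rw [← p.star_mul_self]
      exact le_iSup_seminorm p _

variable {X} in
theorem le_maxSeminorm (p : CStarSeminorm X) (x : X) : p x ≤ maxSeminorm X x :=
  le_iSup_seminorm p x

variable [IsScalarTower ℂ X X] [SMulCommClass ℂ X X] [StarModule ℂ X]

/-- The enveloping C⋆-algebra of `X`: the separated completion with respect to the largest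
C⋆-seminorm. -/
def CStarEnv : Type _ := UniformSpace.Completion (maxSeminorm X).Pre

instance : NonUnitalCStarAlgebra (CStarEnv X) :=
  (inferInstance : NonUnitalCStarAlgebra (UniformSpace.Completion (maxSeminorm X).Pre))

/-- The universal representation of `X`. -/
def toEnv : X →⋆ₙₐ[ℂ] CStarEnv X := toCompletion (maxSeminorm X)

variable {X}

theorem norm_toEnv (x : X) : ‖toEnv X x‖ = maxSeminorm X x := norm_toCompletion _ x

theorem denseRange_toEnv : DenseRange (toEnv X) := denseRange_toCompletion (maxSeminorm X)

/-- The extension of a representation of `X` to the enveloping C⋆-algebra. -/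
def envLift {E : Type*} [NonUnitalCStarAlgebra E] (π : X →⋆ₙₐ[ℂ] E) : CStarEnv X →⋆ₙₐ[ℂ] E :=
  completionLift (maxSeminorm X) π fun x => le_maxSeminorm (.ofHom π) x

theorem envLift_toEnv {E : Type*} [NonUnitalCStarAlgebra E] (π : X →⋆ₙₐ[ℂ] E) (x : X) :
    envLift π (toEnv X x) = π x := completionLift_toCompletion _ π _ x

/-- The extension of a linear map that is bounded with respect to the largest C⋆-seminorm. -/
def envExtend {E : Type*} [NormedAddCommGroup E] [NormedSpace ℂ E] [CompleteSpace E]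
    (f : X →ₗ[ℂ] E) (C : ℝ) (h : ∀ x, ‖f x‖ ≤ C * maxSeminorm X x) : CStarEnv X →L[ℂ] E :=
  completionExtend (maxSeminorm X) f C h

theorem envExtend_toEnv {E : Type*} [NormedAddCommGroup E] [NormedSpace ℂ E] [CompleteSpace E]
    (f : X →ₗ[ℂ] E) (C : ℝ) (h : ∀ x, ‖f x‖ ≤ C * maxSeminorm X x) (x : X) :
    envExtend f C h (toEnv X x) = f x := completionExtend_apply _ f C h x

theorem norm_envExtend_le {E : Type*} [NormedAddCommGroup E] [NormedSpace ℂ E] [CompleteSpace E]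
    (f : X →ₗ[ℂ] E) (C : ℝ) (h : ∀ x, ‖f x‖ ≤ C * maxSeminorm X x) (x : CStarEnv X) :
    ‖envExtend f C h x‖ ≤ C * ‖x‖ := by
  refine denseRange_toEnv.induction_on (p := fun x => ‖envExtend f C h x‖ ≤ C * ‖x‖) x
    (isClosed_le (by fun_prop) (by fun_prop)) (fun x => ?_)
  rw [envExtend_toEnv, norm_toEnv]
  exact h x

theorem continuous_hom {E F : Type*} [NonUnitalCStarAlgebra E] [NonUnitalCStarAlgebra F]
    (π : E →⋆ₙₐ[ℂ] F) : Continuous π :=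
  AddMonoidHomClass.continuous_of_bound π 1 fun x => by
    simpa using NonUnitalStarAlgHom.norm_apply_le π x

/-- Representations of the enveloping C⋆-algebra are determined on `X`. -/
theorem env_hom_ext {E : Type*} [NonUnitalCStarAlgebra E] {π ρ : CStarEnv X →⋆ₙₐ[ℂ] E}
    (h : ∀ x, π (toEnv X x) = ρ (toEnv X x)) : π = ρ :=
  DFunLike.coe_injective
    (denseRange_toEnv.equalizer (continuous_hom π) (continuous_hom ρ) (funext h))

end Env

/-! ### The full group C⋆-algebra -/

section Group

variable (Γ : Type*) [Group Γ]

/-- The involution of the group algebra, `(∑ z_γ γ)⋆ = ∑ conj(z_γ) γ⁻¹`. -/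
instance : Star (MonoidAlgebra ℂ Γ) where
  star f := .ofCoeff ((f.coeff.mapRange star (star_zero ℂ)).equivMapDomain (Equiv.inv Γ))

variable {Γ} in
theorem coeff_star (f : MonoidAlgebra ℂ Γ) (γ : Γ) : (star f).coeff γ = star (f.coeff γ⁻¹) := rfl

variable {Γ} in
theorem star_single (γ : Γ) (z : ℂ) :
    star (MonoidAlgebra.single γ z) = MonoidAlgebra.single γ⁻¹ (star z) := by
  classical
  ext δ
  rw [coeff_star, MonoidAlgebra.coeff_single, MonoidAlgebra.coeff_single, Finsupp.single_apply,
    Finsupp.single_apply]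
  by_cases h : γ = δ⁻¹
  · rw [if_pos h, if_pos (by rw [h, inv_inv])]
  · rw [if_neg h, if_neg (fun h' => h (by rw [← h', inv_inv])), star_zero]

variable {Γ} in
theorem star_add_groupAlgebra (f g : MonoidAlgebra ℂ Γ) : star (f + g) = star f + star g := by
  ext δ
  simp only [coeff_star, MonoidAlgebra.coeff_add, Finsupp.add_apply, star_add]

instance : StarRing (MonoidAlgebra ℂ Γ) where
  star_involutive f := by
    induction f using MonoidAlgebra.induction_linear with
    | zero => ext δ; simp [coeff_star]
    | add f g hf hg => rw [star_add_groupAlgebra, star_add_groupAlgebra, hf, hg]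
    | single γ z => simp [star_single]
  star_mul f g := by
    have h0 : star (0 : MonoidAlgebra ℂ Γ) = 0 := by ext δ; simp [coeff_star]
    induction f using MonoidAlgebra.induction_linear with
    | zero => simp [h0]
    | add f f' hf hf' => rw [add_mul, star_add_groupAlgebra, star_add_groupAlgebra, hf, hf', mul_add]
    | single γ z =>
      induction g using MonoidAlgebra.induction_linear with
      | zero => simp [h0]
      | add g g' hg hg' =>
        rw [mul_add, star_add_groupAlgebra, star_add_groupAlgebra, hg, hg', add_mul]
      | single γ' z' => simp [star_single, MonoidAlgebra.single_mul_single, mul_comm]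
  star_add := star_add_groupAlgebra

instance : StarModule ℂ (MonoidAlgebra ℂ Γ) where
  star_smul c f := by
    ext δ
    simp only [coeff_star, MonoidAlgebra.coeff_smul, Finsupp.smul_apply, smul_eq_mul, star_mul']

theorem seminorm_single_le (p : CStarSeminorm (MonoidAlgebra ℂ Γ)) (γ : Γ) :
    p (MonoidAlgebra.single γ 1) ≤ 1 := by
  have h1 := p.star_mul_self (MonoidAlgebra.single γ 1)
  have h2 := p.star_mul_self (MonoidAlgebra.single 1 1)
  simp only [star_single, MonoidAlgebra.single_mul_single, star_one, mul_one, inv_one,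
    inv_mul_cancel] at h1 h2
  have h3 : p (MonoidAlgebra.single (1 : Γ) 1) ≤ 1 := by
    by_contra! hc
    nlinarith
  by_contra! hc
  nlinarith

instance : HasEnvelope (MonoidAlgebra ℂ Γ) where
  bddAbove f := by
    induction f using MonoidAlgebra.induction_linear with
    | zero => exact ⟨0, by rintro _ ⟨p, rfl⟩; simp⟩
    | add f g hf hg =>
      obtain ⟨C, hC⟩ := hf
      obtain ⟨C', hC'⟩ := hg
      refine ⟨C + C', ?_⟩
      rintro _ ⟨p, rfl⟩
      exact (map_add_le_add p.toSeminorm f g).trans (add_le_add (hC ⟨p, rfl⟩) (hC' ⟨p, rfl⟩))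
    | single γ z =>
      refine ⟨‖z‖, ?_⟩
      rintro _ ⟨p, rfl⟩
      have h : MonoidAlgebra.single γ z = z • MonoidAlgebra.single γ (1 : ℂ) := by simp
      simp only [h, map_smul_eq_mul]
      nlinarith [norm_nonneg z, seminorm_single_le Γ p γ]

/-- The full group C⋆-algebra `C⋆(Γ)`. -/
def GroupCStar : Type _ := CStarEnv (MonoidAlgebra ℂ Γ)

instance : NonUnitalCStarAlgebra (GroupCStar Γ) :=
  (inferInstance : NonUnitalCStarAlgebra (CStarEnv (MonoidAlgebra ℂ Γ)))

/-- The universal representation of the group algebra. -/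
def ofGroupAlgebra : MonoidAlgebra ℂ Γ →⋆ₙₐ[ℂ] GroupCStar Γ := toEnv (MonoidAlgebra ℂ Γ)

variable {Γ}

/-- The canonical unitary in `C⋆(Γ)` given by `γ`. -/
def GroupCStar.of (γ : Γ) : GroupCStar Γ :=
  ofGroupAlgebra Γ (MonoidAlgebra.single γ 1)

variable (Γ) in
theorem denseRange_ofGroupAlgebra : DenseRange (ofGroupAlgebra Γ) :=
  denseRange_toEnv (X := MonoidAlgebra ℂ Γ)

/-- The ⋆-homomorphism on `ℂΓ` that is given by a family of elements behaving like the group. -/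
def groupAlgebraLift {E : Type*} [NonUnitalCStarAlgebra E] (u : Γ → E)
    (hmul : ∀ γ γ', u (γ * γ') = u γ * u γ') (hstar : ∀ γ, u γ⁻¹ = star (u γ)) :
    MonoidAlgebra ℂ Γ →⋆ₙₐ[ℂ] E :=
  let f : MonoidAlgebra ℂ Γ →ₗ[ℂ] E :=
    (Finsupp.linearCombination ℂ u).comp
      ({ toFun := MonoidAlgebra.coeff, map_add' := fun _ _ => rfl, map_smul' := fun _ _ => rfl } :
        MonoidAlgebra ℂ Γ →ₗ[ℂ] (Γ →₀ ℂ))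
  have hf : ∀ γ z, f (MonoidAlgebra.single γ z) = z • u γ := fun γ z =>
    Finsupp.linearCombination_single ℂ z γ
  { toFun := f
    map_smul' := map_smul f
    map_zero' := map_zero f
    map_add' := map_add f
    map_mul' := fun x y => by
      induction x using MonoidAlgebra.induction_linear with
      | zero => simp
      | add x x' hx hx' => rw [add_mul, map_add, hx, hx', map_add, add_mul]
      | single γ z =>
        induction y using MonoidAlgebra.induction_linear with
        | zero => simp
        | add y y' hy hy' => rw [mul_add, map_add, hy, hy', map_add, mul_add]
        | single γ' z' =>
          rw [MonoidAlgebra.single_mul_single, hf, hf, hf, hmul, smul_mul_smul_comm]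
    map_star' := fun x => by
      induction x using MonoidAlgebra.induction_linear with
      | zero => simp
      | add x x' hx hx' => rw [star_add, map_add, hx, hx', map_add, star_add]
      | single γ z => rw [star_single, hf, hf, hstar, star_smul] }

theorem groupAlgebraLift_single {E : Type*} [NonUnitalCStarAlgebra E] (u : Γ → E)
    (hmul : ∀ γ γ', u (γ * γ') = u γ * u γ') (hstar : ∀ γ, u γ⁻¹ = star (u γ)) (γ : Γ) :
    groupAlgebraLift u hmul hstar (MonoidAlgebra.single γ 1) = u γ :=
  (Finsupp.linearCombination_single ℂ 1 γ).trans (one_smul ℂ (u γ))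

theorem GroupCStar.of_mul (γ γ' : Γ) :
    GroupCStar.of (γ * γ') = GroupCStar.of γ * GroupCStar.of γ' := by
  simp [GroupCStar.of, ← map_mul, MonoidAlgebra.single_mul_single]

theorem GroupCStar.of_inv (γ : Γ) : GroupCStar.of γ⁻¹ = star (GroupCStar.of γ) := by
  simp [GroupCStar.of, ← map_star, star_single]

end Group

/-! ### The maximal tensor product -/

section Tensor

variable (A B C : Type*) [NonUnitalCStarAlgebra A] [NonUnitalCStarAlgebra B]
  [NonUnitalCStarAlgebra C]

section Bound

attribute [local instance] CStarAlgebra.spectralOrder CStarAlgebra.spectralOrderedRing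

variable {A B}

theorem sq_le_self_of_norm_le_one (a : A) (ha : ‖a‖ ≤ 1) :
    (star a * a) * (star a * a) ≤ star a * a := by
  have h1 := CStarAlgebra.star_left_conjugate_le_norm_smul (a := a) (b := a * star a)
    (IsSelfAdjoint.mul_star_self a)
  have h2 : ‖a * star a‖ ≤ 1 := by
    rw [CStarRing.norm_self_mul_star]
    nlinarith [norm_nonneg a]
  have h3 : ‖a * star a‖ • (star a * a) ≤ (1 : ℝ) • (star a * a) :=
    smul_le_smul_of_nonneg_right h2 (star_mul_self_nonneg a)
  rw [one_smul] at h3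
  simpa only [mul_assoc] using h1.trans h3

theorem norm_tmul_le_one {E : Type*} [NonUnitalCStarAlgebra E] (φ : A ⊗[ℂ] B →⋆ₙₐ[ℂ] E) (a : A)
    (b : B) (ha : ‖a‖ ≤ 1) (hb : ‖b‖ ≤ 1) : ‖φ (a ⊗ₜ b)‖ ≤ 1 := by
  obtain ⟨s, hs⟩ := CStarAlgebra.nonneg_iff_eq_star_mul_self.mp
    (sub_nonneg.mpr (sq_le_self_of_norm_le_one a ha))
  obtain ⟨t, ht⟩ := CStarAlgebra.nonneg_iff_eq_star_mul_self.mp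
    (sub_nonneg.mpr (sq_le_self_of_norm_le_one b hb))
  set h := star a * a with hh
  set k := star b * b with hk
  have hhs : star h = h := by simp [hh]
  set x := φ (h ⊗ₜ k) with hx
  have hx1 : x = star (φ (a ⊗ₜ b)) * φ (a ⊗ₜ b) := by
    rw [hx, ← map_star, ← map_mul, TensorProduct.star_tmul, Algebra.TensorProduct.tmul_mul_tmul]
  have key : x - x * x = star (φ (s ⊗ₜ b)) * φ (s ⊗ₜ b) + star (φ (h ⊗ₜ t)) * φ (h ⊗ₜ t) := by
    simp only [hx, ← map_star, ← map_mul, TensorProduct.star_tmul, ← map_sub, ← map_add,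
      Algebra.TensorProduct.tmul_mul_tmul, ← hs, ← ht, hhs]
    rw [TensorProduct.sub_tmul, TensorProduct.tmul_sub, ← hk]
    congr 1
    abel
  have hle : x * x ≤ x := by
    rw [← sub_nonneg, key]
    exact add_nonneg (star_mul_self_nonneg _) (star_mul_self_nonneg _)
  have hsa : star x = x := by rw [hx1]; simp
  have hn : ‖x * x‖ = ‖x‖ * ‖x‖ := by
    conv_lhs => rw [← hsa]
    rw [hsa, ← CStarRing.norm_star_mul_self, hsa]
  have h0 : 0 ≤ x * x := by
    have := star_mul_self_nonneg x
    rwa [hsa] at this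
  have h1 := CStarAlgebra.norm_le_norm_of_nonneg_of_le h0 hle
  have h2 : ‖x‖ = ‖φ (a ⊗ₜ b)‖ * ‖φ (a ⊗ₜ b)‖ := by
    rw [hx1, CStarRing.norm_star_mul_self]
  have h3 := norm_nonneg (φ (a ⊗ₜ b))
  have h4 : ‖x‖ ≤ 1 := by
    by_contra! hc
    nlinarith
  nlinarith

end Bound

variable {A B} in
theorem seminorm_tmul_le (p : CStarSeminorm (A ⊗[ℂ] B)) (a : A) (b : B) :
    p (a ⊗ₜ b) ≤ ‖a‖ * ‖b‖ := by
  rcases eq_or_ne a 0 with rfl | ha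
  · simp
  rcases eq_or_ne b 0 with rfl | hb
  · simp
  have ha' := norm_pos_iff.mpr ha
  have hb' := norm_pos_iff.mpr hb
  have h := norm_tmul_le_one (toCompletion p) (((‖a‖⁻¹ : ℝ) : ℂ) • a) (((‖b‖⁻¹ : ℝ) : ℂ) • b)
    (by rw [norm_smul]; simp [ha'.ne']) (by rw [norm_smul]; simp [hb'.ne'])
  rw [norm_toCompletion, TensorProduct.smul_tmul_smul, map_smul_eq_mul] at h
  simp only [norm_mul, Complex.norm_real, norm_inv, norm_norm] at h
  rw [← mul_inv, inv_mul_le_iff₀ (by positivity), mul_one] at h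
  exact h

instance : HasEnvelope (A ⊗[ℂ] B) where
  bddAbove x := by
    induction x using TensorProduct.induction_on with
    | zero => exact ⟨0, by rintro _ ⟨p, rfl⟩; simp⟩
    | add x y hx hy =>
      obtain ⟨C, hC⟩ := hx
      obtain ⟨C', hC'⟩ := hy
      refine ⟨C + C', ?_⟩
      rintro _ ⟨p, rfl⟩
      exact (map_add_le_add p.toSeminorm x y).trans (add_le_add (hC ⟨p, rfl⟩) (hC' ⟨p, rfl⟩))
    | tmul a b =>
      refine ⟨‖a‖ * ‖b‖, ?_⟩
      rintro _ ⟨p, rfl⟩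
      exact seminorm_tmul_le p a b

/-- The maximal tensor product of two C⋆-algebras: the enveloping C⋆-algebra of the algebraic
tensor product. -/
def MaxTensor : Type _ := CStarEnv (A ⊗[ℂ] B)

instance : NonUnitalCStarAlgebra (MaxTensor A B) :=
  (inferInstance : NonUnitalCStarAlgebra (CStarEnv (A ⊗[ℂ] B)))

/-- The universal representation of the algebraic tensor product. -/
def ofAlg : A ⊗[ℂ] B →⋆ₙₐ[ℂ] MaxTensor A B := toEnv (A ⊗[ℂ] B)

variable {A B} in
theorem norm_ofAlg (x : A ⊗[ℂ] B) : ‖ofAlg A B x‖ = maxSeminorm (A ⊗[ℂ] B) x := norm_toEnv x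

theorem denseRange_ofAlg : DenseRange (ofAlg A B) := denseRange_toEnv (X := A ⊗[ℂ] B)

variable {A B C}

/-- The elementary tensor `a ⊗ b` in the maximal tensor product. -/
def tmul (a : A) (b : B) : MaxTensor A B := ofAlg A B (a ⊗ₜ[ℂ] b)

theorem norm_tmul_le (a : A) (b : B) : ‖tmul a b‖ ≤ ‖a‖ * ‖b‖ := by
  rw [tmul, norm_ofAlg]
  exact seminorm_tmul_le _ a b

theorem tmul_mul_tmul (a a' : A) (b b' : B) :
    tmul a b * tmul a' b' = tmul (a * a') (b * b') := by
  simp only [tmul, ← map_mul, Algebra.TensorProduct.tmul_mul_tmul]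

theorem star_tmul (a : A) (b : B) : star (tmul a b) = tmul (star a) (star b) := by
  simp only [tmul, ← map_star, TensorProduct.star_tmul]

variable (A B) in
/-- The bilinear map `(a, b) ↦ a ⊗ b`. -/
def tmulBilin : A →ₗ[ℂ] B →ₗ[ℂ] MaxTensor A B :=
  LinearMap.mk₂ ℂ tmul
    (fun a a' b => by simp only [tmul, TensorProduct.add_tmul, map_add])
    (fun c a b => by simp only [tmul, ← TensorProduct.smul_tmul', map_smul])
    (fun a b b' => by simp only [tmul, TensorProduct.tmul_add, map_add])
    (fun c a b => by simp only [tmul, TensorProduct.tmul_smul, map_smul])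

theorem tmulBilin_apply (a : A) (b : B) : tmulBilin A B a b = tmul a b := rfl

theorem maxTensor_hom_ext {E : Type*} [NonUnitalCStarAlgebra E] {π ρ : MaxTensor A B →⋆ₙₐ[ℂ] E}
    (h : ∀ x, π (ofAlg A B x) = ρ (ofAlg A B x)) : π = ρ :=
  DFunLike.coe_injective
    ((denseRange_ofAlg A B).equalizer (continuous_hom π) (continuous_hom ρ) (funext h))

theorem tensor_hom_ext {E : Type*} [NonUnitalCStarAlgebra E] {π ρ : MaxTensor A B →⋆ₙₐ[ℂ] E}
    (h : ∀ a b, π (tmul a b) = ρ (tmul a b)) : π = ρ :=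
  maxTensor_hom_ext fun x => by
    induction x using TensorProduct.induction_on with
    | zero => simp
    | add x y hx hy => rw [map_add, map_add, map_add, hx, hy]
    | tmul a b => exact h a b

section Lift

variable {E : Type*} [NonUnitalCStarAlgebra E] (f : A →ₗ[ℂ] B →ₗ[ℂ] E)
  (hmul : ∀ a a' b b', f (a * a') (b * b') = f a b * f a' b')
  (hstar : ∀ a b, f (star a) (star b) = star (f a b))

/-- The representation of the algebraic tensor product given by a bilinear map that is
multiplicative and involutive on elementary tensors. -/
def algTensorLift : A ⊗[ℂ] B →⋆ₙₐ[ℂ] E :=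
  { toFun := TensorProduct.lift f
    map_smul' := map_smul _
    map_zero' := map_zero _
    map_add' := map_add _
    map_mul' := fun x y => by
      induction x using TensorProduct.induction_on with
      | zero => simp
      | add x x' hx hx' => rw [add_mul, map_add, hx, hx', map_add, add_mul]
      | tmul a b =>
        induction y using TensorProduct.induction_on with
        | zero => simp
        | add y y' hy hy' => rw [mul_add, map_add, hy, hy', map_add, mul_add]
        | tmul a' b' =>
          rw [Algebra.TensorProduct.tmul_mul_tmul, TensorProduct.lift.tmul,
            TensorProduct.lift.tmul, TensorProduct.lift.tmul, hmul]
    map_star' := fun x => by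
      induction x using TensorProduct.induction_on with
      | zero => simp
      | add x x' hx hx' => rw [star_add, map_add, hx, hx', map_add, star_add]
      | tmul a b =>
        rw [TensorProduct.star_tmul, TensorProduct.lift.tmul, TensorProduct.lift.tmul, hstar] }

/-- The extension of such a bilinear map to the maximal tensor product. -/
def tensorLift : MaxTensor A B →⋆ₙₐ[ℂ] E := envLift (algTensorLift f hmul hstar)

theorem tensorLift_tmul (a : A) (b : B) : tensorLift f hmul hstar (tmul a b) = f a b :=
  (envLift_toEnv _ _).trans (TensorProduct.lift.tmul a b)

end Lift

section Map

variable {A' B' A'' B'' : Type*} [NonUnitalCStarAlgebra A'] [NonUnitalCStarAlgebra B']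
  [NonUnitalCStarAlgebra A''] [NonUnitalCStarAlgebra B'']

/-- The ⋆-homomorphism `φ ⊗ ψ` between maximal tensor products. -/
def tensorMap (φ : A →⋆ₙₐ[ℂ] A') (ψ : B →⋆ₙₐ[ℂ] B') : MaxTensor A B →⋆ₙₐ[ℂ] MaxTensor A' B' :=
  tensorLift ((tmulBilin A' B').compl₁₂ (φ : A →ₗ[ℂ] A') (ψ : B →ₗ[ℂ] B'))
    (fun a a' b b' => by
      simp only [LinearMap.compl₁₂_apply, LinearMap.coe_coe, tmulBilin_apply, map_mul,
        tmul_mul_tmul])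
    (fun a b => by
      simp only [LinearMap.compl₁₂_apply, LinearMap.coe_coe, tmulBilin_apply, map_star, star_tmul])

theorem tensorMap_tmul (φ : A →⋆ₙₐ[ℂ] A') (ψ : B →⋆ₙₐ[ℂ] B') (a : A) (b : B) :
    tensorMap φ ψ (tmul a b) = tmul (φ a) (ψ b) := tensorLift_tmul _ _ _ a b

theorem tensorMap_comp (φ' : A' →⋆ₙₐ[ℂ] A'') (ψ' : B' →⋆ₙₐ[ℂ] B'') (φ : A →⋆ₙₐ[ℂ] A')
    (ψ : B →⋆ₙₐ[ℂ] B') :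
    (tensorMap φ' ψ').comp (tensorMap φ ψ) = tensorMap (φ'.comp φ) (ψ'.comp ψ) :=
  tensor_hom_ext fun a b => by
    simp only [NonUnitalStarAlgHom.comp_apply, tensorMap_tmul]

end Map

section Assoc

attribute [local instance] CStarAlgebra.spectralOrder CStarAlgebra.spectralOrderedRing

/-- The linear map `(a ⊗ b, c) ↦ a ⊗ (b ⊗ c)` on the algebraic level. -/
def tri : A ⊗[ℂ] B →ₗ[ℂ] C →ₗ[ℂ] MaxTensor A (MaxTensor B C) :=
  TensorProduct.lift
    (LinearMap.mk₂ ℂ (fun a b => (tmulBilin A (MaxTensor B C) a).comp (tmulBilin B C b))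
      (fun a a' b => by ext c; simp)
      (fun z a b => by ext c; simp)
      (fun a b b' => by ext c; simp)
      (fun z a b => by ext c; simp))

theorem tri_tmul (a : A) (b : B) (c : C) : tri (a ⊗ₜ b) c = tmul a (tmul b c) := rfl

theorem tri_mul (x y : A ⊗[ℂ] B) (c c' : C) : tri (x * y) (c * c') = tri x c * tri y c' := by
  induction x using TensorProduct.induction_on with
  | zero => simp
  | add x x' hx hx' =>
    rw [add_mul, map_add, LinearMap.add_apply, hx, hx', map_add, LinearMap.add_apply, add_mul]
  | tmul a b =>
    induction y using TensorProduct.induction_on with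
    | zero => simp
    | add y y' hy hy' =>
      rw [mul_add, map_add, LinearMap.add_apply, hy, hy', map_add, LinearMap.add_apply, mul_add]
    | tmul a' b' =>
      rw [Algebra.TensorProduct.tmul_mul_tmul, tri_tmul, tri_tmul, tri_tmul, tmul_mul_tmul,
        tmul_mul_tmul]

theorem tri_star (x : A ⊗[ℂ] B) (c : C) : tri (star x) (star c) = star (tri x c) := by
  induction x using TensorProduct.induction_on with
  | zero => simp
  | add x x' hx hx' =>
    rw [star_add, map_add, LinearMap.add_apply, hx, hx', map_add, LinearMap.add_apply, star_add]
  | tmul a b =>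
    rw [TensorProduct.star_tmul, tri_tmul, tri_tmul, star_tmul, star_tmul]

theorem exists_tri_bound (x : A ⊗[ℂ] B) : ∃ K : ℝ, ∀ c : C, ‖tri x c‖ ≤ K * ‖c‖ := by
  induction x using TensorProduct.induction_on with
  | zero => exact ⟨0, by simp⟩
  | add x y hx hy =>
    obtain ⟨K, hK⟩ := hx
    obtain ⟨K', hK'⟩ := hy
    refine ⟨K + K', fun c => ?_⟩
    rw [map_add, LinearMap.add_apply, add_mul]
    exact (norm_add_le _ _).trans (add_le_add (hK c) (hK' c))
  | tmul a b =>
    refine ⟨‖a‖ * ‖b‖, fun c => ?_⟩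
    rw [tri_tmul, mul_assoc]
    exact (norm_tmul_le _ _).trans
      (mul_le_mul_of_nonneg_left (norm_tmul_le _ _) (norm_nonneg _))

theorem continuous_tri (x : A ⊗[ℂ] B) : Continuous fun c : C => tri x c := by
  obtain ⟨K, hK⟩ := exists_tri_bound (C := C) x
  exact AddMonoidHomClass.continuous_of_bound (tri x) K hK

theorem bddAbove_tri (x : A ⊗[ℂ] B) :
    BddAbove (Set.range fun c : {c : C // ‖c‖ ≤ 1} => ‖tri x c.1‖) := by
  obtain ⟨K, hK⟩ := exists_tri_bound (C := C) x
  refine ⟨|K|, ?_⟩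
  rintro _ ⟨c, rfl⟩
  have h1 := hK c.1
  have h2 := c.2
  have h3 := norm_nonneg c.1
  have h4 := le_abs_self K
  nlinarith [abs_nonneg K, mul_le_mul_of_nonneg_right h4 h3]

theorem tri_le_iSup (x : A ⊗[ℂ] B) (c : C) (hc : ‖c‖ ≤ 1) :
    ‖tri x c‖ ≤ ⨆ c : {c : C // ‖c‖ ≤ 1}, ‖tri x c.1‖ :=
  le_ciSup (f := fun c : {c : C // ‖c‖ ≤ 1} => ‖tri x c.1‖) (bddAbove_tri x) ⟨c, hc⟩

variable (C) in
instance : Nonempty {c : C // ‖c‖ ≤ 1} := ⟨⟨0, by simp⟩⟩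

theorem iSup_tri_nonneg (x : A ⊗[ℂ] B) : 0 ≤ ⨆ c : {c : C // ‖c‖ ≤ 1}, ‖tri x c.1‖ :=
  Real.iSup_nonneg fun _ => norm_nonneg _

theorem iSup_tri_mul_le (x y : A ⊗[ℂ] B) :
    ⨆ c : {c : C // ‖c‖ ≤ 1}, ‖tri (x * y) c.1‖ ≤
      (⨆ c : {c : C // ‖c‖ ≤ 1}, ‖tri x c.1‖) * ⨆ c : {c : C // ‖c‖ ≤ 1}, ‖tri y c.1‖ := by
  refine ciSup_le fun c => ?_
  have hu := CStarAlgebra.increasingApproximateUnit C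
  have := hu.neBot
  refine le_of_tendsto
    (((continuous_tri (x * y)).norm.tendsto c.1).comp (hu.tendsto_mul_left c.1)) ?_
  filter_upwards [hu.eventually_norm] with e he
  simp only [Function.comp_apply]
  rw [tri_mul]
  exact (norm_mul_le _ _).trans (mul_le_mul (tri_le_iSup x c.1 c.2) (tri_le_iSup y e he)
    (norm_nonneg _) (iSup_tri_nonneg x))

theorem iSup_tri_star (x : A ⊗[ℂ] B) :
    ⨆ c : {c : C // ‖c‖ ≤ 1}, ‖tri (star x) c.1‖ ≤ ⨆ c : {c : C // ‖c‖ ≤ 1}, ‖tri x c.1‖ := by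
  refine ciSup_le fun c => ?_
  rw [← norm_star, ← tri_star, star_star]
  exact tri_le_iSup x _ (by rw [norm_star]; exact c.2)

variable (A B C) in
/-- An auxiliary C⋆-seminorm on the algebraic tensor product. -/
def triSeminorm : CStarSeminorm (A ⊗[ℂ] B) where
  toFun x := ⨆ c : {c : C // ‖c‖ ≤ 1}, ‖tri x c.1‖
  map_zero' := by simp
  add_le' x y := ciSup_le fun c => by
    rw [map_add, LinearMap.add_apply]
    exact (norm_add_le _ _).trans (add_le_add (tri_le_iSup x c.1 c.2) (tri_le_iSup y c.1 c.2))
  neg' x := by simp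
  smul' z x := by
    simp_rw [map_smul, LinearMap.smul_apply, norm_smul, Real.mul_iSup_of_nonneg (norm_nonneg z)]
  mul_le' := iSup_tri_mul_le
  star_mul_self' x := by
    refine le_antisymm ?_ ?_
    · rw [sq]
      exact (iSup_tri_mul_le _ _).trans
        (mul_le_mul_of_nonneg_right (iSup_tri_star x) (iSup_tri_nonneg x))
    · rw [← Real.le_sqrt (iSup_tri_nonneg x) (iSup_tri_nonneg _)]
      refine ciSup_le fun c => Real.le_sqrt_of_sq_le ?_
      rw [sq, ← CStarRing.norm_star_mul_self, ← tri_star, ← tri_mul]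
      refine tri_le_iSup _ _ ?_
      rw [CStarRing.norm_star_mul_self]
      nlinarith [norm_nonneg c.1, c.2]

theorem norm_tri_le (x : A ⊗[ℂ] B) (c : C) :
    ‖tri x c‖ ≤ ‖c‖ * maxSeminorm (A ⊗[ℂ] B) x := by
  rcases eq_or_ne c 0 with rfl | hc
  · simp
  have hc' := norm_pos_iff.mpr hc
  have h1 := tri_le_iSup x (((‖c‖⁻¹ : ℝ) : ℂ) • c) (by rw [norm_smul]; simp [hc'.ne'])
  have h2 := le_maxSeminorm (triSeminorm A B C) x
  have h3 := h1.trans h2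
  rw [map_smul, norm_smul, Complex.norm_real, norm_inv, norm_norm, inv_mul_le_iff₀ hc'] at h3
  exact h3

/-- The extension of a bounded linear map to the maximal tensor product. -/
def tensorExtend {E : Type*} [NormedAddCommGroup E] [NormedSpace ℂ E] [CompleteSpace E]
    (f : A ⊗[ℂ] B →ₗ[ℂ] E) (K : ℝ) (h : ∀ x, ‖f x‖ ≤ K * maxSeminorm (A ⊗[ℂ] B) x) :
    MaxTensor A B →L[ℂ] E := envExtend f K h

theorem tensorExtend_ofAlg {E : Type*} [NormedAddCommGroup E] [NormedSpace ℂ E] [CompleteSpace E]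
    (f : A ⊗[ℂ] B →ₗ[ℂ] E) (K : ℝ) (h : ∀ x, ‖f x‖ ≤ K * maxSeminorm (A ⊗[ℂ] B) x)
    (x : A ⊗[ℂ] B) : tensorExtend f K h (ofAlg A B x) = f x := envExtend_toEnv f K h x

/-- The map `x ↦ x ⊗ c` on `A ⊗ B`, where `(a ⊗ b) ⊗ c = a ⊗ (b ⊗ c)`. -/
def triRight (c : C) : MaxTensor A B →L[ℂ] MaxTensor A (MaxTensor B C) :=
  tensorExtend (tri.flip c) ‖c‖ (fun x => norm_tri_le x c)

theorem triRight_ofAlg (c : C) (x : A ⊗[ℂ] B) : triRight c (ofAlg A B x) = tri x c :=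
  tensorExtend_ofAlg _ _ _ x

/-- The bilinear map `(x, c) ↦ x ⊗ c` on `A ⊗ B` and `C`. -/
def triExtend : MaxTensor A B →ₗ[ℂ] C →ₗ[ℂ] MaxTensor A (MaxTensor B C) :=
  LinearMap.mk₂ ℂ (fun x c => triRight c x)
    (fun x y c => map_add (triRight c) x y) (fun z x c => map_smul (triRight c) z x)
    (fun x c c' => by
      refine (denseRange_ofAlg A B).induction_on (p := fun x : MaxTensor A B =>
        triRight (c + c') x = triRight c x + triRight c' x) x
        (isClosed_eq (triRight _).continuous
          ((triRight c).continuous.add (triRight c').continuous)) (fun x => ?_)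
      rw [triRight_ofAlg, triRight_ofAlg, triRight_ofAlg, map_add])
    (fun z x c => by
      refine (denseRange_ofAlg A B).induction_on (p := fun x : MaxTensor A B =>
        triRight (z • c) x = z • triRight c x) x
        (isClosed_eq (triRight _).continuous ((triRight c).continuous.const_smul z))
        (fun x => ?_)
      rw [triRight_ofAlg, triRight_ofAlg, map_smul])

theorem triExtend_ofAlg (x : A ⊗[ℂ] B) (c : C) : triExtend (ofAlg A B x) c = tri x c :=
  triRight_ofAlg c x

theorem continuous_triExtend (c : C) :
    Continuous fun x : MaxTensor A B => triExtend x c :=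
  (triRight c).continuous

variable (A B C) in
/-- The canonical isomorphism `(A ⊗ B) ⊗ C → A ⊗ (B ⊗ C)`, `(a ⊗ b) ⊗ c ↦ a ⊗ (b ⊗ c)`. -/
def tensorAssoc : MaxTensor (MaxTensor A B) C →⋆ₙₐ[ℂ] MaxTensor A (MaxTensor B C) :=
  tensorLift triExtend
    (fun x y c c' => by
      have := continuous_triExtend (A := A) (B := B) (c * c')
      have := continuous_triExtend (A := A) (B := B) c
      have := continuous_triExtend (A := A) (B := B) c'
      refine (denseRange_ofAlg A B).induction_on₂ (p := fun x y : MaxTensor A B =>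
        triExtend (x * y) (c * c') = triExtend x c * triExtend y c')
        (isClosed_eq (by fun_prop) (by fun_prop)) (fun x y => ?_) x y
      rw [← map_mul, triExtend_ofAlg, triExtend_ofAlg, triExtend_ofAlg, tri_mul])
    (fun x c => by
      have := continuous_triExtend (A := A) (B := B) c
      have := continuous_triExtend (A := A) (B := B) (star c)
      refine (denseRange_ofAlg A B).induction_on (p := fun x : MaxTensor A B =>
        triExtend (star x) (star c) = star (triExtend x c)) x
        (isClosed_eq (by fun_prop) (by fun_prop)) (fun x => ?_)
      rw [← map_star, triExtend_ofAlg, triExtend_ofAlg, tri_star])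

theorem tensorAssoc_tmul (a : A) (b : B) (c : C) :
    tensorAssoc A B C (tmul (tmul a b) c) = tmul a (tmul b c) :=
  (tensorLift_tmul _ _ _ _ _).trans ((triExtend_ofAlg _ _).trans (tri_tmul a b c))

/-- Homomorphisms on a threefold tensor product are determined by elementary tensors. -/
theorem tensor_hom_ext₃ {E : Type*} [NonUnitalCStarAlgebra E]
    {π ρ : MaxTensor (MaxTensor A B) C →⋆ₙₐ[ℂ] E}
    (h : ∀ a b c, π (tmul (tmul a b) c) = ρ (tmul (tmul a b) c)) : π = ρ :=
  tensor_hom_ext fun x c => by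
    have hc : Continuous fun x : MaxTensor A B => tmul x c :=
      AddMonoidHomClass.continuous_of_bound ((tmulBilin (MaxTensor A B) C).flip c) ‖c‖
        fun x => (norm_tmul_le x c).trans_eq (mul_comm _ _)
    have hπ := continuous_hom π
    have hρ := continuous_hom ρ
    refine (denseRange_ofAlg A B).induction_on (p := fun x : MaxTensor A B =>
      π (tmul x c) = ρ (tmul x c)) x (isClosed_eq (by fun_prop) (by fun_prop)) (fun x => ?_)
    induction x using TensorProduct.induction_on with
    | zero =>
      have : tmul (ofAlg A B 0) c = 0 := by
        rw [map_zero, ← tmulBilin_apply, map_zero, LinearMap.zero_apply]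
      rw [this, map_zero, map_zero]
    | add x y hx hy =>
      have : tmul (ofAlg A B (x + y)) c = tmul (ofAlg A B x) c + tmul (ofAlg A B y) c := by
        rw [map_add, ← tmulBilin_apply, map_add, LinearMap.add_apply]
        rfl
      rw [this, map_add, map_add, hx, hy]
    | tmul a b => exact h a b c

theorem tensorAssoc_natural {A' B' C' : Type*} [NonUnitalCStarAlgebra A']
    [NonUnitalCStarAlgebra B'] [NonUnitalCStarAlgebra C'] (f : A →⋆ₙₐ[ℂ] A') (g : B →⋆ₙₐ[ℂ] B')
    (h : C →⋆ₙₐ[ℂ] C') :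
    (tensorAssoc A' B' C').comp (tensorMap (tensorMap f g) h) =
      (tensorMap f (tensorMap g h)).comp (tensorAssoc A B C) :=
  tensor_hom_ext₃ fun a b c => by
    simp only [NonUnitalStarAlgHom.comp_apply, tensorMap_tmul, tensorAssoc_tmul]

end Assoc

end Tensor

/-! ### The comultiplication of `C⋆(Γ)` -/

section Comul

variable (Γ : Type*) [Group Γ]

/-- The comultiplication `Δ : C⋆(Γ) → C⋆(Γ) ⊗ C⋆(Γ)`, `γ ↦ γ ⊗ γ`. -/
def comul : GroupCStar Γ →⋆ₙₐ[ℂ] MaxTensor (GroupCStar Γ) (GroupCStar Γ) :=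
  envLift (groupAlgebraLift (fun γ : Γ => tmul (GroupCStar.of γ) (GroupCStar.of γ))
    (fun γ γ' => by rw [tmul_mul_tmul, GroupCStar.of_mul])
    (fun γ => by rw [star_tmul, GroupCStar.of_inv]))

theorem comul_of (γ : Γ) :
    comul Γ (GroupCStar.of γ) = tmul (GroupCStar.of γ) (GroupCStar.of γ) :=
  (envLift_toEnv _ _).trans (groupAlgebraLift_single _ _ _ γ)

end Comul

/-! ### `(ℂ,Γ)`-C⋆-algebras and their cotensor product -/

section Cotensor

open NonUnitalStarAlgHom (id)

/-- The structure of a `(ℂ,Γ)`-C⋆-algebra on a C⋆-algebra `A` (not necessarily unital): two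
commuting coactions of `C⋆(Γ)` on `A`, from the left and from the right. -/
structure CGammaStructure (Γ : Type*) [Group Γ] (A : Type*) [NonUnitalCStarAlgebra A] where
  /-- The left coaction `δ`. -/
  left : A →⋆ₙₐ[ℂ] MaxTensor (GroupCStar Γ) A
  /-- The right coaction `δ'`. -/
  right : A →⋆ₙₐ[ℂ] MaxTensor A (GroupCStar Γ)
  left_injective : Function.Injective left
  right_injective : Function.Injective right
  /-- `(id ⊗ δ) ∘ δ = (Δ ⊗ id) ∘ δ`. -/
  left_coassoc : (tensorMap (id ℂ (GroupCStar Γ)) left).comp left =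
    (tensorAssoc (GroupCStar Γ) (GroupCStar Γ) A).comp ((tensorMap (comul Γ) (id ℂ A)).comp left)
  /-- `(δ' ⊗ id) ∘ δ' = (id ⊗ Δ) ∘ δ'`. -/
  right_coassoc :
    (tensorAssoc A (GroupCStar Γ) (GroupCStar Γ)).comp
      ((tensorMap right (id ℂ (GroupCStar Γ))).comp right) =
    (tensorMap (id ℂ A) (comul Γ)).comp right
  /-- `(δ ⊗ id) ∘ δ' = (id ⊗ δ') ∘ δ`. -/
  left_right :
    (tensorAssoc (GroupCStar Γ) A (GroupCStar Γ)).comp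
      ((tensorMap left (id ℂ (GroupCStar Γ))).comp right) =
    (tensorMap (id ℂ (GroupCStar Γ)) right).comp left

variable {Γ : Type*} [Group Γ]
  {A B A' B' : Type*} [NonUnitalCStarAlgebra A] [NonUnitalCStarAlgebra B]
  [NonUnitalCStarAlgebra A'] [NonUnitalCStarAlgebra B']

/-- Morphisms of `(ℂ,Γ)`-C⋆-algebras: ⋆-homomorphisms that intertwine the coactions. -/
structure IsMorphism (cA : CGammaStructure Γ A) (cB : CGammaStructure Γ B) (π : A →⋆ₙₐ[ℂ] B) :
    Prop where
  left : cB.left.comp π = (tensorMap (id ℂ (GroupCStar Γ)) π).comp cA.left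
  right : cB.right.comp π = (tensorMap π (id ℂ (GroupCStar Γ))).comp cA.right

theorem tensorMap_id (A B : Type*) [NonUnitalCStarAlgebra A] [NonUnitalCStarAlgebra B] :
    tensorMap (id ℂ A) (id ℂ B) = id ℂ (MaxTensor A B) :=
  tensor_hom_ext fun a b => by rw [tensorMap_tmul]; rfl

theorem IsMorphism.refl (cA : CGammaStructure Γ A) : IsMorphism cA cA (id ℂ A) where
  left := by rw [tensorMap_id]; rfl
  right := by rw [tensorMap_id]; rfl

/-- A short exact sequence `J → A → C` of `(ℂ,Γ)`-C⋆-algebras. -/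
structure IsShortExact {J A C : Type*} [NonUnitalCStarAlgebra J] [NonUnitalCStarAlgebra A]
    [NonUnitalCStarAlgebra C] (cJ : CGammaStructure Γ J) (cA : CGammaStructure Γ A)
    (cC : CGammaStructure Γ C) (ι : J →⋆ₙₐ[ℂ] A) (π : A →⋆ₙₐ[ℂ] C) : Prop where
  morphism_ι : IsMorphism cJ cA ι
  morphism_π : IsMorphism cA cC π
  ker_ι : ∀ x, ι x = 0 → x = 0
  range_ι : Set.range ι = {a | π a = 0}
  range_π : Set.range π = Set.univ

/-- The subalgebra `{x ∈ A ⊗ B : (δ'_A ⊗ id) x = (id ⊗ δ_B) x}` of the maximal tensor product. -/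
def cotensorSubalgebra (cA : CGammaStructure Γ A) (cB : CGammaStructure Γ B) :
    NonUnitalStarSubalgebra ℂ (MaxTensor A B) where
  carrier := {x | tensorAssoc A (GroupCStar Γ) B (tensorMap cA.right (id ℂ B) x) =
    tensorMap (id ℂ A) cB.left x}
  add_mem' {x y} hx hy := by
    simp only [Set.mem_ofPred_eq] at hx hy ⊢
    rw [map_add, map_add, map_add, hx, hy]
  zero_mem' := by simp
  mul_mem' {x y} hx hy := by
    simp only [Set.mem_ofPred_eq] at hx hy ⊢
    rw [map_mul, map_mul, map_mul, hx, hy]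
  smul_mem' c x hx := by
    simp only [Set.mem_ofPred_eq] at hx ⊢
    rw [map_smul, map_smul, map_smul, hx]
  star_mem' {x} hx := by
    simp only [Set.mem_ofPred_eq] at hx ⊢
    rw [map_star, map_star, map_star, hx]

theorem mem_cotensorSubalgebra (cA : CGammaStructure Γ A) (cB : CGammaStructure Γ B)
    (x : MaxTensor A B) : x ∈ cotensorSubalgebra cA cB ↔
      tensorAssoc A (GroupCStar Γ) B (tensorMap cA.right (id ℂ B) x) =
        tensorMap (id ℂ A) cB.left x := Iff.rfl

theorem isClosed_cotensorSubalgebra (cA : CGammaStructure Γ A) (cB : CGammaStructure Γ B) :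
    IsClosed (cotensorSubalgebra cA cB : Set (MaxTensor A B)) :=
  isClosed_eq ((continuous_hom _).comp (continuous_hom _)) (continuous_hom _)

/-- The maximal cotensor product of two `(ℂ,Γ)`-C⋆-algebras `A` and `B`. -/
def Cotensor (cA : CGammaStructure Γ A) (cB : CGammaStructure Γ B) : Type _ :=
  cotensorSubalgebra cA cB

instance (cA : CGammaStructure Γ A) (cB : CGammaStructure Γ B) :
    NonUnitalCStarAlgebra (Cotensor cA cB) :=
  NonUnitalStarSubalgebra.nonUnitalCStarAlgebra (cotensorSubalgebra cA cB)
    (h_closed := isClosed_cotensorSubalgebra cA cB)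

/-- The inclusion of the cotensor product into the maximal tensor product. -/
def cotensorIncl (cA : CGammaStructure Γ A) (cB : CGammaStructure Γ B) :
    Cotensor cA cB →⋆ₙₐ[ℂ] MaxTensor A B :=
  NonUnitalStarSubalgebraClass.subtype (cotensorSubalgebra cA cB)

theorem cotensorIncl_injective (cA : CGammaStructure Γ A) (cB : CGammaStructure Γ B) :
    Function.Injective (cotensorIncl cA cB) := Subtype.val_injective

theorem range_cotensorIncl (cA : CGammaStructure Γ A) (cB : CGammaStructure Γ B) :
    Set.range (cotensorIncl cA cB) = cotensorSubalgebra cA cB := Subtype.range_val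

theorem tensorMap_mem_cotensor {cA : CGammaStructure Γ A} {cB : CGammaStructure Γ B}
    {cA' : CGammaStructure Γ A'} {cB' : CGammaStructure Γ B'} {φ : A →⋆ₙₐ[ℂ] A'}
    {ψ : B →⋆ₙₐ[ℂ] B'} (hφ : IsMorphism cA cA' φ) (hψ : IsMorphism cB cB' ψ)
    (x : MaxTensor A B) (hx : x ∈ cotensorSubalgebra cA cB) :
    tensorMap φ ψ x ∈ cotensorSubalgebra cA' cB' := by
  rw [mem_cotensorSubalgebra] at hx ⊢
  have h1 : (tensorMap cA'.right (id ℂ B')).comp (tensorMap φ ψ) =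
      (tensorMap (tensorMap φ (id ℂ (GroupCStar Γ))) ψ).comp (tensorMap cA.right (id ℂ B)) := by
    rw [tensorMap_comp, tensorMap_comp, hφ.right]
    rfl
  have h2 : (tensorMap (id ℂ A') cB'.left).comp (tensorMap φ ψ) =
      (tensorMap φ (tensorMap (id ℂ (GroupCStar Γ)) ψ)).comp (tensorMap (id ℂ A) cB.left) := by
    rw [tensorMap_comp, tensorMap_comp, hψ.left]
    rfl
  have h3 := DFunLike.congr_fun (tensorAssoc_natural φ (id ℂ (GroupCStar Γ)) ψ)
    (tensorMap cA.right (id ℂ B) x)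
  rw [NonUnitalStarAlgHom.comp_apply, NonUnitalStarAlgHom.comp_apply] at h3
  rw [← NonUnitalStarAlgHom.comp_apply (tensorMap cA'.right (id ℂ B')), h1,
    ← NonUnitalStarAlgHom.comp_apply (tensorMap (id ℂ A') cB'.left), h2,
    NonUnitalStarAlgHom.comp_apply, NonUnitalStarAlgHom.comp_apply, h3, hx]

/-- The restriction of `φ ⊗ ψ` to the cotensor products, for morphisms `φ` and `ψ`. -/
def cotensorMap {cA : CGammaStructure Γ A} {cB : CGammaStructure Γ B}
    {cA' : CGammaStructure Γ A'} {cB' : CGammaStructure Γ B'} {φ : A →⋆ₙₐ[ℂ] A'}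
    {ψ : B →⋆ₙₐ[ℂ] B'} (hφ : IsMorphism cA cA' φ) (hψ : IsMorphism cB cB' ψ) :
    Cotensor cA cB →⋆ₙₐ[ℂ] Cotensor cA' cB' :=
  NonUnitalStarAlgHom.codRestrict ((tensorMap φ ψ).comp (cotensorIncl cA cB))
    (cotensorSubalgebra cA' cB') fun x => tensorMap_mem_cotensor hφ hψ _ x.2

theorem cotensorIncl_cotensorMap {cA : CGammaStructure Γ A} {cB : CGammaStructure Γ B}
    {cA' : CGammaStructure Γ A'} {cB' : CGammaStructure Γ B'} {φ : A →⋆ₙₐ[ℂ] A'}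
    {ψ : B →⋆ₙₐ[ℂ] B'} (hφ : IsMorphism cA cA' φ) (hψ : IsMorphism cB cB' ψ)
    (x : Cotensor cA cB) :
    cotensorIncl cA' cB' (cotensorMap hφ hψ x) = tensorMap φ ψ (cotensorIncl cA cB x) := rfl

/-- The condition that the coactions on the cotensor product are the restrictions of the coactions
`δ_A ⊗ id` and `id ⊗ δ'_B` on `A ⊗ B`. -/
structure IsRestriction (cA : CGammaStructure Γ A) (cB : CGammaStructure Γ B)
    (c : CGammaStructure Γ (Cotensor cA cB)) : Prop where
  left : (tensorMap (id ℂ (GroupCStar Γ)) (cotensorIncl cA cB)).comp c.left =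
    (tensorAssoc (GroupCStar Γ) A B).comp
      ((tensorMap cA.left (id ℂ B)).comp (cotensorIncl cA cB))
  right : (tensorAssoc A B (GroupCStar Γ)).comp
      ((tensorMap (cotensorIncl cA cB) (id ℂ (GroupCStar Γ))).comp c.right) =
    (tensorMap (id ℂ A) cB.right).comp (cotensorIncl cA cB)

end Cotensor

end CGamma

end

noncomputable section

namespace CGamma

open Filter Topology

/-! ### Positive maps on ⋆-algebras -/

section Positive

attribute [local instance] CStarAlgebra.spectralOrder CStarAlgebra.spectralOrderedRing

/-! A coaction of `C⋆(Γ)` behaves like a grading by `Γ`: an element `a` has left degree `γ` if `δ(a)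
= γ ⊗ a`, and right degrees are defined in the same way. Let `τ` be the functional `γ ⊗ γ' ↦
δ_{γ,γ'}` on `C⋆(Γ) ⊗ C⋆(Γ)`. It is a vector functional of the representation on `ℓ²(Γ)` by left and
right translations, which exists on the maximal tensor product because these translations commute.
Slicing with `τ` extracts components of a given degree, and coassociativity together with the counit
shows that elements homogeneous on both sides are total (`dense_span_bihomogeneous`).

Applied to the two middle legs of `δ'_A ⊗ δ_B`, the slice gives a bounded map `cotensorProj` on `A ⊗
B`. It fixes `a ⊗ b` if the right degree of `a` equals the left degree of `b`, and kills it if the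
degrees differ. It is a projection onto the cotensor product, natural for morphisms, positive, and a
bimodule map over the cotensor product, hence a completely positive conditional expectation
(`isCP_of_bimodule`).

Exactness follows because the maximal tensor product is exact (`tensorMap_ideal_injective`,
`range_tensorMap_eq`, `tensorMap_surjective`) and a natural retract of an exact sequence is exact:
preimages are found in the tensor product and then projected.

For the coactions, the difficulty is that maximal tensor products need not preserve inclusions, so
`C⋆(Γ) ⊗ (A ⊗^Γ B)` has to be shown to embed into `C⋆(Γ) ⊗ (A ⊗ B)`. The expectation `P` provides
the bounded left inverse `id ⊗ P`. After that, existence is a computation on bihomogeneous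
elementary tensors, and uniqueness is the injectivity of the embedding.

The analytic input is that `id ⊗ P` is bounded for the maximal norm when `P` is completely positive
(`norm_le_of_positive`). A positive map `Q` defines the `L²`-seminorm `‖Q(x⋆x)‖^(1/2)`; the operator
norm of left multiplication for it is a C⋆-seminorm, hence below the maximal one, and approximate
units with Cauchy–Schwarz carry the bound over to `Q`. The constants are not optimal, since only
boundedness matters. -/

theorem norm_le_of_neg_le_of_le {E : Type*} [NonUnitalCStarAlgebra E] {h c : E} (hc : 0 ≤ c)
    (h1 : -c ≤ h) (h2 : h ≤ c) : ‖h‖ ≤ ‖c‖ := by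
  have hcs : IsSelfAdjoint c := .of_nonneg hc
  have hhs : IsSelfAdjoint h := by
    have : IsSelfAdjoint (c - h) := .of_nonneg (sub_nonneg.mpr h2)
    simpa using hcs.sub this
  -- The unitization supplies the scalar `‖c‖ · 1`, which dominates both `h` and `-h`.
  have e1 : (h : Unitization ℂ E) ≤ (c : Unitization ℂ E) := (Unitization.inr_le_iff h c).mpr h2
  have e2 : ((-c : E) : Unitization ℂ E) ≤ (h : Unitization ℂ E) :=
    (Unitization.inr_le_iff (-c) h hcs.neg).mpr h1
  have hcs' : IsSelfAdjoint (c : Unitization ℂ E) := hcs.inr ℂ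
  have hhs' : IsSelfAdjoint (h : Unitization ℂ E) := hhs.inr ℂ
  have e3 := hcs'.le_algebraMap_norm_self
  have e4 : (h : Unitization ℂ E) ≤ algebraMap ℝ _ ‖(c : Unitization ℂ E)‖ := e1.trans e3
  have e5 : -(h : Unitization ℂ E) ≤ algebraMap ℝ _ ‖(c : Unitization ℂ E)‖ := by
    refine le_trans ?_ e3
    rw [Unitization.inr_neg] at e2
    exact neg_le.mp e2
  rw [le_algebraMap_iff_spectrum_le hhs'] at e4
  rw [le_algebraMap_iff_spectrum_le hhs'.neg] at e5
  rw [← Unitization.norm_inr (𝕜 := ℂ) h, ← Unitization.norm_inr (𝕜 := ℂ) c]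
  -- For a self-adjoint element, `‖h‖` or `-‖h‖` is a spectral value, so bounding the spectra of `h`
  -- and `-h` bounds the norm.
  rcases CStarAlgebra.norm_or_neg_norm_mem_spectrum hhs' with h3 | h3
  · exact e4 _ h3
  · refine e5 _ ?_
    rw [← spectrum.neg_eq]
    simpa using h3

theorem le_two_mul_sqrt_of_forall {a b N : ℝ} (ha : 0 ≤ a) (hb : 0 ≤ b)
    (h : ∀ s : ℝ, 0 < s → s * N ≤ s ^ 2 * a + b) : N ≤ 2 * (√a * √b) := by
  have key : ∀ ε : ℝ, 0 < ε → N ≤ √a * (√b + ε) + √b * (√a + ε) := by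
    intro ε hε
    have ha' : 0 < √a + ε := by positivity
    have hb' : 0 < √b + ε := by positivity
    -- The minimum of `s a + b / s` is at `s = √b / √a`; the shift by `ε` keeps this meaningful when
    -- `a` or `b` vanishes.
    have h1 := h ((√b + ε) / (√a + ε)) (by positivity)
    have h2 : N ≤ (√b + ε) / (√a + ε) * a + (√a + ε) / (√b + ε) * b := by
      have h3 : (√b + ε) / (√a + ε) * N ≤ (√b + ε) / (√a + ε) *
          ((√b + ε) / (√a + ε) * a + (√a + ε) / (√b + ε) * b) := by
        refine h1.trans_eq ?_
        field_simp
      exact le_of_mul_le_mul_left h3 (by positivity)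
    have h4 : a / (√a + ε) ≤ √a := by
      rw [div_le_iff₀ ha']
      nlinarith [Real.mul_self_sqrt ha, Real.sqrt_nonneg a]
    have h5 : b / (√b + ε) ≤ √b := by
      rw [div_le_iff₀ hb']
      nlinarith [Real.mul_self_sqrt hb, Real.sqrt_nonneg b]
    calc N ≤ _ := h2
      _ = (a / (√a + ε)) * (√b + ε) + (b / (√b + ε)) * (√a + ε) := by ring
      _ ≤ _ := by gcongr
  have hc : Tendsto (fun ε : ℝ => √a * (√b + ε) + √b * (√a + ε)) (𝓝[>] 0)
      (𝓝 (√a * (√b + 0) + √b * (√a + 0))) :=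
    Tendsto.mono_left (Continuous.tendsto (by fun_prop) 0) nhdsWithin_le_nhds
  have h6 := ge_of_tendsto hc (by filter_upwards [self_mem_nhdsWithin] with ε hε using key ε hε)
  linarith

variable {X : Type*} [NonUnitalRing X] [StarRing X] [Module ℂ X] [IsScalarTower ℂ X X]
  [SMulCommClass ℂ X X] [StarModule ℂ X] {E : Type*} [NonUnitalCStarAlgebra E]

/-- The `L²`-norm `x ↦ ‖Q(x⋆x)‖^(1/2)` of a positive map. -/
def formNorm (Q : X →ₗ[ℂ] E) (x : X) : ℝ := √‖Q (star x * x)‖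

variable {Q : X →ₗ[ℂ] E} (hQ : ∀ x, 0 ≤ Q (star x * x))

theorem formNorm_nonneg (Q : X →ₗ[ℂ] E) (x : X) : 0 ≤ formNorm Q x := Real.sqrt_nonneg _

theorem formNorm_sq (Q : X →ₗ[ℂ] E) (x : X) : formNorm Q x ^ 2 = ‖Q (star x * x)‖ :=
  Real.sq_sqrt (norm_nonneg _)

theorem formNorm_smul (Q : X →ₗ[ℂ] E) (c : ℂ) (x : X) : formNorm Q (c • x) = ‖c‖ * formNorm Q x := by
  rw [formNorm, star_smul, smul_mul_smul_comm, map_smul, norm_smul, formNorm]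
  have : ‖star c * c‖ = ‖c‖ ^ 2 := by rw [norm_mul, norm_star, sq]
  rw [this, Real.sqrt_mul (by positivity), Real.sqrt_sq (norm_nonneg _)]

include hQ

/-- Cauchy–Schwarz for the symmetrized form, with the sharp constant. Positivity at `s x ± y`
squeezes `s N` between `±(s² Q(x⋆x) + Q(y⋆y))`; taking norms and optimizing over `s > 0` gives the
bound. -/
theorem formNorm_symm_le (x y : X) :
    ‖Q (star x * y) + Q (star y * x)‖ ≤ 2 * (formNorm Q x * formNorm Q y) := by
  refine le_two_mul_sqrt_of_forall (norm_nonneg _) (norm_nonneg _) fun s hs => ?_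
  set N := Q (star x * y) + Q (star y * x)
  have hsr : star ((s : ℂ) • x) = (s : ℂ) • star x := by
    rw [star_smul]; simp
  have e1 : Q (star ((s : ℂ) • x + y) * ((s : ℂ) • x + y)) =
      ((s ^ 2 : ℝ) : ℂ) • Q (star x * x) + Q (star y * y) + (s : ℂ) • N := by
    simp only [star_add, hsr, add_mul, mul_add, smul_mul_assoc, mul_smul_comm, map_add, map_smul,
      smul_add, N, smul_smul]
    push_cast
    rw [sq]
    abel
  have e2 : Q (star ((s : ℂ) • x - y) * ((s : ℂ) • x - y)) =
      ((s ^ 2 : ℝ) : ℂ) • Q (star x * x) + Q (star y * y) - (s : ℂ) • N := by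
    simp only [star_sub, hsr, sub_mul, mul_sub, smul_mul_assoc, mul_smul_comm, map_sub, map_smul,
      smul_add, smul_sub, N, smul_smul]
    push_cast
    rw [sq]
    abel
  have p1 := hQ ((s : ℂ) • x + y)
  have p2 := hQ ((s : ℂ) • x - y)
  rw [e1] at p1
  rw [e2] at p2
  set c := ((s ^ 2 : ℝ) : ℂ) • Q (star x * x) + Q (star y * y) with hc
  have hc0 : 0 ≤ c := by
    refine add_nonneg ?_ (hQ y)
    rw [Complex.coe_smul]
    exact smul_nonneg (by positivity) (hQ x)
  have h := norm_le_of_neg_le_of_le hc0 (h := (s : ℂ) • N) (neg_le_iff_add_nonneg'.mpr p1)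
    (sub_nonneg.mp p2)
  rw [norm_smul, Complex.norm_real, Real.norm_of_nonneg hs.le] at h
  refine h.trans ((norm_add_le _ _).trans_eq ?_)
  rw [norm_smul, Complex.norm_real, Real.norm_of_nonneg (by positivity)]

/-- Replacing `y` by `i y` turns the symmetric part of the form into the antisymmetric part. Adding
the two bounds costs a factor 2 against the usual Cauchy–Schwarz inequality. -/
theorem norm_form_le (x y : X) : ‖Q (star x * y)‖ ≤ 2 * (formNorm Q x * formNorm Q y) := by
  have h1 := formNorm_symm_le hQ x y
  have h2 := formNorm_symm_le hQ x (Complex.I • y)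
  rw [formNorm_smul, Complex.norm_I, one_mul, star_smul, mul_smul_comm, smul_mul_assoc, map_smul,
    map_smul] at h2
  have h3 : Complex.I • Q (star x * y) + star Complex.I • Q (star y * x) =
      Complex.I • (Q (star x * y) - Q (star y * x)) := by
    have : star Complex.I = -Complex.I := Complex.conj_I
    rw [this, smul_sub, neg_smul, sub_eq_add_neg]
  rw [h3, norm_smul, Complex.norm_I, one_mul] at h2
  have h4 : (2 : ℂ) • Q (star x * y) =
      (Q (star x * y) + Q (star y * x)) + (Q (star x * y) - Q (star y * x)) := by
    rw [two_smul]; abel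
  have h5 : ‖(2 : ℂ) • Q (star x * y)‖ ≤ _ := h4 ▸ norm_add_le _ _
  rw [norm_smul, Complex.norm_ofNat] at h5
  linarith

/-- The cross terms form exactly the symmetrized expression, for which Cauchy–Schwarz is sharp;
`norm_form_le` on each of them would be too weak. -/
theorem formNorm_add_le (x y : X) : formNorm Q (x + y) ≤ formNorm Q x + formNorm Q y := by
  refine abs_le_of_sq_le_sq' ?_ (add_nonneg (formNorm_nonneg _ _) (formNorm_nonneg _ _)) |>.2
  have h : Q (star (x + y) * (x + y)) = (Q (star x * x) + (Q (star x * y) + Q (star y * x))) +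
      Q (star y * y) := by
    simp only [star_add, add_mul, mul_add, map_add]
    abel
  rw [formNorm_sq, h]
  refine (norm_add₃_le).trans ?_
  rw [← formNorm_sq, ← formNorm_sq]
  have := formNorm_symm_le hQ x y
  nlinarith

variable (hb : ∀ x, ∃ M, ∀ w, formNorm Q (x * w) ≤ M * formNorm Q w)

omit hQ in
include hb in
theorem bddAbove_formNorm (x : X) :
    BddAbove (Set.range fun w : {w : X // formNorm Q w ≤ 1} => formNorm Q (x * w.1)) := by
  obtain ⟨M, hM⟩ := hb x
  refine ⟨|M|, ?_⟩
  rintro _ ⟨w, rfl⟩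
  refine (hM w).trans ?_
  have := formNorm_nonneg Q w.1
  have := w.2
  have := le_abs_self M
  nlinarith [abs_nonneg M]

variable (Q) in
omit hQ in
/-- The operator norm with respect to the `L²`-norm of a positive map. -/
def formOpNorm (x : X) : ℝ := ⨆ w : {w : X // formNorm Q w ≤ 1}, formNorm Q (x * w.1)

omit hQ in
theorem formOpNorm_nonneg (x : X) : 0 ≤ formOpNorm Q x :=
  Real.iSup_nonneg fun _ => formNorm_nonneg _ _

omit hQ in
include hb in
theorem formNorm_mul_le (x w : X) : formNorm Q (x * w) ≤ formOpNorm Q x * formNorm Q w := by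
  rcases (formNorm_nonneg Q w).eq_or_lt with h | h
  -- A null vector cannot be normalized; boundedness of left multiplication sends it to a null
  -- vector.
  · obtain ⟨M, hM⟩ := hb x
    have := hM w
    rw [← h, mul_zero] at this ⊢
    exact this
  · have h1 := le_ciSup (bddAbove_formNorm hb x)
      ⟨((((formNorm Q w)⁻¹ : ℝ)) : ℂ) • w, by
        rw [formNorm_smul, Complex.norm_real, norm_inv, Real.norm_of_nonneg h.le,
          inv_mul_cancel₀ h.ne']⟩
    simp only [mul_smul_comm] at h1
    rw [formNorm_smul, Complex.norm_real, norm_inv, Real.norm_of_nonneg h.le,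
      inv_mul_le_iff₀ h, mul_comm] at h1
    exact h1

omit hQ in
theorem formOpNorm_le {x : X} {M : ℝ} (h : ∀ w, formNorm Q w ≤ 1 → formNorm Q (x * w) ≤ M) :
    formOpNorm Q x ≤ M :=
  have : Nonempty {w : X // formNorm Q w ≤ 1} := ⟨⟨0, by simp [formNorm]⟩⟩
  ciSup_le fun w => h w.1 w.2

omit hQ in
include hb in
theorem formOpNorm_mul_le (x y : X) : formOpNorm Q (x * y) ≤ formOpNorm Q x * formOpNorm Q y :=
  formOpNorm_le fun w hw => by
    rw [mul_assoc]
    refine (formNorm_mul_le hb x _).trans (mul_le_mul_of_nonneg_left ?_ (formOpNorm_nonneg x))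
    refine (formNorm_mul_le hb y w).trans ?_
    exact mul_le_of_le_one_right (formOpNorm_nonneg y) hw

-- The C⋆-inequality comes from `‖xw‖² = ⟨w, x⋆x w⟩ ≤ ‖w‖ ‖x⋆x w‖`. Both terms of the symmetrized
-- form coincide here, so the factor 2 cancels and no constant is lost.
include hb in
theorem sq_formOpNorm_le (x : X) : formOpNorm Q x ^ 2 ≤ formOpNorm Q (star x * x) := by
  rw [← Real.le_sqrt (formOpNorm_nonneg x) (formOpNorm_nonneg _)]
  refine formOpNorm_le fun w hw => Real.le_sqrt_of_sq_le ?_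
  have h1 := formNorm_symm_le hQ w (star x * x * w)
  have h2 : Q (star w * (star x * x * w)) = Q (star (x * w) * (x * w)) := by
    rw [star_mul]; simp only [mul_assoc]
  have h3 : Q (star (star x * x * w) * w) = Q (star (x * w) * (x * w)) := by
    simp only [star_mul, star_star, mul_assoc]
  rw [h2, h3, ← two_smul ℂ, norm_smul, Complex.norm_ofNat, ← formNorm_sq] at h1
  have h4 := formNorm_mul_le hb (star x * x) w
  have h5 := formNorm_nonneg Q w
  have h6 := formOpNorm_nonneg (Q := Q) (star x * x)
  nlinarith [formNorm_nonneg Q (star x * x * w)]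

include hb in
/-- The C⋆-seminorm of the representation that is constructed from a positive map. -/
def formSeminorm : CStarSeminorm X where
  toFun := formOpNorm Q
  map_zero' := le_antisymm (formOpNorm_le fun w _ => by simp [formNorm]) (formOpNorm_nonneg _)
  add_le' x y := formOpNorm_le fun w hw => by
    rw [add_mul]
    refine (formNorm_add_le hQ _ _).trans (add_le_add ?_ ?_)
    · exact (formNorm_mul_le hb x w).trans (mul_le_of_le_one_right (formOpNorm_nonneg x) hw)
    · exact (formNorm_mul_le hb y w).trans (mul_le_of_le_one_right (formOpNorm_nonneg y) hw)
  neg' x := by simp [formOpNorm, formNorm]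
  smul' c x := by
    simp_rw [formOpNorm, smul_mul_assoc, formNorm_smul, Real.mul_iSup_of_nonneg (norm_nonneg c)]
  mul_le' := formOpNorm_mul_le hb
  star_mul_self' x := by
    -- From `p(x)² ≤ p(x⋆x) ≤ p(x⋆) p(x)`, as for any submultiplicative seminorm satisfying the
    -- C⋆-inequality.
    have h : ∀ x, formOpNorm Q x ≤ formOpNorm Q (star x) := fun x => by
      by_contra! hlt
      have h1 := sq_formOpNorm_le hQ hb x
      have h2 := formOpNorm_mul_le hb (star x) x
      nlinarith [formOpNorm_nonneg (Q := Q) (star x), formOpNorm_nonneg (Q := Q) x]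
    refine le_antisymm ((formOpNorm_mul_le hb _ _).trans ?_) (sq_formOpNorm_le hQ hb x)
    have h1 := h (star x)
    rw [star_star] at h1
    rw [sq]
    exact mul_le_mul_of_nonneg_right h1 (formOpNorm_nonneg x)

end Positive

end CGamma

namespace CGamma

open Filter Topology

/-! ### Positive maps on tensor products -/

section PositiveTensor

attribute [local instance] CStarAlgebra.spectralOrder CStarAlgebra.spectralOrderedRing

variable {A B E : Type*} [NonUnitalCStarAlgebra A] [NonUnitalCStarAlgebra B]
  [NonUnitalCStarAlgebra E] {Q : A ⊗[ℂ] B →ₗ[ℂ] E} (hQ : ∀ x, 0 ≤ Q (star x * x))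

include hQ

/-- With `x = a⋆a ⊗ b⋆b`, positivity of `x - x²` gives `‖xw‖ ≤ ‖(a ⊗ b)w‖`, and Cauchy–Schwarz gives
`‖(a ⊗ b)w‖² = ⟨w, xw⟩ ≤ ‖w‖ ‖xw‖`. Together these yield the contraction, all norms being `L²`-norms
of `Q`. -/
theorem formNorm_tmul_mul_le_of_norm_le_one {a : A} {b : B} (ha : ‖a‖ ≤ 1) (hb : ‖b‖ ≤ 1)
    (w : A ⊗[ℂ] B) : formNorm Q (a ⊗ₜ b * w) ≤ formNorm Q w := by
  obtain ⟨s, hs⟩ := CStarAlgebra.nonneg_iff_eq_star_mul_self.mp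
    (sub_nonneg.mpr (sq_le_self_of_norm_le_one a ha))
  obtain ⟨t, ht⟩ := CStarAlgebra.nonneg_iff_eq_star_mul_self.mp
    (sub_nonneg.mpr (sq_le_self_of_norm_le_one b hb))
  set h := star a * a with hh
  set k := star b * b with hk
  have hhs : star h = h := by simp [hh]
  have hks : star k = k := by simp [hk]
  set x : A ⊗[ℂ] B := h ⊗ₜ k with hx
  have hx1 : x = star (a ⊗ₜ[ℂ] b) * (a ⊗ₜ[ℂ] b) := by
    rw [hx, TensorProduct.star_tmul, Algebra.TensorProduct.tmul_mul_tmul]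
  have hxs : star x = x := by rw [hx, TensorProduct.star_tmul, hhs, hks]
  -- `Q` is only known to be positive on elements `z⋆z` of the algebraic tensor product, so `x - x²`
  -- has to be an explicit sum of such elements.
  have key : x - x * x = star (s ⊗ₜ[ℂ] b) * (s ⊗ₜ[ℂ] b) + star (h ⊗ₜ[ℂ] t) * (h ⊗ₜ[ℂ] t) := by
    simp only [hx, TensorProduct.star_tmul, Algebra.TensorProduct.tmul_mul_tmul, ← hs, ← ht, hhs]
    rw [TensorProduct.sub_tmul, TensorProduct.tmul_sub, ← hk]
    abel
  have e1 : star (a ⊗ₜ[ℂ] b * w) * (a ⊗ₜ[ℂ] b * w) = star w * (x * w) := by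
    rw [hx1, star_mul]; simp only [mul_assoc]
  have e2 : star (x * w) * (x * w) = star w * (x * x * w) := by
    rw [star_mul, hxs]; simp only [mul_assoc]
  have e3 : star (x * w) * w = star w * (x * w) := by
    rw [star_mul, hxs, mul_assoc]
  have h1 : Q (star (x * w) * (x * w)) ≤ Q (star (a ⊗ₜ[ℂ] b * w) * (a ⊗ₜ[ℂ] b * w)) := by
    rw [← sub_nonneg, ← map_sub]
    have : star (a ⊗ₜ[ℂ] b * w) * (a ⊗ₜ[ℂ] b * w) - star (x * w) * (x * w) =
        star (s ⊗ₜ[ℂ] b * w) * (s ⊗ₜ[ℂ] b * w) + star (h ⊗ₜ[ℂ] t * w) * (h ⊗ₜ[ℂ] t * w) := by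
      rw [e1, e2, ← mul_sub, ← sub_mul, key, star_mul, star_mul]
      simp only [add_mul, mul_add, mul_assoc]
    rw [this, map_add]
    exact add_nonneg (hQ _) (hQ _)
  have h2 := CStarAlgebra.norm_le_norm_of_nonneg_of_le (hQ (x * w)) h1
  rw [← formNorm_sq, ← formNorm_sq] at h2
  have h3 := formNorm_symm_le hQ w (x * w)
  rw [e3, ← e1, ← two_smul ℂ, norm_smul, Complex.norm_ofNat, ← formNorm_sq] at h3
  have n1 := formNorm_nonneg Q (x * w)
  have n2 := formNorm_nonneg Q (a ⊗ₜ b * w)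
  have n3 := formNorm_nonneg Q w
  have h4 := abs_le_of_sq_le_sq' h2 n2 |>.2
  by_contra! hlt
  nlinarith

theorem formNorm_tmul_mul_le (a : A) (b : B) (w : A ⊗[ℂ] B) :
    formNorm Q (a ⊗ₜ b * w) ≤ ‖a‖ * ‖b‖ * formNorm Q w := by
  rcases eq_or_ne a 0 with rfl | ha
  · simp [formNorm]
  rcases eq_or_ne b 0 with rfl | hb
  · simp [formNorm]
  have ha' := norm_pos_iff.mpr ha
  have hb' := norm_pos_iff.mpr hb
  have h := formNorm_tmul_mul_le_of_norm_le_one hQ (a := ((‖a‖⁻¹ : ℝ) : ℂ) • a)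
    (b := ((‖b‖⁻¹ : ℝ) : ℂ) • b)
    (by rw [norm_smul]; simp [ha'.ne']) (by rw [norm_smul]; simp [hb'.ne']) w
  rw [TensorProduct.smul_tmul_smul, smul_mul_assoc, formNorm_smul] at h
  simp only [norm_mul, Complex.norm_real, norm_inv, norm_norm] at h
  rwa [← mul_inv, inv_mul_le_iff₀ (by positivity)] at h

theorem exists_formNorm_mul_le (x : A ⊗[ℂ] B) :
    ∃ M, ∀ w, formNorm Q (x * w) ≤ M * formNorm Q w := by
  induction x using TensorProduct.induction_on with
  | zero => exact ⟨0, by simp [formNorm]⟩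
  | add x y hx hy =>
    obtain ⟨C, hC⟩ := hx
    obtain ⟨C', hC'⟩ := hy
    refine ⟨C + C', fun w => ?_⟩
    rw [add_mul, add_mul]
    exact (formNorm_add_le hQ _ _).trans (add_le_add (hC w) (hC' w))
  | tmul a b => exact ⟨‖a‖ * ‖b‖, formNorm_tmul_mul_le hQ a b⟩

omit hQ in
theorem tendsto_tmul_of_bound {K : ℝ} (hK : ∀ a b, ‖Q (a ⊗ₜ b)‖ ≤ K * ‖a‖ * ‖b‖) {ι : Type*}
    {l : Filter ι} {f : ι → A} {g : ι → B} {a : A} {b : B} (hf : Tendsto f l (𝓝 a))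
    (hg : Tendsto g l (𝓝 b)) : Tendsto (fun i => Q (f i ⊗ₜ g i)) l (𝓝 (Q (a ⊗ₜ b))) := by
  let T : A →L[ℂ] B →L[ℂ] E := LinearMap.mkContinuous₂ (TensorProduct.curry Q) K hK
  have hT : Continuous fun p : A × B => T p.1 p.2 := T.continuous₂
  exact (hT.tendsto (a, b)).comp (hf.prodMk_nhds hg)

/-- Let `e` run through elementary tensors of approximate units; their `L²`-norms are at most `√K`.
Taking the limit of `Q(x⋆x e)` gives `‖x‖₂ ≤ 2 p √K`, where `p` is the operator seminorm of `x`, and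
taking the limit of `Q(e x)` gives `‖Q x‖ ≤ 2 √K ‖x‖₂`. The 4 is the Cauchy–Schwarz constant 2, used
twice. -/
theorem norm_le_of_positive {K : ℝ} (hK0 : 0 ≤ K)
    (hK : ∀ a b, ‖Q (a ⊗ₜ b)‖ ≤ K * ‖a‖ * ‖b‖) (x : A ⊗[ℂ] B) :
    ‖Q x‖ ≤ 4 * K * maxSeminorm (A ⊗[ℂ] B) x := by
  have hb := exists_formNorm_mul_le hQ
  have uA := CStarAlgebra.increasingApproximateUnit A
  have uB := CStarAlgebra.increasingApproximateUnit B
  have nA := uA.neBot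
  have nB := uB.neBot
  set l := CStarAlgebra.approximateUnit A ×ˢ CStarAlgebra.approximateUnit B with hl
  have left : ∀ x, Tendsto (fun e : A × B => Q (e.1 ⊗ₜ e.2 * x)) l (𝓝 (Q x)) := fun x => by
    induction x using TensorProduct.induction_on with
    | zero => simp
    | add x y hx hy => simpa [mul_add] using hx.add hy
    | tmul a b =>
      simp only [Algebra.TensorProduct.tmul_mul_tmul]
      exact tendsto_tmul_of_bound hK ((uA.tendsto_mul_right a).comp tendsto_fst)
        ((uB.tendsto_mul_right b).comp tendsto_snd)
  have right : ∀ x, Tendsto (fun e : A × B => Q (x * e.1 ⊗ₜ e.2)) l (𝓝 (Q x)) := fun x => by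
    induction x using TensorProduct.induction_on with
    | zero => simp
    | add x y hx hy => simpa [add_mul] using hx.add hy
    | tmul a b =>
      simp only [Algebra.TensorProduct.tmul_mul_tmul]
      exact tendsto_tmul_of_bound hK ((uA.tendsto_mul_left a).comp tendsto_fst)
        ((uB.tendsto_mul_left b).comp tendsto_snd)
  have small : ∀ᶠ e in l, ‖e.1‖ ≤ 1 ∧ ‖e.2‖ ≤ 1 :=
    (uA.eventually_norm.prod_inl _).and (uB.eventually_norm.prod_inr _)
  have unit : ∀ e : A × B, ‖e.1‖ ≤ 1 → ‖e.2‖ ≤ 1 → formNorm Q (e.1 ⊗ₜ e.2) ≤ √K := by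
    intro e h1 h2
    refine Real.sqrt_le_sqrt ?_
    rw [TensorProduct.star_tmul, Algebra.TensorProduct.tmul_mul_tmul]
    refine (hK _ _).trans ?_
    rw [CStarRing.norm_star_mul_self, CStarRing.norm_star_mul_self, mul_assoc]
    refine mul_le_of_le_one_right hK0 ?_
    exact mul_le_one₀ (mul_le_one₀ h1 (norm_nonneg _) h1) (by positivity)
      (mul_le_one₀ h2 (norm_nonneg _) h2)
  set p := formOpNorm Q x
  have hp : 0 ≤ p := formOpNorm_nonneg x
  have s1 : formNorm Q x ^ 2 ≤ 2 * (formNorm Q x * (p * √K)) := by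
    rw [formNorm_sq]
    refine le_of_tendsto (right (star x * x)).norm ?_
    filter_upwards [small] with e he
    rw [mul_assoc]
    refine (norm_form_le hQ _ _).trans ?_
    gcongr
    · exact formNorm_nonneg _ _
    · exact (formNorm_mul_le hb _ _).trans (mul_le_mul_of_nonneg_left (unit e he.1 he.2) hp)
  have s2 : formNorm Q x ≤ 2 * (p * √K) := by
    by_contra! hlt
    have : 0 ≤ 2 * (p * √K) := by positivity
    nlinarith
  have s3 : ‖Q x‖ ≤ 2 * (√K * formNorm Q x) := by
    refine le_of_tendsto (left x).norm ?_
    filter_upwards [small] with e he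
    have := norm_form_le hQ (star (e.1 ⊗ₜ[ℂ] e.2)) x
    rw [star_star] at this
    refine this.trans ?_
    gcongr
    · exact formNorm_nonneg _ _
    · rw [TensorProduct.star_tmul]
      exact unit (star e.1, star e.2) (by simpa using he.1) (by simpa using he.2)
  have s4 : p ≤ maxSeminorm (A ⊗[ℂ] B) x := le_maxSeminorm (formSeminorm hQ hb) x
  calc ‖Q x‖ ≤ 2 * (√K * (2 * (p * √K))) := s3.trans (by gcongr)
    _ = 4 * (√K * √K) * p := by ring
    _ = 4 * K * p := by rw [Real.mul_self_sqrt hK0]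
    _ ≤ _ := by gcongr

end PositiveTensor

/-! ### Completely positive maps -/

section CompletelyPositive

attribute [local instance] CStarAlgebra.spectralOrder CStarAlgebra.spectralOrderedRing

variable {B Y Z : Type*} [NonUnitalCStarAlgebra B] [NonUnitalCStarAlgebra Y]
  [NonUnitalCStarAlgebra Z]

/-- Complete positivity: the matrices `(P(yᵢ⋆yⱼ))` are of the form `w⋆w`. -/
def IsCP (P : Y →L[ℂ] Z) : Prop :=
  ∀ (n : ℕ) (y : Fin n → Y), ∃ (m : ℕ) (w : Fin m → Fin n → Z),
    ∀ i j, P (star (y i) * y j) = ∑ k, star (w k i) * w k j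

theorem exists_fin_sum_tmul (x : B ⊗[ℂ] Y) :
    ∃ (n : ℕ) (b : Fin n → B) (y : Fin n → Y), x = ∑ i, b i ⊗ₜ[ℂ] y i := by
  obtain ⟨S, hS⟩ := TensorProduct.exists_finset x
  refine ⟨S.card, fun i => (S.equivFin.symm i).1.1, fun i => (S.equivFin.symm i).1.2, ?_⟩
  rw [hS, ← Finset.sum_coe_sort S]
  exact (S.equivFin.symm.sum_comp fun s : S => s.1.1 ⊗ₜ[ℂ] s.1.2).symm

theorem tmul_sum {ι : Type*} (b : B) (s : Finset ι) (f : ι → Y) :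
    tmul b (∑ i ∈ s, f i) = ∑ i ∈ s, tmul b (f i) := map_sum (tmulBilin B Y b) f s

/-- The map `id ⊗ P` on the algebraic tensor product. -/
def algIdTensor (B : Type*) [NonUnitalCStarAlgebra B] (P : Y →L[ℂ] Z) :
    B ⊗[ℂ] Y →ₗ[ℂ] MaxTensor B Z :=
  (ofAlg B Z : B ⊗[ℂ] Z →ₗ[ℂ] MaxTensor B Z).comp (TensorProduct.map LinearMap.id (P : Y →ₗ[ℂ] Z))

theorem algIdTensor_tmul (P : Y →L[ℂ] Z) (b : B) (y : Y) :
    algIdTensor B P (b ⊗ₜ y) = tmul b (P y) := rfl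

/-- For `x = ∑ bᵢ ⊗ yᵢ`, inserting `P(yᵢ⋆yⱼ) = ∑ₖ wₖᵢ⋆wₖⱼ` turns the image of `x⋆x` into `∑ₖ |∑ᵢ bᵢ
⊗ wₖᵢ|²`. The definition of `IsCP` is made for this computation. -/
theorem algIdTensor_nonneg {P : Y →L[ℂ] Z} (hP : IsCP P) (x : B ⊗[ℂ] Y) :
    0 ≤ algIdTensor B P (star x * x) := by
  obtain ⟨n, b, y, rfl⟩ := exists_fin_sum_tmul x
  obtain ⟨m, w, hw⟩ := hP n y
  have h : algIdTensor B P (star (∑ i, b i ⊗ₜ[ℂ] y i) * ∑ i, b i ⊗ₜ[ℂ] y i) =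
      ∑ k, star (∑ i, tmul (b i) (w k i)) * ∑ i, tmul (b i) (w k i) := by
    simp only [star_sum, Finset.sum_mul_sum, map_sum, TensorProduct.star_tmul,
      Algebra.TensorProduct.tmul_mul_tmul, algIdTensor_tmul, hw, star_tmul, tmul_mul_tmul, tmul_sum]
    symm
    rw [Finset.sum_comm]
    refine Finset.sum_congr rfl fun i _ => ?_
    rw [Finset.sum_comm]
  rw [h]
  exact Finset.sum_nonneg fun k _ => star_mul_self_nonneg _

theorem norm_algIdTensor_le {P : Y →L[ℂ] Z} (hP : IsCP P) (x : B ⊗[ℂ] Y) :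
    ‖algIdTensor B P x‖ ≤ 4 * ‖P‖ * maxSeminorm (B ⊗[ℂ] Y) x :=
  norm_le_of_positive (algIdTensor_nonneg hP) (norm_nonneg P) (fun b y => by
    rw [algIdTensor_tmul]
    refine (norm_tmul_le _ _).trans ?_
    have := P.le_opNorm y
    nlinarith [norm_nonneg b]) x

/-- The map `id ⊗ P` for a completely positive map `P`. -/
def idTensor (B : Type*) [NonUnitalCStarAlgebra B] {P : Y →L[ℂ] Z} (hP : IsCP P) :
    MaxTensor B Y →L[ℂ] MaxTensor B Z :=
  tensorExtend (algIdTensor B P) (4 * ‖P‖) (norm_algIdTensor_le hP)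

theorem idTensor_tmul {P : Y →L[ℂ] Z} (hP : IsCP P) (b : B) (y : Y) :
    idTensor B hP (tmul b y) = tmul b (P y) :=
  tensorExtend_ofAlg _ _ _ _

theorem idTensor_nonneg {P : Y →L[ℂ] Z} (hP : IsCP P) (x : MaxTensor B Y) :
    0 ≤ idTensor B hP (star x * x) := by
  refine (denseRange_ofAlg B Y).induction_on
    (p := fun x : MaxTensor B Y => 0 ≤ idTensor B hP (star x * x)) x
    (CStarAlgebra.isClosed_nonneg.preimage (f := fun x => idTensor B hP (star x * x))
      (by fun_prop)) (fun x => ?_)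
  rw [← map_star, ← map_mul]
  exact (algIdTensor_nonneg hP x).trans_eq (tensorExtend_ofAlg _ _ _ _).symm

end CompletelyPositive

/-! ### Continuous linear maps on tensor products, symmetry -/

section Symmetry

variable {A B C : Type*} [NonUnitalCStarAlgebra A] [NonUnitalCStarAlgebra B]
  [NonUnitalCStarAlgebra C]

theorem continuous_tmul : Continuous fun p : A × B => tmul p.1 p.2 := by
  let T : A →L[ℂ] B →L[ℂ] MaxTensor A B :=
    LinearMap.mkContinuous₂ (tmulBilin A B) 1 (fun a b => by
      rw [one_mul]; exact norm_tmul_le a b)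
  exact T.continuous₂

theorem homId_apply (a : A) : NonUnitalStarAlgHom.id ℂ A a = a := Eq.trans rfl rfl

theorem hom_comp_apply (g : B →⋆ₙₐ[ℂ] C) (f : A →⋆ₙₐ[ℂ] B) (a : A) : g.comp f a = g (f a) :=
  Eq.trans rfl rfl

theorem clm_comp_apply (g : B →L[ℂ] C) (f : A →L[ℂ] B) (a : A) : g.comp f a = g (f a) :=
  Eq.trans rfl rfl

/-- A ⋆-homomorphism as a continuous linear map. -/
def homCLM (π : A →⋆ₙₐ[ℂ] B) : A →L[ℂ] B := ⟨(π : A →ₗ[ℂ] B), continuous_hom π⟩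

theorem homCLM_apply (π : A →⋆ₙₐ[ℂ] B) (a : A) : homCLM π a = π a := Eq.trans rfl rfl

/-- The elementary tensors from total subsets are total. -/
theorem dense_span_tmul {S : Set A} {T : Set B} (hS : Dense (Submodule.span ℂ S : Set A))
    (hT : Dense (Submodule.span ℂ T : Set B)) :
    Dense (Submodule.span ℂ (Set.image2 tmul S T) : Set (MaxTensor A B)) := by
  set V := (Submodule.span ℂ (Set.image2 tmul S T)).topologicalClosure with hV
  have hc : IsClosed (V : Set (MaxTensor A B)) := Submodule.isClosed_topologicalClosure _
  have h1 : ∀ a b, tmul a b ∈ V := by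
    intro a b
    have ca : Continuous fun a : A => tmul a b := continuous_tmul.comp (.prodMk_left b)
    refine hS.induction (P := fun a => tmul a b ∈ V) (fun a ha => ?_) (hc.preimage ca) a
    have cb : Continuous fun b : B => tmul a b := continuous_tmul.comp (.prodMk_right a)
    refine hT.induction (P := fun b => tmul a b ∈ V) (fun b hb => ?_) (hc.preimage cb) b
    refine Submodule.span_induction (p := fun a _ => tmulBilin A B a b ∈ V) (fun a ha => ?_)
      (by simp) (fun x y _ _ hx hy => by rw [map_add]; exact add_mem hx hy)
      (fun c x _ hx => by rw [map_smul]; exact V.smul_mem c hx) ha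
    refine Submodule.span_induction (p := fun b _ => tmulBilin A B a b ∈ V) (fun b hb => ?_)
      (by simp) (fun x y _ _ hx hy => by rw [map_add]; exact add_mem hx hy)
      (fun c x _ hx => by rw [map_smul]; exact V.smul_mem c hx) hb
    exact Submodule.le_topologicalClosure _ (Submodule.subset_span ⟨a, ha, b, hb, rfl⟩)
  have h2 : ∀ x, ofAlg A B x ∈ V := fun x => by
    induction x using TensorProduct.induction_on with
    | zero => simp
    | add x y hx hy => rw [map_add]; exact add_mem hx hy
    | tmul a b => exact h1 a b
  rw [← dense_closure, ← Submodule.topologicalClosure_coe, ← hV]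
  refine (denseRange_ofAlg A B).mono ?_
  rintro _ ⟨x, rfl⟩
  exact h2 x

/-- Continuous linear maps on a tensor product agree if they agree on elementary tensors from
total subsets. -/
theorem tensor_clm_ext {E : Type*} [NonUnitalCStarAlgebra E] {S : Set A} {T : Set B}
    (hS : Dense (Submodule.span ℂ S : Set A)) (hT : Dense (Submodule.span ℂ T : Set B))
    {f g : MaxTensor A B →L[ℂ] E} (h : ∀ a ∈ S, ∀ b ∈ T, f (tmul a b) = g (tmul a b)) : f = g :=
  ContinuousLinearMap.ext_on (dense_span_tmul hS hT) (by
    rintro _ ⟨a, ha, b, hb, rfl⟩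
    exact h a ha b hb)

variable (A) in
theorem dense_span_univ : Dense (Submodule.span ℂ (Set.univ : Set A) : Set A) := by
  simp

theorem tensor_hom_ext₃' {E : Type*} [NonUnitalCStarAlgebra E]
    {π ρ : MaxTensor A (MaxTensor B C) →⋆ₙₐ[ℂ] E}
    (h : ∀ a b c, π (tmul a (tmul b c)) = ρ (tmul a (tmul b c))) : π = ρ := by
  have key : homCLM π = homCLM ρ := by
    refine tensor_clm_ext (dense_span_univ A)
      (dense_span_tmul (dense_span_univ B) (dense_span_univ C)) ?_
    rintro a _ _ ⟨b, _, c, _, rfl⟩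
    rw [homCLM_apply, homCLM_apply, h a b c]
  refine DFunLike.ext _ _ fun x => ?_
  rw [← homCLM_apply π, key, homCLM_apply]

variable (B) in
/-- The map `b ↦ a ⊗ b`. -/
def tmulLeft (a : A) : B →L[ℂ] MaxTensor A B :=
  LinearMap.mkContinuous (tmulBilin A B a) ‖a‖ (norm_tmul_le a)

theorem tmulLeft_apply (a : A) (b : B) : tmulLeft B a b = tmul a b := Eq.trans rfl rfl

theorem tmul_zero (a : A) : tmul a (0 : B) = 0 := map_zero (tmulLeft B a)

theorem zero_tmul (b : B) : tmul (0 : A) b = 0 :=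
  LinearMap.map_zero₂ (tmulBilin A B) b

variable (A B C)

/-- The symmetry `a ⊗ b ↦ b ⊗ a`. -/
def tensorFlip : MaxTensor A B →⋆ₙₐ[ℂ] MaxTensor B A :=
  tensorLift (tmulBilin B A).flip (fun a a' b b' => by
      simp only [LinearMap.flip_apply, tmulBilin_apply, tmul_mul_tmul])
    (fun a b => by simp only [LinearMap.flip_apply, tmulBilin_apply, star_tmul])

variable {A B C}

theorem tensorFlip_tmul (a : A) (b : B) : tensorFlip A B (tmul a b) = tmul b a :=
  tensorLift_tmul _ _ _ a b

theorem tensorFlip_comp : (tensorFlip B A).comp (tensorFlip A B) =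
    NonUnitalStarAlgHom.id ℂ (MaxTensor A B) :=
  tensor_hom_ext fun a b => by
    rw [hom_comp_apply, tensorFlip_tmul, tensorFlip_tmul]; rfl

theorem tensorFlip_tensorFlip (x : MaxTensor A B) : tensorFlip B A (tensorFlip A B x) = x :=
  DFunLike.congr_fun tensorFlip_comp x

variable (A B C)

/-- The inverse of the canonical isomorphism `(A ⊗ B) ⊗ C → A ⊗ (B ⊗ C)`. -/
def tensorAssocInv : MaxTensor A (MaxTensor B C) →⋆ₙₐ[ℂ] MaxTensor (MaxTensor A B) C :=
  -- Conjugating the associator of `C`, `B`, `A` by symmetries: `a(bc) ↦ (bc)a ↦ (cb)a ↦ c(ba) ↦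
  -- c(ab) ↦ (ab)c`.
  (tensorFlip C (MaxTensor A B)).comp <|
    (tensorMap (NonUnitalStarAlgHom.id ℂ C) (tensorFlip B A)).comp <|
      (tensorAssoc C B A).comp <|
        (tensorMap (tensorFlip B C) (NonUnitalStarAlgHom.id ℂ A)).comp <|
          tensorFlip A (MaxTensor B C)

variable {A B C}

theorem tensorAssocInv_tmul (a : A) (b : B) (c : C) :
    tensorAssocInv A B C (tmul a (tmul b c)) = tmul (tmul a b) c := by
  simp only [tensorAssocInv, hom_comp_apply, tensorFlip_tmul, tensorMap_tmul,
    tensorAssoc_tmul, homId_apply]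

theorem tensorAssocInv_tensorAssoc (x : MaxTensor (MaxTensor A B) C) :
    tensorAssocInv A B C (tensorAssoc A B C x) = x := by
  have : (tensorAssocInv A B C).comp (tensorAssoc A B C) = NonUnitalStarAlgHom.id ℂ _ :=
    tensor_hom_ext₃ fun a b c => by
      rw [hom_comp_apply, tensorAssoc_tmul, tensorAssocInv_tmul]; rfl
  exact DFunLike.congr_fun this x

end Symmetry

end CGamma

namespace CGamma

open Filter Topology

/-! ### The diagonal functional on `C⋆(Γ) ⊗ C⋆(Γ)` -/

section Diagonal

variable {Γ : Type*} [Group Γ]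

theorem dense_span_of : Dense (Submodule.span ℂ (Set.range (GroupCStar.of (Γ := Γ))) :
    Set (GroupCStar Γ)) := by
  refine (denseRange_ofGroupAlgebra Γ).mono ?_
  rintro _ ⟨f, rfl⟩
  induction f using MonoidAlgebra.induction_linear with
  | zero => rw [map_zero]; exact zero_mem _
  | add f g hf hg => rw [map_add]; exact add_mem hf hg
  | single γ z =>
    have : MonoidAlgebra.single γ z = z • MonoidAlgebra.single γ (1 : ℂ) := by simp
    rw [this, map_smul]
    exact Submodule.smul_mem _ _ (Submodule.subset_span ⟨γ, rfl⟩)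

/-- The representation of `C⋆(Γ)` given by a family of elements behaving like the group. -/
def groupLift {E : Type*} [NonUnitalCStarAlgebra E] (u : Γ → E)
    (hmul : ∀ γ γ', u (γ * γ') = u γ * u γ') (hstar : ∀ γ, u γ⁻¹ = star (u γ)) :
    GroupCStar Γ →⋆ₙₐ[ℂ] E := envLift (groupAlgebraLift u hmul hstar)

theorem groupLift_of {E : Type*} [NonUnitalCStarAlgebra E] (u : Γ → E)
    (hmul : ∀ γ γ', u (γ * γ') = u γ * u γ') (hstar : ∀ γ, u γ⁻¹ = star (u γ)) (γ : Γ) :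
    groupLift u hmul hstar (GroupCStar.of γ) = u γ :=
  (envLift_toEnv _ _).trans (groupAlgebraLift_single _ _ _ γ)

/-! ### The regular representations on `ℓ²(Γ)` and the diagonal functional -/

variable (Γ) in
/-- The Hilbert space `ℓ²(Γ)`. -/
abbrev L2 : Type _ := lp (fun _ : Γ => ℂ) 2

/-- The operator `f ↦ f ∘ e⁻¹` on `ℓ²(Γ)`. -/
def permOp (e : Equiv.Perm Γ) : L2 Γ →L[ℂ] L2 Γ :=
  LinearMap.mkContinuous
    { toFun := fun f => ⟨fun r => f (e⁻¹ r), by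
        have h := (lp.memℓp f).summable (by norm_num)
        exact memℓp_gen (h.comp_injective (e⁻¹).injective)⟩
      map_add' := fun f g => rfl
      map_smul' := fun c f => rfl } 1 fun f => by
    refine le_of_eq ?_
    rw [one_mul, lp.norm_eq_tsum_rpow (by norm_num), lp.norm_eq_tsum_rpow (by norm_num)]
    congr 1
    exact (e⁻¹).tsum_eq fun r => ‖f r‖ ^ (2 : ENNReal).toReal

theorem permOp_apply (e : Equiv.Perm Γ) (f : L2 Γ) (r : Γ) : permOp e f r = f (e⁻¹ r) := rfl

theorem permOp_mul (e e' : Equiv.Perm Γ) : permOp (e * e') = permOp e * permOp e' := by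
  ext f r
  rw [permOp_apply, mul_inv_rev]
  rfl

theorem permOp_inv (e : Equiv.Perm Γ) : permOp e⁻¹ = star (permOp e) := by
  rw [ContinuousLinearMap.star_eq_adjoint, ContinuousLinearMap.eq_adjoint_iff]
  intro f g
  rw [lp.inner_eq_tsum, lp.inner_eq_tsum, ← (e⁻¹).tsum_eq]
  refine tsum_congr fun r => ?_
  rw [permOp_apply, permOp_apply, inv_inv, show e (e⁻¹ r) = r from e.apply_symm_apply r]

variable (Γ)

/-- The left regular representation. -/
def leftRegular : GroupCStar Γ →⋆ₙₐ[ℂ] (L2 Γ →L[ℂ] L2 Γ) :=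
  groupLift (fun γ => permOp (Equiv.mulLeft γ))
    (fun γ γ' => by rw [← permOp_mul]; congr 1; ext r; simp)
    (fun γ => by rw [← permOp_inv]; congr 1; ext r; simp)

/-- The right regular representation. -/
def rightRegular : GroupCStar Γ →⋆ₙₐ[ℂ] (L2 Γ →L[ℂ] L2 Γ) :=
  -- The inverse makes right translation a homomorphism instead of an antihomomorphism.
  groupLift (fun γ => permOp (Equiv.mulRight γ⁻¹))
    (fun γ γ' => by rw [← permOp_mul]; congr 1; ext r; simp [mul_assoc])
    (fun γ => by rw [← permOp_inv]; congr 1; ext r; simp)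

variable {Γ}

/-- On group elements this is associativity of the product of `Γ`; density does the rest. Commuting
images are what allows the two representations to be combined on the maximal tensor product. -/
theorem commute_regular (x y : GroupCStar Γ) : Commute (leftRegular Γ x) (rightRegular Γ y) := by
  have hl := continuous_hom (leftRegular Γ)
  have hr := continuous_hom (rightRegular Γ)
  refine dense_span_of.induction (P := fun x => Commute (leftRegular Γ x) (rightRegular Γ y))
    (fun x hx => ?_) (isClosed_eq (by fun_prop) (by fun_prop)) x
  refine dense_span_of.induction (P := fun y => Commute (leftRegular Γ x) (rightRegular Γ y))
    (fun y hy => ?_) (isClosed_eq (by fun_prop) (by fun_prop)) y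
  refine Submodule.span_induction (p := fun x _ => Commute (leftRegular Γ x) (rightRegular Γ y))
    ?_ (by simp) (fun x y _ _ hx hy => by rw [map_add]; exact hx.add_left hy)
    (fun c x _ hx => by rw [map_smul]; exact hx.smul_left c) hx
  rintro _ ⟨γ, rfl⟩
  refine Submodule.span_induction
    (p := fun y _ => Commute (leftRegular Γ (GroupCStar.of γ)) (rightRegular Γ y))
    ?_ (by simp) (fun x y _ _ hx hy => by rw [map_add]; exact hx.add_right hy)
    (fun c x _ hx => by rw [map_smul]; exact hx.smul_right c) hy
  rintro _ ⟨γ', rfl⟩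
  rw [leftRegular, rightRegular, groupLift_of, groupLift_of, Commute, SemiconjBy, ← permOp_mul,
    ← permOp_mul]
  congr 1
  ext r
  simp [mul_assoc]

variable (Γ)

/-- The representation of `C⋆(Γ) ⊗ C⋆(Γ)` on `ℓ²(Γ)` by left and right translations. -/
def biregular : MaxTensor (GroupCStar Γ) (GroupCStar Γ) →⋆ₙₐ[ℂ] (L2 Γ →L[ℂ] L2 Γ) :=
  tensorLift ((LinearMap.mul ℂ (L2 Γ →L[ℂ] L2 Γ)).compl₁₂ (leftRegular Γ : _ →ₗ[ℂ] _)
      (rightRegular Γ : _ →ₗ[ℂ] _))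
    (fun x x' y y' => by
      simp only [LinearMap.compl₁₂_apply, LinearMap.mul_apply', LinearMap.coe_coe, map_mul]
      exact (commute_regular x' y).mul_mul_mul_comm _ _)
    (fun x y => by
      simp only [LinearMap.compl₁₂_apply, LinearMap.mul_apply', LinearMap.coe_coe, map_star,
        star_mul]
      rw [← map_star, ← map_star]
      exact commute_regular _ _)

/-- The functional `γ ⊗ γ' ↦ δ_{γ,γ'}`. -/
def diagFunctional : MaxTensor (GroupCStar Γ) (GroupCStar Γ) →L[ℂ] ℂ :=
  open Classical in
  (innerSL ℂ (lp.single 2 (1 : Γ) (1 : ℂ) : L2 Γ)).comp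
    ((ContinuousLinearMap.apply ℂ (L2 Γ) (lp.single 2 (1 : Γ) (1 : ℂ) : L2 Γ)).comp
      (homCLM (biregular Γ)))

-- The operator of `γ ⊗ γ'` moves the basis vector at `1` to the one at `γ γ'⁻¹`, so the vector
-- functional at `1` detects `γ = γ'`.
open Classical in
theorem diagFunctional_apply (x : MaxTensor (GroupCStar Γ) (GroupCStar Γ)) :
    diagFunctional Γ x = inner ℂ (lp.single 2 (1 : Γ) (1 : ℂ) : L2 Γ)
      (biregular Γ x (lp.single 2 (1 : Γ) (1 : ℂ) : L2 Γ)) := rfl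

open Classical in
theorem diagFunctional_of (γ γ' : Γ) :
    diagFunctional Γ (tmul (GroupCStar.of γ) (GroupCStar.of γ')) = if γ = γ' then 1 else 0 := by
  rw [diagFunctional_apply, biregular, tensorLift_tmul, LinearMap.compl₁₂_apply,
    LinearMap.mul_apply', LinearMap.coe_coe, LinearMap.coe_coe, leftRegular, rightRegular,
    groupLift_of, groupLift_of, ← permOp_mul, lp.inner_single_left, permOp_apply, lp.single_apply]
  have : ((Equiv.mulLeft γ * Equiv.mulRight γ'⁻¹)⁻¹ : Equiv.Perm Γ) 1 = γ⁻¹ * γ' := by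
    rw [Equiv.Perm.inv_eq_iff_eq]
    simp
  rw [this]
  by_cases h : γ = γ'
  · subst h
    simp
  · have : γ⁻¹ * γ' ≠ 1 := fun h' => h (inv_mul_eq_one.mp h')
    simp [h, this]

/-- For a vector functional at `ξ`, the matrix `(τ(yᵢ⋆yⱼ))` is the Gram matrix of the vectors `yᵢ
ξ`, hence a sum of positive matrices of rank one. -/
theorem isCP_diagFunctional : IsCP (diagFunctional Γ) := by
  classical
  intro n y
  obtain ⟨m, A, hA⟩ := Matrix.posSemidef_iff_eq_sum_vecMulVec.mp (Matrix.posSemidef_gram ℂ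
    fun i => biregular Γ (y i) (lp.single 2 (1 : Γ) (1 : ℂ) : L2 Γ))
  refine ⟨m, fun k i => star (A k i), fun i j => ?_⟩
  have h := congr_fun (congr_fun hA i) j
  rw [Matrix.gram_apply, Matrix.sum_apply] at h
  rw [diagFunctional_apply, map_mul, map_star, mul_apply_eq_comp,
    ContinuousLinearMap.star_eq_adjoint, ContinuousLinearMap.adjoint_inner_right, h]
  simp [Matrix.vecMulVec_apply]

/-- The isomorphism `A ⊗ ℂ → A`. -/
def tensorScalar (A : Type*) [NonUnitalCStarAlgebra A] : MaxTensor A ℂ →⋆ₙₐ[ℂ] A :=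
  tensorLift (LinearMap.lsmul ℂ A).flip
    (fun a a' z z' => by
      simp [smul_mul_smul_comm])
    (fun a z => by simp)

theorem tensorScalar_tmul {A : Type*} [NonUnitalCStarAlgebra A] (a : A) (z : ℂ) :
    tensorScalar A (tmul a z) = z • a := tensorLift_tmul _ _ _ a z

/-- The map `id ⊗ τ`, where `τ` is the diagonal functional. -/
def diagSlice (A : Type*) [NonUnitalCStarAlgebra A] :
    MaxTensor A (MaxTensor (GroupCStar Γ) (GroupCStar Γ)) →L[ℂ] A :=
  (homCLM (tensorScalar A)).comp (idTensor A (isCP_diagFunctional Γ))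

variable {Γ}

open Classical in
theorem diagSlice_tmul {A : Type*} [NonUnitalCStarAlgebra A] (a : A) (γ γ' : Γ) :
    diagSlice Γ A (tmul a (tmul (GroupCStar.of γ) (GroupCStar.of γ'))) =
      if γ = γ' then a else 0 := by
  rw [diagSlice, clm_comp_apply, idTensor_tmul, homCLM_apply, tensorScalar_tmul,
    diagFunctional_of, ite_smul, one_smul, zero_smul]

attribute [local instance] CStarAlgebra.spectralOrder CStarAlgebra.spectralOrderedRing in
theorem diagSlice_nonneg {A : Type*} [NonUnitalCStarAlgebra A]
    (x : MaxTensor A (MaxTensor (GroupCStar Γ) (GroupCStar Γ))) :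
    0 ≤ diagSlice Γ A (star x * x) := by
  rw [diagSlice, clm_comp_apply, homCLM_apply]
  exact map_nonneg (tensorScalar A) (idTensor_nonneg (isCP_diagFunctional Γ) x)

/-! ### The counit -/

variable (Γ)

/-- The counit `γ ↦ 1` of `C⋆(Γ)`. -/
def counit : GroupCStar Γ →⋆ₙₐ[ℂ] ℂ := groupLift (fun _ => 1) (by simp) (by simp)

theorem counit_of (γ : Γ) : counit Γ (GroupCStar.of γ) = 1 := groupLift_of _ _ _ γ

/-- The map `ε ⊗ id`, where `ε` is the counit. -/
def counitSlice (A : Type*) [NonUnitalCStarAlgebra A] : MaxTensor (GroupCStar Γ) A →⋆ₙₐ[ℂ] A :=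
  (tensorScalar A).comp ((tensorMap (NonUnitalStarAlgHom.id ℂ A) (counit Γ)).comp
    (tensorFlip (GroupCStar Γ) A))

variable {Γ}

theorem counitSlice_tmul {A : Type*} [NonUnitalCStarAlgebra A] (γ : Γ) (a : A) :
    counitSlice Γ A (tmul (GroupCStar.of γ) a) = a := by
  rw [counitSlice, hom_comp_apply, hom_comp_apply, tensorFlip_tmul,
    tensorMap_tmul, tensorScalar_tmul, counit_of, one_smul, homId_apply]

end Diagonal

end CGamma

namespace CGamma

open Filter Topology
open NonUnitalStarAlgHom (id)

/-! ### Homogeneous elements -/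

section Homogeneous

variable {Γ : Type*} [Group Γ] {A B : Type*} [NonUnitalCStarAlgebra A] [NonUnitalCStarAlgebra B]

theorem group_tensor_ext {E : Type*} [NonUnitalCStarAlgebra E]
    {f g : MaxTensor (GroupCStar Γ) A →L[ℂ] E}
    (h : ∀ γ a, f (tmul (GroupCStar.of γ) a) = g (tmul (GroupCStar.of γ) a))
    (x : MaxTensor (GroupCStar Γ) A) : f x = g x := by
  refine DFunLike.congr_fun (tensor_clm_ext dense_span_of (dense_span_univ A) ?_) x
  rintro _ ⟨γ, rfl⟩ a _
  exact h γ a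

theorem tensor_group_ext {E : Type*} [NonUnitalCStarAlgebra E]
    {f g : MaxTensor A (GroupCStar Γ) →L[ℂ] E}
    (h : ∀ a γ, f (tmul a (GroupCStar.of γ)) = g (tmul a (GroupCStar.of γ)))
    (x : MaxTensor A (GroupCStar Γ)) : f x = g x := by
  refine DFunLike.congr_fun (tensor_clm_ext (dense_span_univ A) dense_span_of ?_) x
  rintro a _ _ ⟨γ, rfl⟩
  exact h a γ

theorem group_tensor_hom_ext {E : Type*} [NonUnitalCStarAlgebra E]
    {f g : MaxTensor (GroupCStar Γ) A →⋆ₙₐ[ℂ] E}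
    (h : ∀ γ a, f (tmul (GroupCStar.of γ) a) = g (tmul (GroupCStar.of γ) a)) : f = g :=
  DFunLike.ext _ _ fun x => by
    have := group_tensor_ext (f := homCLM f) (g := homCLM g)
      (fun γ a => by rw [homCLM_apply, homCLM_apply, h]) x
    rwa [homCLM_apply, homCLM_apply] at this

theorem tensor_group_hom_ext {E : Type*} [NonUnitalCStarAlgebra E]
    {f g : MaxTensor A (GroupCStar Γ) →⋆ₙₐ[ℂ] E}
    (h : ∀ a γ, f (tmul a (GroupCStar.of γ)) = g (tmul a (GroupCStar.of γ))) : f = g :=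
  DFunLike.ext _ _ fun x => by
    have := tensor_group_ext (f := homCLM f) (g := homCLM g)
      (fun γ a => by rw [homCLM_apply, homCLM_apply, h]) x
    rwa [homCLM_apply, homCLM_apply] at this

/-- The structure with left and right interchanged. -/
def CGammaStructure.op (c : CGammaStructure Γ A) : CGammaStructure Γ A where
  left := (tensorFlip A (GroupCStar Γ)).comp c.right
  right := (tensorFlip (GroupCStar Γ) A).comp c.left
  left_injective := fun x y h => c.right_injective <| by
    have h' := congrArg (tensorFlip (GroupCStar Γ) A) h
    simpa only [hom_comp_apply, tensorFlip_tensorFlip] using h'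
  right_injective := fun x y h => c.left_injective <| by
    have h' := congrArg (tensorFlip A (GroupCStar Γ)) h
    simpa only [hom_comp_apply, tensorFlip_tensorFlip] using h'
  left_coassoc := by
    -- `F` reverses three tensor factors, `a ⊗ (g ⊗ h) ↦ h ⊗ (g ⊗ a)`, and so carries right
    -- coassociativity of `c` to left coassociativity.
    let F := (tensorAssoc (GroupCStar Γ) (GroupCStar Γ) A).comp
      ((tensorFlip A (MaxTensor (GroupCStar Γ) (GroupCStar Γ))).comp
        (tensorMap (id ℂ A) (tensorFlip (GroupCStar Γ) (GroupCStar Γ))))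
    have h1 : (tensorMap (id ℂ (GroupCStar Γ)) ((tensorFlip A (GroupCStar Γ)).comp c.right)).comp
        (tensorFlip A (GroupCStar Γ)) = (F.comp (tensorAssoc A (GroupCStar Γ) (GroupCStar Γ))).comp
          (tensorMap c.right (id ℂ (GroupCStar Γ))) := by
      have h3 : (tensorMap (id ℂ (GroupCStar Γ)) (tensorFlip A (GroupCStar Γ))).comp
          (tensorFlip (MaxTensor A (GroupCStar Γ)) (GroupCStar Γ)) =
            F.comp (tensorAssoc A (GroupCStar Γ) (GroupCStar Γ)) :=
        tensor_hom_ext₃ fun a g h => by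
          simp only [F, hom_comp_apply, tensorFlip_tmul, tensorMap_tmul, tensorAssoc_tmul, homId_apply]
      rw [← h3]
      refine tensor_hom_ext fun a g => ?_
      simp only [hom_comp_apply, tensorFlip_tmul, tensorMap_tmul, homId_apply]
    -- This is where cocommutativity of `Δ` enters: reversing `γ ⊗ γ` changes nothing.
    have h2 : F.comp (tensorMap (id ℂ A) (comul Γ)) =
        (tensorAssoc (GroupCStar Γ) (GroupCStar Γ) A).comp
          ((tensorMap (comul Γ) (id ℂ A)).comp (tensorFlip A (GroupCStar Γ))) :=
      tensor_group_hom_ext fun a γ => by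
        simp only [F, hom_comp_apply, tensorFlip_tmul, tensorMap_tmul, tensorAssoc_tmul, homId_apply,
          comul_of]
    refine NonUnitalStarAlgHom.ext fun x => ?_
    have e1 := DFunLike.congr_fun h1 (c.right x)
    have e2 := DFunLike.congr_fun h2 (c.right x)
    have e3 := DFunLike.congr_fun c.right_coassoc x
    simp only [hom_comp_apply] at e1 e2 e3 ⊢
    rw [e1, e3, e2]
  right_coassoc := by
    let F := (tensorAssoc A (GroupCStar Γ) (GroupCStar Γ)).comp
      ((tensorMap (tensorFlip (GroupCStar Γ) A) (id ℂ (GroupCStar Γ))).comp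
        (tensorFlip (GroupCStar Γ) (MaxTensor (GroupCStar Γ) A)))
    have h1 : F.comp (tensorMap (id ℂ (GroupCStar Γ)) c.left) =
        (tensorAssoc A (GroupCStar Γ) (GroupCStar Γ)).comp
          ((tensorMap ((tensorFlip (GroupCStar Γ) A).comp c.left) (id ℂ (GroupCStar Γ))).comp
            (tensorFlip (GroupCStar Γ) A)) :=
      tensor_hom_ext fun g a => by
        simp only [F, hom_comp_apply, tensorFlip_tmul, tensorMap_tmul, homId_apply]
    have h2 : F.comp ((tensorAssoc (GroupCStar Γ) (GroupCStar Γ) A).comp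
        (tensorMap (comul Γ) (id ℂ A))) =
        (tensorMap (id ℂ A) (comul Γ)).comp (tensorFlip (GroupCStar Γ) A) :=
      group_tensor_hom_ext fun γ a => by
        simp only [F, hom_comp_apply, tensorFlip_tmul, tensorMap_tmul, tensorAssoc_tmul, homId_apply,
          comul_of]
    refine NonUnitalStarAlgHom.ext fun x => ?_
    have e1 := DFunLike.congr_fun h1 (c.left x)
    have e2 := DFunLike.congr_fun h2 (c.left x)
    have e3 := DFunLike.congr_fun c.left_coassoc x
    simp only [hom_comp_apply] at e1 e2 e3 ⊢
    rw [← e1, e3, e2]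
  left_right := by
    -- `F` sends `(g ⊗ a) ⊗ h` to `h ⊗ (a ⊗ g)`: the outer factors trade places, which exchanges the
    -- two sides of the compatibility of the coactions.
    let F := (tensorMap (id ℂ (GroupCStar Γ)) (tensorFlip (GroupCStar Γ) A)).comp
      (tensorFlip (MaxTensor (GroupCStar Γ) A) (GroupCStar Γ))
    have h1 : (tensorAssoc (GroupCStar Γ) A (GroupCStar Γ)).comp
          ((tensorMap ((tensorFlip A (GroupCStar Γ)).comp c.right) (id ℂ (GroupCStar Γ))).comp
            (tensorFlip (GroupCStar Γ) A)) =
        (F.comp (tensorAssocInv (GroupCStar Γ) A (GroupCStar Γ))).comp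
          (tensorMap (id ℂ (GroupCStar Γ)) c.right) := by
      have h3 : (tensorAssoc (GroupCStar Γ) A (GroupCStar Γ)).comp
          ((tensorMap (tensorFlip A (GroupCStar Γ)) (id ℂ (GroupCStar Γ))).comp
            (tensorFlip (GroupCStar Γ) (MaxTensor A (GroupCStar Γ)))) =
          F.comp (tensorAssocInv (GroupCStar Γ) A (GroupCStar Γ)) :=
        tensor_hom_ext₃' fun g a h => by
          simp only [F, hom_comp_apply, tensorFlip_tmul, tensorMap_tmul, tensorAssoc_tmul,
            tensorAssocInv_tmul, homId_apply]
      rw [← h3]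
      refine tensor_hom_ext fun g a => ?_
      simp only [hom_comp_apply, tensorFlip_tmul, tensorMap_tmul, homId_apply]
    have h2 : F.comp (tensorMap c.left (id ℂ (GroupCStar Γ))) =
        (tensorMap (id ℂ (GroupCStar Γ)) ((tensorFlip (GroupCStar Γ) A).comp c.left)).comp
          (tensorFlip A (GroupCStar Γ)) :=
      tensor_hom_ext fun a g => by
        simp only [F, hom_comp_apply, tensorFlip_tmul, tensorMap_tmul, homId_apply]
    refine NonUnitalStarAlgHom.ext fun x => ?_
    have e1 := DFunLike.congr_fun h1 (c.left x)
    have e2 := DFunLike.congr_fun h2 (c.right x)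
    have e3 := DFunLike.congr_fun c.left_right x
    simp only [hom_comp_apply] at e1 e2 e3 ⊢
    rw [e1, ← e3, tensorAssocInv_tensorAssoc, e2]

theorem op_left_apply (c : CGammaStructure Γ A) (a : A) :
    c.op.left a = tensorFlip A (GroupCStar Γ) (c.right a) := by
  rw [← hom_comp_apply]
  rfl

/-! ### Slices and components of a fixed degree -/

variable (Γ A) in
/-- The map `γ ⊗ (γ' ⊗ a) ↦ δ_{γ,γ'} a`. -/
def pairSlice : MaxTensor (GroupCStar Γ) (MaxTensor (GroupCStar Γ) A) →L[ℂ] A :=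
  (diagSlice Γ A).comp (homCLM ((tensorFlip (MaxTensor (GroupCStar Γ) (GroupCStar Γ)) A).comp
    (tensorAssocInv (GroupCStar Γ) (GroupCStar Γ) A)))

open Classical in
theorem pairSlice_tmul (γ γ' : Γ) (a : A) :
    pairSlice Γ A (tmul (GroupCStar.of γ) (tmul (GroupCStar.of γ') a)) =
      if γ = γ' then a else 0 := by
  rw [pairSlice, clm_comp_apply, homCLM_apply, hom_comp_apply, tensorAssocInv_tmul,
    tensorFlip_tmul, diagSlice_tmul]

variable (A) in
/-- The map `γ' ⊗ a ↦ δ_{γ,γ'} a`. -/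
def degreeSlice (γ : Γ) : MaxTensor (GroupCStar Γ) A →L[ℂ] A :=
  (pairSlice Γ A).comp (tmulLeft _ (GroupCStar.of γ))

open Classical in
theorem degreeSlice_tmul (γ γ' : Γ) (a : A) :
    degreeSlice A γ (tmul (GroupCStar.of γ') a) = if γ = γ' then a else 0 := by
  rw [degreeSlice, clm_comp_apply, tmulLeft_apply, pairSlice_tmul]

theorem degreeSlice_natural (γ : Γ) (f : A →⋆ₙₐ[ℂ] B) (x : MaxTensor (GroupCStar Γ) A) :
    degreeSlice B γ (tensorMap (id ℂ (GroupCStar Γ)) f x) = f (degreeSlice A γ x) := by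
  classical
  have key := group_tensor_ext (f := (degreeSlice B γ).comp
      (homCLM (tensorMap (id ℂ (GroupCStar Γ)) f)))
    (g := (homCLM f).comp (degreeSlice A γ)) (fun γ' a => ?_) x
  · simpa only [clm_comp_apply, homCLM_apply] using key
  simp only [clm_comp_apply, homCLM_apply, tensorMap_tmul, homId_apply,
    degreeSlice_tmul]
  split_ifs
  · rfl
  · rw [map_zero]

variable (c : CGammaStructure Γ A)

/-- The counit identity is not an axiom; it follows from injectivity of `δ`. Applying `δ` to `(ε ⊗
id)δ(a)` gives `(ε ⊗ id ⊗ id)(id ⊗ δ)δ(a) = (ε ⊗ id ⊗ id)(Δ ⊗ id)δ(a) = δ(a)`. -/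
theorem counitSlice_left (a : A) : counitSlice Γ A (c.left a) = a := by
  apply c.left_injective
  have h1 : c.left.comp (counitSlice Γ A) =
      (counitSlice Γ _).comp (tensorMap (id ℂ (GroupCStar Γ)) c.left) :=
    group_tensor_hom_ext fun γ a => by
      simp only [hom_comp_apply, tensorMap_tmul, homId_apply, counitSlice_tmul]
  have h2 : (counitSlice Γ _).comp ((tensorAssoc (GroupCStar Γ) (GroupCStar Γ) A).comp
      (tensorMap (comul Γ) (id ℂ A))) = id ℂ _ :=
    group_tensor_hom_ext fun γ a => by
      simp only [hom_comp_apply, tensorMap_tmul, homId_apply, counitSlice_tmul, comul_of,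
        tensorAssoc_tmul]
  have e1 := DFunLike.congr_fun h1 (c.left a)
  have e2 := DFunLike.congr_fun h2 (c.left a)
  have e3 := DFunLike.congr_fun c.left_coassoc a
  simp only [hom_comp_apply] at e1 e2 e3
  rw [e1, e3, e2, homId_apply]

/-- The component of degree `γ` with respect to the left coaction. -/
def leftComponent (γ : Γ) : A →L[ℂ] A := (degreeSlice A γ).comp (homCLM c.left)

theorem leftComponent_apply (γ : Γ) (a : A) :
    leftComponent c γ a = degreeSlice A γ (c.left a) := by
  rw [leftComponent, clm_comp_apply, homCLM_apply]

theorem degreeSlice_comul (γ : Γ) (y : MaxTensor (GroupCStar Γ) A) :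
    degreeSlice (MaxTensor (GroupCStar Γ) A) γ
      (tensorAssoc (GroupCStar Γ) (GroupCStar Γ) A (tensorMap (comul Γ) (id ℂ A) y)) =
        tmul (GroupCStar.of γ) (degreeSlice A γ y) := by
  classical
  have key := group_tensor_ext (f := (degreeSlice (MaxTensor (GroupCStar Γ) A) γ).comp
    (homCLM ((tensorAssoc (GroupCStar Γ) (GroupCStar Γ) A).comp
      (tensorMap (comul Γ) (id ℂ A))))) (g := (tmulLeft A (GroupCStar.of γ)).comp
        (degreeSlice A γ)) (fun γ' a => ?_) y
  · simpa only [clm_comp_apply, homCLM_apply, hom_comp_apply, tmulLeft_apply] using key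
  simp only [clm_comp_apply, homCLM_apply, hom_comp_apply, tensorMap_tmul,
    homId_apply, comul_of, tensorAssoc_tmul, degreeSlice_tmul (A := A),
    degreeSlice_tmul (A := MaxTensor (GroupCStar Γ) A), tmulLeft_apply]
  split_ifs with h
  · rw [h]
  · rw [tmul_zero]

/-- By naturality of slices, `δ` of the component is the slice of `(id ⊗ δ)δ(a) = (Δ ⊗ id)δ(a)` in
its first leg, and `Δ` copies the selected degree `γ` into the remaining leg. -/
theorem left_leftComponent (γ : Γ) (a : A) :
    c.left (leftComponent c γ a) = tmul (GroupCStar.of γ) (leftComponent c γ a) := by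
  have e3 := DFunLike.congr_fun c.left_coassoc a
  simp only [hom_comp_apply] at e3
  rw [leftComponent_apply,
    ← degreeSlice_natural (A := A) (B := MaxTensor (GroupCStar Γ) A) γ c.left (c.left a), e3,
    degreeSlice_comul]

/-- No convergence of `∑ a_γ` is claimed. The map `pairSlice ∘ (id ⊗ δ)` sends `γ ⊗ b` to a
component of `b`, so by continuity it maps everything into the closed span `V` of the components. At
`δ(a)`, coassociativity turns it into `pairSlice ∘ (Δ ⊗ id) = ε ⊗ id`, whose value there is `a`;
thus `a ∈ V`. -/
theorem dense_span_leftComponent :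
    Dense (Submodule.span ℂ {a | ∃ γ b, a = leftComponent c γ b} : Set A) := by
  classical
  set V := (Submodule.span ℂ {a | ∃ γ b, a = leftComponent c γ b}).topologicalClosure with hV
  have hc : IsClosed (V : Set A) := Submodule.isClosed_topologicalClosure _
  have h1 : ∀ y, pairSlice Γ A (tensorMap (id ℂ (GroupCStar Γ)) c.left y) ∈ V := by
    intro y
    let f := (pairSlice Γ A).comp (homCLM (tensorMap (id ℂ (GroupCStar Γ)) c.left))
    have key : f y ∈ V := by
      refine (dense_span_tmul dense_span_of (dense_span_univ A)).induction (P := fun y => f y ∈ V)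
        (fun y hy => ?_) (hc.preimage f.continuous) y
      refine Submodule.span_induction (p := fun y _ => f y ∈ V) ?_
        (by simp) (fun x y _ _ hx hy => by rw [map_add]; exact add_mem hx hy)
        (fun c x _ hx => by rw [map_smul]; exact V.smul_mem c hx) hy
      rintro _ ⟨_, ⟨γ, rfl⟩, a, _, rfl⟩
      refine Submodule.le_topologicalClosure _ (Submodule.subset_span ⟨γ, a, ?_⟩)
      simp only [f, clm_comp_apply, homCLM_apply, tensorMap_tmul, homId_apply, leftComponent_apply,
        degreeSlice, tmulLeft_apply]
    simpa only [f, clm_comp_apply, homCLM_apply] using key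
  have h2 : ∀ y, pairSlice Γ A (tensorAssoc (GroupCStar Γ) (GroupCStar Γ) A
      (tensorMap (comul Γ) (id ℂ A) y)) = counitSlice Γ A y := by
    intro y
    have key := group_tensor_ext (f := (pairSlice Γ A).comp
      (homCLM ((tensorAssoc (GroupCStar Γ) (GroupCStar Γ) A).comp
        (tensorMap (comul Γ) (id ℂ A))))) (g := homCLM (counitSlice Γ A)) (fun γ' a => ?_) y
    · simpa only [clm_comp_apply, homCLM_apply, hom_comp_apply] using key
    simp only [clm_comp_apply, homCLM_apply, hom_comp_apply, tensorMap_tmul,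
      homId_apply, comul_of, tensorAssoc_tmul, pairSlice_tmul, counitSlice_tmul, if_true]
  rw [← dense_closure, ← Submodule.topologicalClosure_coe, ← hV]
  refine Dense.of_closure (dense_univ.mono fun a _ => subset_closure ?_)
  have e3 := DFunLike.congr_fun c.left_coassoc a
  simp only [hom_comp_apply] at e3
  have h3 := h1 (c.left a)
  rwa [e3, h2, counitSlice_left] at h3

/-- The elements that are homogeneous of degree `γ` with respect to the left coaction and
homogeneous of degree `η` with respect to the right coaction. -/
structure IsBihomogeneous (γ η : Γ) (a : A) : Prop where
  left : c.left a = tmul (GroupCStar.of γ) a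
  right : c.right a = tmul a (GroupCStar.of η)

/-- The set of all bihomogeneous elements. -/
def bihomogeneous : Set A := {a | ∃ γ η, IsBihomogeneous c γ η a}

theorem right_eq_of_op {γ : Γ} {a : A} (h : c.op.left a = tmul (GroupCStar.of γ) a) :
    c.right a = tmul a (GroupCStar.of γ) := by
  have h' := congrArg (tensorFlip (GroupCStar Γ) A) h
  rwa [tensorFlip_tmul, op_left_apply, tensorFlip_tensorFlip] at h'

/-- Since the coactions commute, slicing on the right does not disturb the left degree. -/
theorem left_rightComponent {γ : Γ} {a : A} (h : c.left a = tmul (GroupCStar.of γ) a) (η : Γ) :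
    c.left (leftComponent c.op η a) = tmul (GroupCStar.of γ) (leftComponent c.op η a) := by
  classical
  have h1 : (tensorMap (id ℂ (GroupCStar Γ)) c.left).comp (tensorFlip A (GroupCStar Γ)) =
      (tensorFlip _ (GroupCStar Γ)).comp (tensorMap c.left (id ℂ (GroupCStar Γ))) :=
    tensor_hom_ext fun a g => by
      simp only [hom_comp_apply, tensorFlip_tmul, tensorMap_tmul, homId_apply]
  have h2 : ∀ y : MaxTensor A (GroupCStar Γ), degreeSlice (MaxTensor (GroupCStar Γ) A) η
      (tensorFlip (MaxTensor (GroupCStar Γ) A) (GroupCStar Γ)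
        (tensorAssocInv (GroupCStar Γ) A (GroupCStar Γ) (tmul (GroupCStar.of γ) y))) =
      tmul (GroupCStar.of γ) (degreeSlice A η (tensorFlip A (GroupCStar Γ) y)) := by
    intro y
    have key := tensor_group_ext (f := ((degreeSlice (MaxTensor (GroupCStar Γ) A) η).comp
      (homCLM ((tensorFlip (MaxTensor (GroupCStar Γ) A) (GroupCStar Γ)).comp
        (tensorAssocInv (GroupCStar Γ) A (GroupCStar Γ))))).comp (tmulLeft _ (GroupCStar.of γ)))
      (g := (tmulLeft A (GroupCStar.of γ)).comp ((degreeSlice A η).comp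
        (homCLM (tensorFlip A (GroupCStar Γ))))) (fun a γ' => ?_) y
    · simpa only [clm_comp_apply, homCLM_apply, hom_comp_apply, tmulLeft_apply] using key
    simp only [clm_comp_apply, homCLM_apply, hom_comp_apply, tensorAssocInv_tmul,
      tensorFlip_tmul, degreeSlice_tmul (A := A),
      degreeSlice_tmul (A := MaxTensor (GroupCStar Γ) A), tmulLeft_apply]
    split_ifs
    · rfl
    · rw [tmul_zero]
  have e1 := DFunLike.congr_fun h1 (c.right a)
  have e2 := DFunLike.congr_fun c.left_right a
  simp only [hom_comp_apply] at e1 e2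
  rw [h, tensorMap_tmul, homId_apply] at e2
  have e3 := congrArg (tensorAssocInv (GroupCStar Γ) A (GroupCStar Γ)) e2
  rw [tensorAssocInv_tensorAssoc] at e3
  rw [leftComponent_apply,
    ← degreeSlice_natural (A := A) (B := MaxTensor (GroupCStar Γ) A) η c.left (c.op.left a),
    op_left_apply, e1, e3, h2]

/-- The right components of left components are bihomogeneous. They approximate all right components
by density of the left ones, and the right components are total by the same density result for the
opposite structure. -/
theorem dense_span_bihomogeneous : Dense (Submodule.span ℂ (bihomogeneous c) : Set A) := by
  set V := (Submodule.span ℂ (bihomogeneous c)).topologicalClosure with hV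
  have hc : IsClosed (V : Set A) := Submodule.isClosed_topologicalClosure _
  have h1 : ∀ η a, leftComponent c.op η a ∈ V := by
    intro η a
    refine (dense_span_leftComponent c).induction (P := fun a => leftComponent c.op η a ∈ V)
      (fun a ha => ?_) (hc.preimage (leftComponent c.op η).continuous) a
    refine Submodule.span_induction (p := fun a _ => leftComponent c.op η a ∈ V) ?_
      (by simp) (fun x y _ _ hx hy => by rw [map_add]; exact add_mem hx hy)
      (fun c x _ hx => by rw [map_smul]; exact V.smul_mem c hx) ha
    rintro _ ⟨γ, b, rfl⟩
    refine Submodule.le_topologicalClosure _ (Submodule.subset_span ⟨γ, η, ?_, ?_⟩)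
    · exact left_rightComponent c (left_leftComponent c γ b) η
    · exact right_eq_of_op c (left_leftComponent c.op η _)
  rw [← dense_closure, ← Submodule.topologicalClosure_coe, ← hV]
  refine (dense_span_leftComponent c.op).mono (SetLike.coe_subset_coe.mpr (Submodule.span_le.mpr ?_))
  rintro _ ⟨η, a, rfl⟩
  exact h1 η a

end Homogeneous

end CGamma

namespace CGamma

/-! ### Completely positive conditional expectations -/

section Expectation

attribute [local instance] CStarAlgebra.spectralOrder CStarAlgebra.spectralOrderedRing

variable {Y Z : Type*} [NonUnitalCStarAlgebra Y] [NonUnitalCStarAlgebra Z]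

/-- Injective ⋆-homomorphisms reflect positivity. -/
theorem nonneg_of_map_nonneg (k : Z →⋆ₙₐ[ℂ] Y) (hk : Function.Injective k) {z : Z}
    (h : 0 ≤ k z) : 0 ≤ z := by
  have hz : IsSelfAdjoint z := hk (by rw [map_star]; exact h.isSelfAdjoint)
  have hc := continuous_hom k
  -- ⋆-homomorphisms commute with the functional calculus, so an injective one detects a nonzero
  -- negative part.
  have h1 : k z⁻ = (k z)⁻ := by
    rw [CFC.negPart_def, CFC.negPart_def]
    exact NonUnitalStarAlgHom.map_cfcₙ k _ z (hφa := h.isSelfAdjoint)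
  have h2 : z⁻ = 0 := hk (by
    rw [h1, map_zero]; exact (CFC.negPart_eq_zero_iff _ h.isSelfAdjoint).mpr h)
  exact (CFC.negPart_eq_zero_iff z hz).mp h2

theorem eq_zero_of_sum_star_mul_self_nonpos {ι : Type*} [Fintype ι] {t : ι → Z}
    (h : ∑ i, star (t i) * t i ≤ 0) (i : ι) : t i = 0 := by
  have h0 : ∑ i, star (t i) * t i = 0 :=
    le_antisymm h (Finset.sum_nonneg fun i _ => star_mul_self_nonneg _)
  exact CStarRing.star_mul_self_eq_zero_iff _ |>.mp
    ((Finset.sum_eq_zero_iff_of_nonneg fun i _ => star_mul_self_nonneg _).mp h0 i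
      (Finset.mem_univ i))

/-- The negative part `N` of `M` is described by algebraic identities, in the form needed for matrix
algebras; the product formula expresses that the positive and negative parts are orthogonal. -/
theorem exists_negative_part {M : Z} (hM : IsSelfAdjoint M) :
    ∃ N S : Z, star N = N ∧ N = star S * S ∧ M * N = -(N * N) ∧
      (N = 0 → ∃ T : Z, M = star T * T) := by
  have h0 : 0 ≤ M⁻ := CFC.negPart_nonneg M
  obtain ⟨S, hS⟩ := CStarAlgebra.nonneg_iff_eq_star_mul_self.mp h0
  refine ⟨M⁻, S, h0.isSelfAdjoint, hS, ?_, fun h => ?_⟩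
  · conv_lhs => lhs; rw [← CFC.posPart_sub_negPart M hM]
    rw [sub_mul, CFC.posPart_mul_negPart, zero_sub]
  · exact CStarAlgebra.nonneg_iff_eq_star_mul_self.mp ((CFC.negPart_eq_zero_iff M hM).mp h)

/-- Testing the hypothesis on the columns of the negative part `N = S⋆S` makes the diagonal of `N M
N` positive. But `N M N = -(S N)⋆(S N)`, so the columns of `S N` vanish, hence `N² = 0` and `N = 0`.
-/
theorem exists_cstarMatrix_sqrt {n : ℕ} (M : CStarMatrix (Fin n) (Fin n) Z)
    (hM : IsSelfAdjoint M)
    (h : ∀ v : Fin n → Z, 0 ≤ ∑ i, ∑ j, star (v i) * (M i j * v j)) :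
    ∃ S : CStarMatrix (Fin n) (Fin n) Z, M = star S * S := by
  obtain ⟨N, S, hNs, hS, h2, h0⟩ := exists_negative_part hM
  refine h0 ?_
  have h1 : N * M * N = -(star (S * N) * (S * N)) := by
    rw [mul_assoc, h2, star_mul, hNs, mul_neg, mul_assoc, ← mul_assoc (star S), ← hS]
  have h3 : S * N = 0 := by
    ext i k
    refine eq_zero_of_sum_star_mul_self_nonpos (t := fun i => (S * N) i k) ?_ i
    have h4 := congrArg (fun T : CStarMatrix (Fin n) (Fin n) Z => T k k) h1
    have h5 : (N * M * N) k k = ∑ i, ∑ j, star (N i k) * (M i j * N j k) := by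
      rw [mul_assoc, CStarMatrix.mul_apply]
      refine Finset.sum_congr rfl fun i _ => ?_
      rw [CStarMatrix.mul_apply, Finset.mul_sum]
      refine Finset.sum_congr rfl fun j _ => ?_
      congr 1
      conv_lhs => rw [← hNs]
      exact CStarMatrix.star_apply
    have h6 : (star (S * N) * (S * N)) k k = ∑ i, star ((S * N) i k) * (S * N) i k := by
      rw [CStarMatrix.mul_apply]
      rfl
    have h7 : (N * M * N) k k = -(star (S * N) * (S * N)) k k := h4
    rw [← h6, ← neg_nonneg, ← h7, h5]
    exact h _
  have h8 : N * N = 0 := by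
    conv_lhs => lhs; rw [hS]
    rw [mul_assoc, h3, mul_zero]
  rw [← CStarRing.star_mul_self_eq_zero_iff, hNs, h8]

/-- A conditional expectation is completely positive. -/
theorem isCP_of_bimodule (k : Z →⋆ₙₐ[ℂ] Y) (hk : Function.Injective k) (P : Y →L[ℂ] Z)
    (hl : ∀ z y, P (k z * y) = z * P y) (hr : ∀ y z, P (y * k z) = P y * z)
    (hs : ∀ y, P (star y) = star (P y)) (h0 : ∀ y, 0 ≤ k (P (star y * y))) : IsCP P := by
  intro n y
  set M : CStarMatrix (Fin n) (Fin n) Z := CStarMatrix.ofMatrix fun i j => P (star (y i) * y j)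
    with hM
  have hMij : ∀ i j, M i j = P (star (y i) * y j) := fun i j => rfl
  have hsa : IsSelfAdjoint M := by
    ext i j
    rw [CStarMatrix.star_apply, hMij, hMij, ← hs, star_mul, star_star]
  obtain ⟨S, hS⟩ := exists_cstarMatrix_sqrt M hsa (fun v => by
    -- The bimodule property moves the coefficients inside `P`, where the double sum becomes a
    -- single `y⋆y`.
    have h1 : ∑ i, ∑ j, star (v i) * (M i j * v j) =
        P (star (∑ i, y i * k (v i)) * ∑ i, y i * k (v i)) := by
      rw [star_sum, Finset.sum_mul_sum, map_sum]
      refine Finset.sum_congr rfl fun i _ => ?_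
      rw [map_sum]
      refine Finset.sum_congr rfl fun j _ => ?_
      rw [star_mul, ← map_star, hMij, mul_assoc, hl, ← mul_assoc (star (y i)), hr]
    rw [h1]
    exact nonneg_of_map_nonneg k hk (h0 _))
  refine ⟨n, fun l i => S l i, fun i j => ?_⟩
  rw [← hMij, hS, CStarMatrix.mul_apply]
  rfl

end Expectation

end CGamma

namespace CGamma

open Filter Topology
open NonUnitalStarAlgHom (id)

/-! ### The projection onto the cotensor product -/

section Projection

variable {Γ : Type*} [Group Γ] {A B C D : Type*} [NonUnitalCStarAlgebra A]
  [NonUnitalCStarAlgebra B] [NonUnitalCStarAlgebra C] [NonUnitalCStarAlgebra D]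

variable (B C D) in
/-- The isomorphism `b ⊗ (c ⊗ d) ↦ d ⊗ (b ⊗ c)`. -/
def rotateTensor : MaxTensor B (MaxTensor C D) →⋆ₙₐ[ℂ] MaxTensor D (MaxTensor B C) :=
  (tensorFlip (MaxTensor B C) D).comp (tensorAssocInv B C D)

theorem rotateTensor_tmul (b : B) (c : C) (d : D) :
    rotateTensor B C D (tmul b (tmul c d)) = tmul d (tmul b c) := by
  rw [rotateTensor, hom_comp_apply, tensorAssocInv_tmul, tensorFlip_tmul (A := MaxTensor B C)]

/-- The ⋆-homomorphism `a ⊗ e ↦ (a ⊗ d) ⊗ c`, where `g e = d ⊗ c`. -/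
def assocAlong (A : Type*) [NonUnitalCStarAlgebra A] (g : B →⋆ₙₐ[ℂ] MaxTensor D C) :
    MaxTensor A B →⋆ₙₐ[ℂ] MaxTensor (MaxTensor A D) C :=
  (tensorAssocInv A D C).comp (tensorMap (id ℂ A) g)

theorem assocAlong_tmul {g : B →⋆ₙₐ[ℂ] MaxTensor D C} (a : A) {b : B} {c : C} {d : D}
    (h : g b = tmul d c) : assocAlong A g (tmul a b) = tmul (tmul a d) c := by
  rw [assocAlong, hom_comp_apply, tensorMap_tmul, homId_apply, h, tensorAssocInv_tmul]

variable (cA : CGammaStructure Γ A) (cB : CGammaStructure Γ B)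

/-- The ⋆-homomorphism `γ ⊗ b ↦ b ⊗ (γ ⊗ γ')`, for `b` of degree `γ'`. -/
def degreeHom : MaxTensor (GroupCStar Γ) B →⋆ₙₐ[ℂ]
    MaxTensor B (MaxTensor (GroupCStar Γ) (GroupCStar Γ)) :=
  (rotateTensor (GroupCStar Γ) (GroupCStar Γ) B).comp (tensorMap (id ℂ (GroupCStar Γ)) cB.left)

theorem degreeHom_tmul {γ γ' : Γ} {b : B} (hb : cB.left b = tmul (GroupCStar.of γ') b) :
    degreeHom cB (tmul (GroupCStar.of γ) b) =
      tmul b (tmul (GroupCStar.of γ) (GroupCStar.of γ')) := by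
  rw [degreeHom, hom_comp_apply, tensorMap_tmul, hb, homId_apply, rotateTensor_tmul]

/-- The map `a ⊗ (γ ⊗ b) ↦ a ⊗ b_γ`, where `b_γ` is the component of degree `γ`. -/
def degreeMatch (A : Type*) [NonUnitalCStarAlgebra A] (cB : CGammaStructure Γ B) :
    MaxTensor A (MaxTensor (GroupCStar Γ) B) →L[ℂ] MaxTensor A B :=
  (diagSlice Γ (MaxTensor A B)).comp (homCLM (assocAlong A (degreeHom cB)))

open Classical in
theorem degreeMatch_tmul {γ γ' : Γ} (a : A) {b : B} (hb : cB.left b = tmul (GroupCStar.of γ') b) :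
    degreeMatch A cB (tmul a (tmul (GroupCStar.of γ) b)) = if γ = γ' then tmul a b else 0 := by
  rw [degreeMatch, clm_comp_apply, homCLM_apply, assocAlong_tmul a (degreeHom_tmul cB hb),
    diagSlice_tmul (A := MaxTensor A B)]

/-- On `a ⊗ b` with `b` homogeneous, the left coaction only records the degree of `b`, and
`degreeMatch` compares that degree with itself. -/
theorem degreeMatch_left (x : MaxTensor A B) :
    degreeMatch A cB (tensorMap (id ℂ A) cB.left x) = x := by
  have key : (degreeMatch A cB).comp (homCLM (tensorMap (id ℂ A) cB.left)) =
      ContinuousLinearMap.id ℂ (MaxTensor A B) := by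
    refine tensor_clm_ext (dense_span_univ A) (dense_span_bihomogeneous cB) ?_
    rintro a _ b ⟨γ, η, hb⟩
    rw [clm_comp_apply, homCLM_apply, tensorMap_tmul, homId_apply, hb.left,
      degreeMatch_tmul cB a hb.left, if_pos rfl, ContinuousLinearMap.id_apply]
  have := DFunLike.congr_fun key x
  rwa [clm_comp_apply, homCLM_apply, ContinuousLinearMap.id_apply] at this

/-- The projection of `A ⊗ B` onto the cotensor product. -/
def cotensorProj : MaxTensor A B →L[ℂ] MaxTensor A B :=
  (degreeMatch A cB).comp (homCLM ((tensorAssoc A (GroupCStar Γ) B).comp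
    (tensorMap cA.right (id ℂ B))))

variable {cA cB}

open Classical in
theorem cotensorProj_tmul {γ γ' : Γ} {a : A} {b : B}
    (ha : cA.right a = tmul a (GroupCStar.of γ)) (hb : cB.left b = tmul (GroupCStar.of γ') b) :
    cotensorProj cA cB (tmul a b) = if γ = γ' then tmul a b else 0 := by
  rw [cotensorProj, clm_comp_apply, homCLM_apply, hom_comp_apply, tensorMap_tmul, ha, homId_apply,
    tensorAssoc_tmul, degreeMatch_tmul cB a hb]

attribute [local instance] CStarAlgebra.spectralOrder CStarAlgebra.spectralOrderedRing in
theorem cotensorProj_nonneg (x : MaxTensor A B) : 0 ≤ cotensorProj cA cB (star x * x) := by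
  rw [cotensorProj, clm_comp_apply, homCLM_apply, degreeMatch, clm_comp_apply, homCLM_apply,
    map_mul, map_star, map_mul, map_star]
  exact diagSlice_nonneg (A := MaxTensor A B) _

/-- For such `x`, the defining equation replaces `δ'_A ⊗ id` by `id ⊗ δ_B` in the projection, and
`degreeMatch` undoes the latter. -/
theorem cotensorProj_of_mem {x : MaxTensor A B} (hx : x ∈ cotensorSubalgebra cA cB) :
    cotensorProj cA cB x = x := by
  rw [mem_cotensorSubalgebra] at hx
  rw [cotensorProj, clm_comp_apply, homCLM_apply, hom_comp_apply, hx, degreeMatch_left]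

theorem tmul_mem_cotensor {γ : Γ} {a : A} {b : B} (ha : cA.right a = tmul a (GroupCStar.of γ))
    (hb : cB.left b = tmul (GroupCStar.of γ) b) : tmul a b ∈ cotensorSubalgebra cA cB := by
  rw [mem_cotensorSubalgebra, tensorMap_tmul, tensorMap_tmul, ha, hb, homId_apply, homId_apply,
    tensorAssoc_tmul]

/-- A closed subspace that contains the elementary tensors of bihomogeneous elements of matching
degrees contains the range of the projection. -/
theorem cotensorProj_mem {V : Submodule ℂ (MaxTensor A B)} (hV : IsClosed (V : Set (MaxTensor A B)))
    (h : ∀ ζ γ η a b, IsBihomogeneous cA ζ γ a → IsBihomogeneous cB γ η b → tmul a b ∈ V)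
    (x : MaxTensor A B) : cotensorProj cA cB x ∈ V := by
  classical
  refine (dense_span_tmul (dense_span_bihomogeneous cA) (dense_span_bihomogeneous cB)).induction
    (P := fun x => cotensorProj cA cB x ∈ V) (fun x hx => ?_)
    (hV.preimage (cotensorProj cA cB).continuous) x
  refine Submodule.span_induction (p := fun x _ => cotensorProj cA cB x ∈ V) ?_
      (by simp) (fun x y _ _ hx hy => by rw [map_add]; exact add_mem hx hy)
      (fun c x _ hx => by rw [map_smul]; exact V.smul_mem c hx) hx
  rintro _ ⟨a, ⟨ζ, γ, ha⟩, b, ⟨γ', η, hb⟩, rfl⟩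
  rw [cotensorProj_tmul ha.right hb.left]
  split_ifs with hγ
  · subst hγ
    exact h ζ γ η a b ha hb
  · exact V.zero_mem

/-- Induction on elements of the cotensor product. -/
theorem mem_of_mem_cotensor {V : Submodule ℂ (MaxTensor A B)}
    (hV : IsClosed (V : Set (MaxTensor A B)))
    (h : ∀ ζ γ η a b, IsBihomogeneous cA ζ γ a → IsBihomogeneous cB γ η b → tmul a b ∈ V)
    {x : MaxTensor A B} (hx : x ∈ cotensorSubalgebra cA cB) : x ∈ V := by
  rw [← cotensorProj_of_mem hx]
  exact cotensorProj_mem hV h x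

theorem cotensorProj_mem_cotensor (x : MaxTensor A B) :
    cotensorProj cA cB x ∈ cotensorSubalgebra cA cB :=
  cotensorProj_mem (V := (cotensorSubalgebra cA cB).toSubmodule) (isClosed_cotensorSubalgebra cA cB)
    (fun _ _ _ _ _ ha hb => tmul_mem_cotensor ha.right hb.left) x

theorem clm_eq_of_mem_cotensor {E : Type*} [NonUnitalCStarAlgebra E] {f g : MaxTensor A B →L[ℂ] E}
    (h : ∀ ζ γ η a b, IsBihomogeneous cA ζ γ a → IsBihomogeneous cB γ η b →
      f (tmul a b) = g (tmul a b)) {x : MaxTensor A B} (hx : x ∈ cotensorSubalgebra cA cB) :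
    f x = g x := by
  have := mem_of_mem_cotensor (V := LinearMap.ker ((f - g : MaxTensor A B →L[ℂ] E) :
    MaxTensor A B →ₗ[ℂ] E)) (f - g).isClosed_ker
    (fun ζ γ η a b ha hb => by
      rw [LinearMap.mem_ker]
      exact sub_eq_zero.mpr (h ζ γ η a b ha hb)) hx
  rw [LinearMap.mem_ker] at this
  exact sub_eq_zero.mp this

theorem IsBihomogeneous.mul {γ η γ' η' : Γ} {a a' : A} (h : IsBihomogeneous cA γ η a)
    (h' : IsBihomogeneous cA γ' η' a') : IsBihomogeneous cA (γ * γ') (η * η') (a * a') where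
  left := by rw [map_mul, h.left, h'.left, tmul_mul_tmul, GroupCStar.of_mul]
  right := by rw [map_mul, h.right, h'.right, tmul_mul_tmul, GroupCStar.of_mul]

theorem IsBihomogeneous.star {γ η : Γ} {a : A} (h : IsBihomogeneous cA γ η a) :
    IsBihomogeneous cA γ⁻¹ η⁻¹ (star a) where
  left := by rw [map_star, h.left, star_tmul, GroupCStar.of_inv]
  right := by rw [map_star, h.right, star_tmul, GroupCStar.of_inv]

theorem IsBihomogeneous.map {cA' : CGammaStructure Γ C} {π : A →⋆ₙₐ[ℂ] C}
    (hπ : IsMorphism cA cA' π) {γ η : Γ} {a : A} (h : IsBihomogeneous cA γ η a) :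
    IsBihomogeneous cA' γ η (π a) where
  left := by
    have := DFunLike.congr_fun hπ.left a
    rwa [hom_comp_apply, hom_comp_apply, h.left, tensorMap_tmul, homId_apply] at this
  right := by
    have := DFunLike.congr_fun hπ.right a
    rwa [hom_comp_apply, hom_comp_apply, h.right, tensorMap_tmul, homId_apply] at this

/-- It suffices to take `x = a ⊗ b` with inner degrees both equal to `γ`, and `y = a' ⊗ b'` with
inner degrees `γ'` and `γ''`. By cancellation in `Γ`, the degrees `γ γ'` and `γ γ''` of the product
match exactly if `γ' = γ''`. -/
theorem cotensorProj_mul_left {x : MaxTensor A B} (hx : x ∈ cotensorSubalgebra cA cB)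
    (y : MaxTensor A B) : cotensorProj cA cB (x * y) = x * cotensorProj cA cB y := by
  classical
  have key := clm_eq_of_mem_cotensor
    (f := (cotensorProj cA cB).comp ((ContinuousLinearMap.mul ℂ (MaxTensor A B)).flip y))
    (g := (ContinuousLinearMap.mul ℂ (MaxTensor A B)).flip (cotensorProj cA cB y))
    (fun ζ γ η a b ha hb => ?_) hx
  · simpa only [clm_comp_apply, ContinuousLinearMap.flip_apply, ContinuousLinearMap.mul_apply']
      using key
  have key' : (cotensorProj cA cB).comp (ContinuousLinearMap.mul ℂ (MaxTensor A B) (tmul a b)) =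
      (ContinuousLinearMap.mul ℂ (MaxTensor A B) (tmul a b)).comp (cotensorProj cA cB) := by
    refine tensor_clm_ext (dense_span_bihomogeneous cA) (dense_span_bihomogeneous cB) ?_
    rintro a' ⟨ζ', γ', ha'⟩ b' ⟨γ'', η', hb'⟩
    simp only [clm_comp_apply, ContinuousLinearMap.mul_apply', tmul_mul_tmul]
    rw [cotensorProj_tmul ha'.right hb'.left, cotensorProj_tmul (ha.mul ha').right
      (hb.mul hb').left]
    simp only [mul_right_inj, mul_ite, mul_zero, tmul_mul_tmul]
  have := DFunLike.congr_fun key' y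
  simpa only [clm_comp_apply, ContinuousLinearMap.flip_apply, ContinuousLinearMap.mul_apply']
    using this

theorem cotensorProj_mul_right {x : MaxTensor A B} (hx : x ∈ cotensorSubalgebra cA cB)
    (y : MaxTensor A B) : cotensorProj cA cB (y * x) = cotensorProj cA cB y * x := by
  classical
  have key := clm_eq_of_mem_cotensor
    (f := (cotensorProj cA cB).comp (ContinuousLinearMap.mul ℂ (MaxTensor A B) y))
    (g := ContinuousLinearMap.mul ℂ (MaxTensor A B) (cotensorProj cA cB y))
    (fun ζ γ η a b ha hb => ?_) hx
  · simpa only [clm_comp_apply, ContinuousLinearMap.mul_apply'] using key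
  have key' : (cotensorProj cA cB).comp
      ((ContinuousLinearMap.mul ℂ (MaxTensor A B)).flip (tmul a b)) =
      ((ContinuousLinearMap.mul ℂ (MaxTensor A B)).flip (tmul a b)).comp
        (cotensorProj cA cB) := by
    refine tensor_clm_ext (dense_span_bihomogeneous cA) (dense_span_bihomogeneous cB) ?_
    rintro a' ⟨ζ', γ', ha'⟩ b' ⟨γ'', η', hb'⟩
    simp only [clm_comp_apply, ContinuousLinearMap.flip_apply, ContinuousLinearMap.mul_apply',
      tmul_mul_tmul]
    rw [cotensorProj_tmul ha'.right hb'.left, cotensorProj_tmul (ha'.mul ha).right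
      (hb'.mul hb).left]
    simp only [mul_left_inj, ite_mul, zero_mul, tmul_mul_tmul]
  have := DFunLike.congr_fun key' y
  simpa only [clm_comp_apply, ContinuousLinearMap.flip_apply, ContinuousLinearMap.mul_apply']
    using this

theorem cotensorProj_star (x : MaxTensor A B) :
    cotensorProj cA cB (star x) = star (cotensorProj cA cB x) := by
  classical
  refine (dense_span_tmul (dense_span_bihomogeneous cA) (dense_span_bihomogeneous cB)).induction
    (P := fun x => cotensorProj cA cB (star x) = star (cotensorProj cA cB x)) (fun x hx => ?_)
    (isClosed_eq (by fun_prop) (by fun_prop)) x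
  refine Submodule.span_induction
    (p := fun x _ => cotensorProj cA cB (star x) = star (cotensorProj cA cB x)) ?_
      (by simp) (fun x y _ _ hx hy => by rw [star_add, map_add, map_add, hx, hy, star_add])
      (fun c x _ hx => by rw [star_smul, map_smul, map_smul, hx, star_smul]) hx
  rintro _ ⟨a, ⟨ζ, γ, ha⟩, b, ⟨γ', η, hb⟩, rfl⟩
  rw [star_tmul, cotensorProj_tmul ha.right hb.left, cotensorProj_tmul ha.star.right hb.star.left]
  simp only [inv_inj]
  split_ifs
  · rw [star_tmul]
  · rw [star_zero]

/-- Morphisms preserve degrees, so they commute with selecting the matching ones. This naturality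
transfers exactness to cotensor products. -/
theorem cotensorProj_natural {cA' : CGammaStructure Γ C} {cB' : CGammaStructure Γ D}
    {φ : A →⋆ₙₐ[ℂ] C} {ψ : B →⋆ₙₐ[ℂ] D} (hφ : IsMorphism cA cA' φ) (hψ : IsMorphism cB cB' ψ)
    (x : MaxTensor A B) :
    cotensorProj cA' cB' (tensorMap φ ψ x) = tensorMap φ ψ (cotensorProj cA cB x) := by
  classical
  have key : (cotensorProj cA' cB').comp (homCLM (tensorMap φ ψ)) =
      (homCLM (tensorMap φ ψ)).comp (cotensorProj cA cB) := by
    refine tensor_clm_ext (dense_span_bihomogeneous cA) (dense_span_bihomogeneous cB) ?_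
    rintro a ⟨ζ, γ, ha⟩ b ⟨γ', η, hb⟩
    rw [clm_comp_apply, clm_comp_apply, homCLM_apply, homCLM_apply, tensorMap_tmul,
      cotensorProj_tmul ha.right hb.left, cotensorProj_tmul (ha.map hφ).right (hb.map hψ).left]
    split_ifs
    · rw [tensorMap_tmul]
    · rw [map_zero]
  have := DFunLike.congr_fun key x
  rwa [clm_comp_apply, clm_comp_apply, homCLM_apply, homCLM_apply] at this

end Projection

end CGamma

namespace CGamma

open Filter Topology
open NonUnitalStarAlgHom (id)

/-! ### The coactions on the cotensor product -/

section Structure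

variable {Γ : Type*} [Group Γ] {A B Y Z : Type*} [NonUnitalCStarAlgebra A]
  [NonUnitalCStarAlgebra B] [NonUnitalCStarAlgebra Y] [NonUnitalCStarAlgebra Z]

theorem idTensor_tensorMap (B : Type*) [NonUnitalCStarAlgebra B] {P : Y →L[ℂ] Z} (hP : IsCP P)
    {k : Z →⋆ₙₐ[ℂ] Y} (hk : ∀ z, P (k z) = z) (x : MaxTensor B Z) :
    idTensor B hP (tensorMap (id ℂ B) k x) = x := by
  have key : (idTensor B hP).comp (homCLM (tensorMap (id ℂ B) k)) =
      ContinuousLinearMap.id ℂ (MaxTensor B Z) := by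
    refine tensor_clm_ext (dense_span_univ B) (dense_span_univ Z) ?_
    rintro b _ z _
    rw [clm_comp_apply, homCLM_apply, tensorMap_tmul, homId_apply, idTensor_tmul, hk,
      ContinuousLinearMap.id_apply]
  have := DFunLike.congr_fun key x
  rwa [clm_comp_apply, homCLM_apply, ContinuousLinearMap.id_apply] at this

/-- An inclusion need not stay injective under maximal tensor products; a completely positive
retraction `P` makes it do so, with left inverse `id ⊗ P`. -/
theorem tensorMap_id_left_injective (B : Type*) [NonUnitalCStarAlgebra B] {P : Y →L[ℂ] Z}
    (hP : IsCP P) {k : Z →⋆ₙₐ[ℂ] Y} (hk : ∀ z, P (k z) = z) :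
    Function.Injective (tensorMap (id ℂ B) k) := fun x y h => by
  rw [← idTensor_tensorMap B hP hk x, h, idTensor_tensorMap B hP hk y]

theorem tensorFlip_tensorMap {A' B' : Type*} [NonUnitalCStarAlgebra A'] [NonUnitalCStarAlgebra B']
    (f : A →⋆ₙₐ[ℂ] A') (g : B →⋆ₙₐ[ℂ] B') (x : MaxTensor A B) :
    tensorFlip A' B' (tensorMap f g x) = tensorMap g f (tensorFlip A B x) := by
  have : (tensorFlip A' B').comp (tensorMap f g) = (tensorMap g f).comp (tensorFlip A B) :=
    tensor_hom_ext fun a b => by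
      simp only [hom_comp_apply, tensorMap_tmul, tensorFlip_tmul]
  have := DFunLike.congr_fun this x
  rwa [hom_comp_apply, hom_comp_apply] at this

theorem tensorMap_injective_comm {A' B' : Type*} [NonUnitalCStarAlgebra A']
    [NonUnitalCStarAlgebra B'] {f : A →⋆ₙₐ[ℂ] A'} {g : B →⋆ₙₐ[ℂ] B'}
    (h : Function.Injective (tensorMap f g)) : Function.Injective (tensorMap g f) := fun x y hxy => by
  have h1 := congrArg (tensorFlip B' A') hxy
  rw [tensorFlip_tensorMap, tensorFlip_tensorMap] at h1
  rw [← tensorFlip_tensorFlip x, h h1, tensorFlip_tensorFlip]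

/-- Factorization of ⋆-homomorphisms through injective ⋆-homomorphisms. -/
theorem exists_lift {k : Z →⋆ₙₐ[ℂ] Y} (hk : Function.Injective k) (f : A →⋆ₙₐ[ℂ] Y)
    (h : ∀ a, f a ∈ Set.range k) : ∃ g : A →⋆ₙₐ[ℂ] Z, k.comp g = f := by
  choose g hg using h
  refine ⟨{ toFun := g
            map_smul' := fun c a => hk ?_
            map_zero' := hk ?_
            map_add' := fun a b => hk ?_
            map_mul' := fun a b => hk ?_
            map_star' := fun a => hk ?_ }, DFunLike.ext _ _ hg⟩
  · simp only [hg, map_smul, MonoidHom.id_apply]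
  · rw [hg, map_zero, map_zero]
  · simp only [hg, map_add]
  · simp only [hg, map_mul]
  · simp only [hg, map_star]

theorem isClosed_range_hom {k : Z →⋆ₙₐ[ℂ] Y} (hk : Function.Injective k) :
    IsClosed (Set.range k) :=
  (NonUnitalStarAlgHom.isometry k hk).isClosedEmbedding.isClosed_range

theorem hom_ext_of_dense {S : Set Z} (hS : Dense (Submodule.span ℂ S : Set Z))
    {f g : Z →⋆ₙₐ[ℂ] Y} (h : ∀ z ∈ S, f z = g z) : f = g := by
  have : homCLM f = homCLM g := ContinuousLinearMap.ext_on hS fun z hz => by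
    rw [homCLM_apply, homCLM_apply, h z hz]
  refine DFunLike.ext _ _ fun z => ?_
  rw [← homCLM_apply f, this, homCLM_apply]

/-- A `(ℂ,Γ)`-structure defined by ⋆-homomorphisms for which there is a total subset of
bihomogeneous elements. -/
def CGammaStructure.ofTotal (l : Z →⋆ₙₐ[ℂ] MaxTensor (GroupCStar Γ) Z)
    (r : Z →⋆ₙₐ[ℂ] MaxTensor Z (GroupCStar Γ)) {S : Set Z}
    (hS : Dense (Submodule.span ℂ S : Set Z))
    (h : ∀ z ∈ S, ∃ γ η : Γ, l z = tmul (GroupCStar.of γ) z ∧ r z = tmul z (GroupCStar.of η)) :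
    CGammaStructure Γ Z where
  left := l
  right := r
  left_injective := by
    -- The counit slice is a left inverse of `l`, as can be seen on homogeneous elements.
    have key : (counitSlice Γ Z).comp l = id ℂ Z := hom_ext_of_dense hS fun z hz => by
      obtain ⟨γ, η, h1, h2⟩ := h z hz
      rw [hom_comp_apply, h1, counitSlice_tmul, homId_apply]
    intro x y hxy
    rw [← homId_apply x, ← homId_apply y, ← key, hom_comp_apply, hom_comp_apply, hxy]
  right_injective := by
    have key : (counitSlice Γ Z).comp ((tensorFlip Z (GroupCStar Γ)).comp r) = id ℂ Z :=
      hom_ext_of_dense hS fun z hz => by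
        obtain ⟨γ, η, h1, h2⟩ := h z hz
        rw [hom_comp_apply, hom_comp_apply, h2, tensorFlip_tmul, counitSlice_tmul, homId_apply]
    intro x y hxy
    rw [← homId_apply x, ← homId_apply y, ← key, hom_comp_apply, hom_comp_apply, hom_comp_apply,
      hom_comp_apply, hxy]
  left_coassoc := hom_ext_of_dense hS fun z hz => by
    obtain ⟨γ, η, h1, h2⟩ := h z hz
    simp only [hom_comp_apply, h1, tensorMap_tmul, homId_apply, comul_of, tensorAssoc_tmul]
  right_coassoc := hom_ext_of_dense hS fun z hz => by
    obtain ⟨γ, η, h1, h2⟩ := h z hz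
    simp only [hom_comp_apply, h2, tensorMap_tmul, homId_apply, comul_of, tensorAssoc_tmul]
  left_right := hom_ext_of_dense hS fun z hz => by
    obtain ⟨γ, η, h1, h2⟩ := h z hz
    simp only [hom_comp_apply, h1, h2, tensorMap_tmul, homId_apply, tensorAssoc_tmul]

variable (cA : CGammaStructure Γ A) (cB : CGammaStructure Γ B)

/-- The projection of `A ⊗ B` onto the cotensor product, as a map into the cotensor product. -/
def cotensorRetract : MaxTensor A B →L[ℂ] Cotensor cA cB :=
  LinearMap.mkContinuous
    { toFun := fun x =>
        (⟨cotensorProj cA cB x, cotensorProj_mem_cotensor x⟩ : cotensorSubalgebra cA cB)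
      map_add' := fun x y => Subtype.ext (map_add (cotensorProj cA cB) x y)
      map_smul' := fun c x => Subtype.ext (map_smul (cotensorProj cA cB) c x) }
    ‖cotensorProj cA cB‖ fun x => (cotensorProj cA cB).le_opNorm x

theorem cotensorIncl_retract (x : MaxTensor A B) :
    cotensorIncl cA cB (cotensorRetract cA cB x) = cotensorProj cA cB x := Eq.trans rfl rfl

theorem cotensorIncl_mem (z : Cotensor cA cB) :
    cotensorIncl cA cB z ∈ cotensorSubalgebra cA cB := z.2

theorem cotensorRetract_incl (z : Cotensor cA cB) :
    cotensorRetract cA cB (cotensorIncl cA cB z) = z :=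
  cotensorIncl_injective cA cB (by
    rw [cotensorIncl_retract, cotensorProj_of_mem (cotensorIncl_mem cA cB z)])

theorem isCP_cotensorRetract : IsCP (cotensorRetract cA cB) := by
  refine isCP_of_bimodule (cotensorIncl cA cB) (cotensorIncl_injective cA cB) _ (fun z y => ?_)
    (fun y z => ?_) (fun y => ?_) fun y => ?_
  · refine cotensorIncl_injective cA cB ?_
    rw [map_mul (cotensorIncl cA cB), cotensorIncl_retract, cotensorIncl_retract,
      cotensorProj_mul_left (cotensorIncl_mem cA cB z)]
  · refine cotensorIncl_injective cA cB ?_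
    rw [map_mul (cotensorIncl cA cB), cotensorIncl_retract, cotensorIncl_retract,
      cotensorProj_mul_right (cotensorIncl_mem cA cB z)]
  · refine cotensorIncl_injective cA cB ?_
    rw [map_star (cotensorIncl cA cB), cotensorIncl_retract, cotensorIncl_retract, cotensorProj_star]
  · rw [cotensorIncl_retract]
    exact cotensorProj_nonneg y

/-- Tensor products with the cotensor product embed into tensor products with `A ⊗ B`. -/
theorem tensorMap_cotensorIncl_injective (E : Type*) [NonUnitalCStarAlgebra E] :
    Function.Injective (tensorMap (id ℂ E) (cotensorIncl cA cB)) :=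
  tensorMap_id_left_injective E (isCP_cotensorRetract cA cB) (cotensorRetract_incl cA cB)

theorem tensorMap_cotensorIncl_injective' (E : Type*) [NonUnitalCStarAlgebra E] :
    Function.Injective (tensorMap (cotensorIncl cA cB) (id ℂ E)) :=
  tensorMap_injective_comm (tensorMap_cotensorIncl_injective cA cB E)

/-- The elements of the cotensor product given by bihomogeneous elementary tensors. -/
def cotensorTotal : Set (Cotensor cA cB) :=
  {z | ∃ ζ γ η a b, IsBihomogeneous cA ζ γ a ∧ IsBihomogeneous cB γ η b ∧
    cotensorIncl cA cB z = tmul a b}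

theorem dense_span_cotensorTotal :
    Dense (Submodule.span ℂ (cotensorTotal cA cB) : Set (Cotensor cA cB)) := by
  classical
  intro z
  have hz := cotensorIncl_mem cA cB z
  set V := (Submodule.span ℂ (cotensorTotal cA cB)).topologicalClosure with hV
  have hc : IsClosed (V : Set (Cotensor cA cB)) := Submodule.isClosed_topologicalClosure _
  have h1 := mem_of_mem_cotensor (cA := cA) (cB := cB)
    -- Induction on the cotensor product takes place inside `A ⊗ B`, so `V` is pulled back along the
    -- retraction.
    (V := V.comap (cotensorRetract cA cB : MaxTensor A B →ₗ[ℂ] Cotensor cA cB))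
    (hc.preimage (cotensorRetract cA cB).continuous) (fun ζ γ η a b ha hb => ?_) hz
  · rw [Submodule.mem_comap] at h1
    rw [← cotensorRetract_incl cA cB z]
    exact h1
  · refine Submodule.le_topologicalClosure _ (Submodule.subset_span ⟨ζ, γ, η, a, b, ha, hb, ?_⟩)
    exact (cotensorIncl_retract cA cB _).trans
      (cotensorProj_of_mem (tmul_mem_cotensor ha.right hb.left))

/-- The embedding has closed range, being isometric, so it is enough to lift the values at a total
set. At an element `z` given by `a ⊗ b` with `a` of left degree `ζ`, the lift is `ζ ⊗ z`. -/
theorem exists_cotensor_left : ∃ l : Cotensor cA cB →⋆ₙₐ[ℂ]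
    MaxTensor (GroupCStar Γ) (Cotensor cA cB),
    (tensorMap (id ℂ (GroupCStar Γ)) (cotensorIncl cA cB)).comp l =
    (tensorAssoc (GroupCStar Γ) A B).comp
      ((tensorMap cA.left (id ℂ B)).comp (cotensorIncl cA cB)) := by
  refine exists_lift (tensorMap_cotensorIncl_injective cA cB (GroupCStar Γ)) _ fun z => ?_
  set f := (tensorAssoc (GroupCStar Γ) A B).comp
      ((tensorMap cA.left (id ℂ B)).comp (cotensorIncl cA cB)) with hf
  set k := tensorMap (id ℂ (GroupCStar Γ)) (cotensorIncl cA cB) with hk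
  have hc : IsClosed (Set.range k) :=
    isClosed_range_hom (tensorMap_cotensorIncl_injective cA cB (GroupCStar Γ))
  refine (dense_span_cotensorTotal cA cB).induction (P := fun z => f z ∈ Set.range k)
    (fun z hz => ?_) (hc.preimage (continuous_hom f)) z
  refine Submodule.span_induction (p := fun z _ => f z ∈ Set.range k) ?_
      ⟨0, by rw [map_zero, map_zero]⟩
      (fun x y _ _ ⟨x', hx⟩ ⟨y', hy⟩ => ⟨x' + y', by rw [map_add, map_add, hx, hy]⟩)
      (fun c x _ ⟨x', hx⟩ => ⟨c • x', by rw [map_smul, map_smul, hx]⟩) hz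
  rintro z ⟨ζ, γ, η, a, b, ha, hb, h⟩
  refine ⟨tmul (GroupCStar.of ζ) z, ?_⟩
  rw [hk, hf, tensorMap_tmul, homId_apply, hom_comp_apply, hom_comp_apply, h, tensorMap_tmul,
    homId_apply, ha.left, tensorAssoc_tmul]

theorem exists_cotensor_right : ∃ r : Cotensor cA cB →⋆ₙₐ[ℂ]
    MaxTensor (Cotensor cA cB) (GroupCStar Γ),
    (tensorMap (cotensorIncl cA cB) (id ℂ (GroupCStar Γ))).comp r =
    (tensorAssocInv A B (GroupCStar Γ)).comp
      ((tensorMap (id ℂ A) cB.right).comp (cotensorIncl cA cB)) := by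
  refine exists_lift (tensorMap_cotensorIncl_injective' cA cB (GroupCStar Γ)) _ fun z => ?_
  set f := (tensorAssocInv A B (GroupCStar Γ)).comp
      ((tensorMap (id ℂ A) cB.right).comp (cotensorIncl cA cB)) with hf
  set k := tensorMap (cotensorIncl cA cB) (id ℂ (GroupCStar Γ)) with hk
  have hc : IsClosed (Set.range k) :=
    isClosed_range_hom (tensorMap_cotensorIncl_injective' cA cB (GroupCStar Γ))
  refine (dense_span_cotensorTotal cA cB).induction (P := fun z => f z ∈ Set.range k)
    (fun z hz => ?_) (hc.preimage (continuous_hom f)) z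
  refine Submodule.span_induction (p := fun z _ => f z ∈ Set.range k) ?_
      ⟨0, by rw [map_zero, map_zero]⟩
      (fun x y _ _ ⟨x', hx⟩ ⟨y', hy⟩ => ⟨x' + y', by rw [map_add, map_add, hx, hy]⟩)
      (fun c x _ ⟨x', hx⟩ => ⟨c • x', by rw [map_smul, map_smul, hx]⟩) hz
  rintro z ⟨ζ, γ, η, a, b, ha, hb, h⟩
  refine ⟨tmul z (GroupCStar.of η), ?_⟩
  rw [hk, hf, tensorMap_tmul, homId_apply, hom_comp_apply, hom_comp_apply, h, tensorMap_tmul,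
    homId_apply, hb.right, tensorAssocInv_tmul]

theorem tensorAssoc_tensorAssocInv {C : Type*} [NonUnitalCStarAlgebra C]
    (x : MaxTensor A (MaxTensor B C)) : tensorAssoc A B C (tensorAssocInv A B C x) = x := by
  have : (tensorAssoc A B C).comp (tensorAssocInv A B C) = id ℂ _ :=
    tensor_hom_ext₃' fun a b c => by
      rw [hom_comp_apply, tensorAssocInv_tmul, tensorAssoc_tmul, homId_apply]
  have := DFunLike.congr_fun this x
  rwa [hom_comp_apply, homId_apply] at this

theorem CGammaStructure.ext' {c c' : CGammaStructure Γ A} (hl : c.left = c'.left)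
    (hr : c.right = c'.right) : c = c' := by
  cases c
  cases c'
  cases hl
  cases hr
  rfl

theorem tensorAssoc_injective (A B C : Type*) [NonUnitalCStarAlgebra A] [NonUnitalCStarAlgebra B]
    [NonUnitalCStarAlgebra C] : Function.Injective (tensorAssoc A B C) :=
  Function.LeftInverse.injective (g := tensorAssocInv A B C) tensorAssocInv_tensorAssoc

/-- The cotensor product carries exactly one structure given by restriction. -/
theorem existsUnique_isRestriction :
    ∃! c : CGammaStructure Γ (Cotensor cA cB), IsRestriction cA cB c := by
  obtain ⟨l, hl⟩ := exists_cotensor_left cA cB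
  obtain ⟨r, hr⟩ := exists_cotensor_right cA cB
  -- All axioms reduce to the bihomogeneous elementary tensors, on which the lifted coactions only
  -- record the outer degrees. Uniqueness uses that the embeddings of the tensor products are
  -- injective.
  refine ⟨CGammaStructure.ofTotal l r (dense_span_cotensorTotal cA cB) ?_, ⟨hl, ?_⟩, fun c hc => ?_⟩
  · rintro z ⟨ζ, γ, η, a, b, ha, hb, h⟩
    refine ⟨ζ, η, tensorMap_cotensorIncl_injective cA cB _ ?_,
      tensorMap_cotensorIncl_injective' cA cB _ ?_⟩
    · have := DFunLike.congr_fun hl z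
      rw [hom_comp_apply, hom_comp_apply, hom_comp_apply] at this
      rw [this, h, tensorMap_tmul, tensorMap_tmul, ha.left, homId_apply, tensorAssoc_tmul,
        homId_apply, h]
    · have := DFunLike.congr_fun hr z
      rw [hom_comp_apply, hom_comp_apply, hom_comp_apply] at this
      rw [this, h, tensorMap_tmul, tensorMap_tmul, hb.right, homId_apply, tensorAssocInv_tmul,
        homId_apply, h]
  · refine DFunLike.ext _ _ fun z => ?_
    have := DFunLike.congr_fun hr z
    simp only [hom_comp_apply] at this ⊢
    exact (congrArg _ this).trans (tensorAssoc_tensorAssocInv _)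
  · refine CGammaStructure.ext' (DFunLike.ext _ _ fun z => ?_) (DFunLike.ext _ _ fun z => ?_)
    · refine tensorMap_cotensorIncl_injective cA cB _ ?_
      have h1 := DFunLike.congr_fun hc.left z
      have h2 := DFunLike.congr_fun hl z
      rw [hom_comp_apply] at h1 h2
      exact h1.trans h2.symm
    · refine tensorMap_cotensorIncl_injective' cA cB _ ?_
      have h1 := DFunLike.congr_fun hc.right z
      have h2 := DFunLike.congr_fun hr z
      rw [hom_comp_apply, hom_comp_apply] at h1
      rw [hom_comp_apply] at h2
      refine tensorAssoc_injective A B (GroupCStar Γ) (h1.trans ?_)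
      refine Eq.trans ?_ (congrArg _ h2.symm)
      rw [hom_comp_apply, hom_comp_apply, hom_comp_apply, tensorAssoc_tensorAssocInv]

end Structure

end CGamma

namespace CGamma

open Filter Topology
open NonUnitalStarAlgHom (id)

attribute [local instance] CStarAlgebra.spectralOrder CStarAlgebra.spectralOrderedRing

/-! ### Tensor products with ideals -/

section Ideal

variable {A B J : Type*} [NonUnitalCStarAlgebra A] [NonUnitalCStarAlgebra B]
  [NonUnitalCStarAlgebra J]

theorem tensorMap_ofAlg {A' B' : Type*} [NonUnitalCStarAlgebra A'] [NonUnitalCStarAlgebra B']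
    (f : A →⋆ₙₐ[ℂ] A') (g : B →⋆ₙₐ[ℂ] B') (x : A ⊗[ℂ] B) :
    tensorMap f g (ofAlg A B x) =
      ofAlg A' B' (TensorProduct.map (f : A →ₗ[ℂ] A') (g : B →ₗ[ℂ] B') x) := by
  induction x using TensorProduct.induction_on with
  | zero => simp only [map_zero]
  | add x y hx hy => simp only [map_add, hx, hy]
  | tmul a b => exact tensorMap_tmul f g a b

theorem tensor_tmul_ext {E : Type*} [NonUnitalCStarAlgebra E] {f g : MaxTensor A B →L[ℂ] E}
    (h : ∀ a b, f (tmul a b) = g (tmul a b)) : f = g :=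
  tensor_clm_ext (dense_span_univ A) (dense_span_univ B) fun a _ b _ => h a b

theorem tmul_add (a : A) (b b' : B) : tmul a (b + b') = tmul a b + tmul a b' :=
  map_add (tmulBilin A B a) b b'

theorem add_tmul (a a' : A) (b : B) : tmul (a + a') b = tmul a b + tmul a' b :=
  LinearMap.map_add₂ (tmulBilin A B) a a' b

theorem tmul_smul (c : ℂ) (a : A) (b : B) : tmul a (c • b) = c • tmul a b :=
  map_smul (tmulBilin A B a) c b

theorem smul_tmul (c : ℂ) (a : A) (b : B) : tmul (c • a) b = c • tmul a b :=
  LinearMap.map_smul₂ (tmulBilin A B) c a b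

variable {ι : J →⋆ₙₐ[ℂ] A} (hι : Function.Injective ι) (hI : ∀ a j, ∃ j', ι j' = a * ι j)

/-- The action of `A` on an ideal. -/
def idealMul : A →ₗ[ℂ] J →ₗ[ℂ] J :=
  -- The chosen element is unique because `ι` is injective, hence bilinear in `a` and `j`.
  LinearMap.mk₂ ℂ (fun a j => (hI a j).choose)
    (fun a a' j => hι (by
      rw [map_add, (hI _ _).choose_spec, (hI _ _).choose_spec, (hI _ _).choose_spec, add_mul]))
    (fun c a j => hι (by
      rw [map_smul, (hI _ _).choose_spec, (hI _ _).choose_spec, smul_mul_assoc]))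
    (fun a j j' => hι ((hI _ _).choose_spec.trans (by
      rw [map_add, mul_add, map_add, (hI _ _).choose_spec, (hI _ _).choose_spec])))
    (fun c a j => hι ((hI _ _).choose_spec.trans (by
      rw [map_smul, mul_smul_comm, map_smul, (hI _ _).choose_spec])))

theorem map_idealMul (a : A) (j : J) : ι (idealMul hι hI a j) = a * ι j := (hI a j).choose_spec

theorem norm_idealMul_le (a : A) (j : J) : ‖idealMul hι hI a j‖ ≤ ‖a‖ * ‖j‖ := by
  rw [← NonUnitalStarAlgHom.norm_map ι hι, ← NonUnitalStarAlgHom.norm_map ι hι j, map_idealMul]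
  exact norm_mul_le _ _

theorem idealMul_mul (a : A) (j j' : J) :
    idealMul hι hI a (j * j') = idealMul hι hI a j * j' :=
  hι (by rw [map_idealMul, map_mul, map_mul, map_idealMul, mul_assoc])

theorem mul_idealMul (a a' : A) (j : J) :
    idealMul hι hI (a * a') j = idealMul hι hI a (idealMul hι hI a' j) :=
  hι (by rw [map_idealMul, map_idealMul, map_idealMul, mul_assoc])

theorem star_idealMul_mul (a : A) (j j' : J) :
    star (idealMul hι hI a j) * j' = star j * idealMul hι hI (star a) j' :=
  hι (by rw [map_mul, map_mul, map_star, map_star, map_idealMul, map_idealMul, star_mul, mul_assoc])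

theorem continuous_idealMul (a : A) : Continuous (idealMul hι hI a) :=
  AddMonoidHomClass.continuous_of_bound _ ‖a‖ (norm_idealMul_le hι hI a)

/-- The action of an elementary tensor on the algebraic tensor product with an ideal. -/
def algIdealAction (a : A) (b : B) : J ⊗[ℂ] B →ₗ[ℂ] MaxTensor J B :=
  (ofAlg J B : J ⊗[ℂ] B →ₗ[ℂ] MaxTensor J B).comp
    (TensorProduct.map (idealMul hι hI a) (LinearMap.mulLeft ℂ b))

/-- Although `a` does not lie in `J`, its action is the limit of left multiplications by `a e ⊗ b f`
in `J ⊗ B`, with `e` and `f` in approximate units; these have norm at most `‖a‖ ‖b‖`. -/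
theorem norm_algIdealAction_le (a : A) (b : B) (x : J ⊗[ℂ] B) :
    ‖algIdealAction hι hI a b x‖ ≤ ‖a‖ * ‖b‖ * maxSeminorm (J ⊗[ℂ] B) x := by
  have uJ := CStarAlgebra.increasingApproximateUnit J
  have uB := CStarAlgebra.increasingApproximateUnit B
  have nJ := uJ.neBot
  have nB := uB.neBot
  set l := CStarAlgebra.approximateUnit J ×ˢ CStarAlgebra.approximateUnit B with hl
  have lim : Tendsto (fun e : J × B => tmul (idealMul hι hI a e.1) (b * e.2) * ofAlg J B x) l
      (𝓝 (algIdealAction hι hI a b x)) := by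
    induction x using TensorProduct.induction_on with
    | zero => simp
    | add x y hx hy => simpa only [map_add, mul_add] using hx.add hy
    | tmul j b' =>
      have h1 : Tendsto (fun e : J × B => (idealMul hι hI a (e.1 * j), b * (e.2 * b'))) l
          (𝓝 (idealMul hι hI a j, b * b')) := by
        refine Tendsto.prodMk_nhds ?_ ?_
        · exact ((continuous_idealMul hι hI a).tendsto j).comp
            ((uJ.tendsto_mul_right j).comp tendsto_fst)
        · exact ((continuous_const_mul b).tendsto b').comp
            ((uB.tendsto_mul_right b').comp tendsto_snd)
      have h2 := (continuous_tmul.tendsto (idealMul hι hI a j, b * b')).comp h1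
      refine h2.congr fun e => ?_
      change tmul (idealMul hι hI a (e.1 * j)) (b * (e.2 * b')) =
        tmul (idealMul hι hI a e.1) (b * e.2) * tmul j b'
      rw [tmul_mul_tmul, idealMul_mul, mul_assoc]
  refine le_of_tendsto lim.norm ?_
  filter_upwards [uJ.eventually_norm.prod_inl _, uB.eventually_norm.prod_inr _] with e h1 h2
  refine (norm_mul_le _ _).trans ?_
  rw [norm_ofAlg]
  refine mul_le_mul_of_nonneg_right ?_ ((maxSeminorm _).nonneg x)
  refine (norm_tmul_le _ _).trans (mul_le_mul ?_ ?_ (norm_nonneg _) (norm_nonneg _))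
  · exact (norm_idealMul_le hι hI a e.1).trans (mul_le_of_le_one_right (norm_nonneg _) h1)
  · exact (norm_mul_le _ _).trans (mul_le_of_le_one_right (norm_nonneg _) h2)

/-- The action of an elementary tensor on the tensor product with an ideal. -/
def idealAction (a : A) (b : B) : MaxTensor J B →L[ℂ] MaxTensor J B :=
  tensorExtend (algIdealAction hι hI a b) (‖a‖ * ‖b‖) (norm_algIdealAction_le hι hI a b)

theorem idealAction_tmul (a : A) (b : B) (j : J) (b' : B) :
    idealAction hι hI a b (tmul j b') = tmul (idealMul hι hI a j) (b * b') :=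
  tensorExtend_ofAlg _ _ _ _

/-- The action of the algebraic tensor product `A ⊗ B` on `J ⊗ B`, for an ideal `J` of `A`. -/
def idealRep : A ⊗[ℂ] B →ₗ[ℂ] MaxTensor J B →L[ℂ] MaxTensor J B :=
  TensorProduct.lift (LinearMap.mk₂ ℂ (idealAction hι hI)
    (fun a a' b => tensor_tmul_ext fun j b' => by
      rw [add_apply, idealAction_tmul, idealAction_tmul, idealAction_tmul,
        map_add, LinearMap.add_apply, add_tmul])
    (fun c a b => tensor_tmul_ext fun j b' => by
      rw [smul_apply, idealAction_tmul, idealAction_tmul,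
        map_smul, LinearMap.smul_apply, smul_tmul])
    (fun a b b'' => tensor_tmul_ext fun j b' => by
      rw [add_apply, idealAction_tmul, idealAction_tmul, idealAction_tmul,
        add_mul, tmul_add])
    (fun c a b => tensor_tmul_ext fun j b' => by
      rw [smul_apply, idealAction_tmul, idealAction_tmul, smul_mul_assoc,
        tmul_smul]))

theorem idealRep_tmul (a : A) (b : B) (j : J) (b' : B) :
    idealRep hι hI (a ⊗ₜ b) (tmul j b') = tmul (idealMul hι hI a j) (b * b') :=
  idealAction_tmul hι hI a b j b'

theorem idealRep_mul (x y : A ⊗[ℂ] B) :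
    idealRep hι hI (x * y) = (idealRep hι hI x).comp (idealRep hι hI y) := by
  induction x using TensorProduct.induction_on with
  | zero => simp
  | add x x' hx hx' => rw [add_mul, map_add, map_add, ContinuousLinearMap.add_comp, hx, hx']
  | tmul a b =>
    induction y using TensorProduct.induction_on with
    | zero => simp
    | add y y' hy hy' => rw [mul_add, map_add, map_add, ContinuousLinearMap.comp_add, hy, hy']
    | tmul a' b' =>
      refine tensor_tmul_ext fun j c => ?_
      rw [Algebra.TensorProduct.tmul_mul_tmul, clm_comp_apply, idealRep_tmul, idealRep_tmul,
        idealRep_tmul, mul_idealMul, mul_assoc]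

/-- Regarding `J ⊗ B` as a Hilbert module over itself with inner product `y⋆y'`, this says that the
action of `x⋆` is adjoint to that of `x`; the C⋆-inequality for the operator norm follows. -/
theorem star_idealRep_mul (x : A ⊗[ℂ] B) (y y' : MaxTensor J B) :
    star (idealRep hι hI x y) * y' = star y * idealRep hι hI (star x) y' := by
  induction x using TensorProduct.induction_on with
  | zero => simp
  | add x x' hx hx' =>
    rw [map_add, add_apply, star_add, add_mul, hx, hx', star_add, map_add,
      add_apply, mul_add]
  | tmul a b =>
    have h1 : ContinuousLinearMap.mul ℂ _ (star (idealRep hι hI (a ⊗ₜ b) y)) =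
        (ContinuousLinearMap.mul ℂ _ (star y)).comp (idealRep hι hI (star (a ⊗ₜ b))) := by
      refine tensor_tmul_ext fun j c => ?_
      -- After the second argument has been reduced to an elementary tensor, taking adjoints lets
      -- the first one be reduced in the same way.
      have h2 : (ContinuousLinearMap.mul ℂ _ (star (tmul j c))).comp
          (idealRep hι hI (a ⊗ₜ b)) =
          ContinuousLinearMap.mul ℂ _ (star (idealRep hι hI (star (a ⊗ₜ b)) (tmul j c))) := by
        refine tensor_tmul_ext fun j' c' => ?_
        rw [clm_comp_apply, ContinuousLinearMap.mul_apply', ContinuousLinearMap.mul_apply',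
          idealRep_tmul, TensorProduct.star_tmul, idealRep_tmul, star_tmul, star_tmul,
          tmul_mul_tmul, tmul_mul_tmul, star_idealMul_mul, star_star, star_mul, star_star,
          mul_assoc]
      have h3 := congrArg star (DFunLike.congr_fun h2 y)
      rw [clm_comp_apply, ContinuousLinearMap.mul_apply', ContinuousLinearMap.mul_apply', star_mul,
        star_mul, star_star, star_star] at h3
      rwa [clm_comp_apply, ContinuousLinearMap.mul_apply', ContinuousLinearMap.mul_apply']
    have := DFunLike.congr_fun h1 y'
    rwa [clm_comp_apply, ContinuousLinearMap.mul_apply', ContinuousLinearMap.mul_apply'] at this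

theorem norm_idealRep_sq_le (x : A ⊗[ℂ] B) :
    ‖idealRep hι hI x‖ ^ 2 ≤ ‖idealRep hι hI (star x * x)‖ := by
  rw [← Real.le_sqrt (norm_nonneg _) (norm_nonneg _)]
  refine ContinuousLinearMap.opNorm_le_bound _ (Real.sqrt_nonneg _) fun y => ?_
  refine abs_le_of_sq_le_sq' ?_ (by positivity) |>.2
  rw [mul_pow, Real.sq_sqrt (norm_nonneg _), sq, ← CStarRing.norm_star_mul_self,
    star_idealRep_mul, ← clm_comp_apply, ← idealRep_mul]
  refine (norm_mul_le _ _).trans ?_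
  rw [norm_star]
  refine (mul_le_mul_of_nonneg_left ((idealRep hι hI (star x * x)).le_opNorm y)
    (norm_nonneg y)).trans_eq ?_
  ring

theorem norm_idealRep_mul_le (x y : A ⊗[ℂ] B) :
    ‖idealRep hι hI (x * y)‖ ≤ ‖idealRep hι hI x‖ * ‖idealRep hι hI y‖ := by
  rw [idealRep_mul]
  exact ContinuousLinearMap.opNorm_comp_le _ _

theorem norm_idealRep_le_star (x : A ⊗[ℂ] B) :
    ‖idealRep hι hI x‖ ≤ ‖idealRep hι hI (star x)‖ := by
  have h1 := norm_idealRep_sq_le hι hI x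
  have h2 := norm_idealRep_mul_le hι hI (star x) x
  by_contra! h
  nlinarith [norm_nonneg (idealRep hι hI x), norm_nonneg (idealRep hι hI (star x))]

/-- The C⋆-seminorm on `A ⊗ B` given by the action on the tensor product with an ideal. -/
def idealSeminorm : CStarSeminorm (A ⊗[ℂ] B) where
  toFun x := ‖idealRep hι hI x‖
  map_zero' := by simp
  add_le' x y := by rw [map_add]; exact norm_add_le _ _
  neg' x := by simp
  smul' c x := by simp [norm_smul]
  mul_le' := norm_idealRep_mul_le hι hI
  star_mul_self' x := by
    refine le_antisymm ((norm_idealRep_mul_le hι hI _ _).trans ?_) (norm_idealRep_sq_le hι hI x)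
    rw [sq]
    refine mul_le_mul_of_nonneg_right ?_ (norm_nonneg _)
    simpa only [star_star] using norm_idealRep_le_star hι hI (star x)

theorem idealRep_map (t : J ⊗[ℂ] B) :
    idealRep hι hI (TensorProduct.map (ι : J →ₗ[ℂ] A) ((id ℂ B : B →⋆ₙₐ[ℂ] B) : B →ₗ[ℂ] B) t) =
      ContinuousLinearMap.mul ℂ (MaxTensor J B) (ofAlg J B t) := by
  induction t using TensorProduct.induction_on with
  | zero => simp only [map_zero]
  | add x y hx hy => simp only [map_add, hx, hy]
  | tmul j b =>
    refine tensor_tmul_ext fun j' b' => ?_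
    have h1 : idealMul hι hI (ι j) j' = j * j' := hι (by rw [map_idealMul, map_mul])
    have h2 : ofAlg J B (j ⊗ₜ b) = tmul j b := rfl
    have h3 : TensorProduct.map (ι : J →ₗ[ℂ] A) ((id ℂ B : B →⋆ₙₐ[ℂ] B) : B →ₗ[ℂ] B) (j ⊗ₜ b) =
      ι j ⊗ₜ b := rfl
    rw [h3, idealRep_tmul, ContinuousLinearMap.mul_apply', h1, h2, tmul_mul_tmul]

/-- Left multiplication by `y` evaluated at `y⋆` has norm `‖y‖²`. -/
theorem norm_ofAlg_le_idealRep (t : J ⊗[ℂ] B) :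
    ‖ofAlg J B t‖ ≤ ‖ContinuousLinearMap.mul ℂ (MaxTensor J B) (ofAlg J B t)‖ := by
  set y := ofAlg J B t
  have h := (ContinuousLinearMap.mul ℂ (MaxTensor J B) y).le_opNorm (star y)
  rw [ContinuousLinearMap.mul_apply', CStarRing.norm_self_mul_star, norm_star] at h
  rcases (norm_nonneg y).eq_or_lt with h0 | h0
  · rw [← h0]; exact norm_nonneg _
  · exact le_of_mul_le_mul_right h h0

include hι hI in
/-- The maximal tensor product preserves inclusions of ideals. -/
theorem tensorMap_ideal_injective :
    Function.Injective (tensorMap ι (id ℂ B)) := by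
  have h : ∀ y : MaxTensor J B, ‖y‖ ≤ ‖tensorMap ι (id ℂ B) y‖ := fun y => by
    have hc := continuous_hom (tensorMap ι (id ℂ B))
    refine (denseRange_ofAlg J B).induction_on
      (p := fun y : MaxTensor J B => ‖y‖ ≤ ‖tensorMap ι (id ℂ B) y‖) y
      (isClosed_le continuous_norm hc.norm) fun t => ?_
    rw [tensorMap_ofAlg, norm_ofAlg (A := A) (B := B)]
    refine (norm_ofAlg_le_idealRep t).trans ?_
    -- An element of the ideal acts by left multiplication, so its norm in `J ⊗ B` is bounded by a
    -- C⋆-seminorm on the algebraic tensor product of `A` and `B`, hence by the maximal one.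
    rw [← idealRep_map hι hI]
    exact le_maxSeminorm (idealSeminorm hι hI) _
  refine (injective_iff_map_eq_zero _).mpr fun y hy => ?_
  have := h y
  rwa [hy, norm_zero, norm_le_zero_iff] at this

end Ideal

end CGamma

namespace CGamma

open Filter Topology
open NonUnitalStarAlgHom (id)

attribute [local instance] CStarAlgebra.spectralOrder CStarAlgebra.spectralOrderedRing

/-! ### Quotients by closed ideals -/

section Quotient

variable {Y I : Type*} [NonUnitalCStarAlgebra Y] [NonUnitalCStarAlgebra I]

/-- In the unitization, `u - u e = u (1 - e)` with `0 ≤ 1 - e ≤ 1`. -/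
theorem norm_sub_mul_le (u : Y) {e : Y} (h0 : 0 ≤ e) (h1 : ‖e‖ ≤ 1) : ‖u - u * e‖ ≤ ‖u‖ := by
  have h2 : (e : Unitization ℂ Y) ≤ 1 := by
    rw [← CStarAlgebra.norm_le_one_iff_of_nonneg _ (Unitization.inr_nonneg_iff.mpr h0),
      Unitization.norm_inr]
    exact h1
  have h3 : ‖(1 : Unitization ℂ Y) - e‖ ≤ 1 := by
    rw [CStarAlgebra.norm_le_one_iff_of_nonneg _ (sub_nonneg.mpr h2)]
    exact sub_le_self _ (Unitization.inr_nonneg_iff.mpr h0)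
  rw [← Unitization.norm_inr (𝕜 := ℂ) (u - u * e), ← Unitization.norm_inr (𝕜 := ℂ) u]
  have h4 : ((u - u * e : Y) : Unitization ℂ Y) = u * (1 - e) := by
    rw [Unitization.inr_sub, Unitization.inr_mul, mul_sub, mul_one]
  rw [h4]
  exact (norm_mul_le _ _).trans (mul_le_of_le_one_right (norm_nonneg _) h3)

theorem norm_sub_mul_le' (u : Y) {e : Y} (h0 : 0 ≤ e) (h1 : ‖e‖ ≤ 1) : ‖u - e * u‖ ≤ ‖u‖ := by
  have := norm_sub_mul_le (star u) h0 h1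
  rwa [← norm_star, star_sub, star_mul, star_star, h0.isSelfAdjoint.star_eq, norm_star] at this

variable {k : I →⋆ₙₐ[ℂ] Y} (hI : ∀ y i, ∃ i', k i' = y * k i)

variable (k) in
/-- The range of a ⋆-homomorphism as a subspace. -/
def rangeSubmodule : Submodule ℂ Y := LinearMap.range (k : I →ₗ[ℂ] Y)

theorem mem_rangeSubmodule {y : Y} : y ∈ rangeSubmodule k ↔ ∃ i, k i = y := Iff.rfl

theorem star_mem_rangeSubmodule {y : Y} (h : y ∈ rangeSubmodule k) : star y ∈ rangeSubmodule k := by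
  obtain ⟨i, rfl⟩ := mem_rangeSubmodule.mp h
  exact mem_rangeSubmodule.mpr ⟨star i, map_star k i⟩

include hI in
theorem mul_mem_rangeSubmodule (x : Y) {y : Y} (h : y ∈ rangeSubmodule k) :
    x * y ∈ rangeSubmodule k := by
  obtain ⟨i, rfl⟩ := mem_rangeSubmodule.mp h
  exact mem_rangeSubmodule.mpr (hI x i)

include hI in
theorem mul_mem_rangeSubmodule' {x : Y} (h : x ∈ rangeSubmodule k) (y : Y) :
    x * y ∈ rangeSubmodule k := by
  have := star_mem_rangeSubmodule (mul_mem_rangeSubmodule hI (star y) (star_mem_rangeSubmodule h))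
  rwa [star_mul, star_star, star_star] at this

variable (k) in
/-- The quotient norm. -/
def quotientNorm (y : Y) : ℝ := ‖(Submodule.Quotient.mk y : Y ⧸ rangeSubmodule k)‖

theorem quotientNorm_le_of_mem {x y : Y} (h : x - y ∈ rangeSubmodule k) :
    quotientNorm k x ≤ ‖y‖ := by
  rw [quotientNorm, (Submodule.Quotient.eq _).mpr h]
  exact Submodule.Quotient.norm_mk_le _ y

theorem exists_norm_lt {x : Y} {r : ℝ} (h : quotientNorm k x < r) :
    ∃ y, x - y ∈ rangeSubmodule k ∧ ‖y‖ < r := by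
  obtain ⟨y, hy, hr⟩ := Submodule.Quotient.norm_mk_lt
    (Submodule.Quotient.mk x : Y ⧸ rangeSubmodule k) (sub_pos.mpr h)
  refine ⟨y, (Submodule.Quotient.eq _).mp hy.symm, hr.trans_eq ?_⟩
  rw [quotientNorm]
  ring

include hI in
theorem quotientNorm_mul_le (x y : Y) :
    quotientNorm k (x * y) ≤ quotientNorm k x * quotientNorm k y := by
  refine le_mul_of_forall_lt₀ fun r hr s hs => ?_
  obtain ⟨x', hx, hxr⟩ := exists_norm_lt hr
  obtain ⟨y', hy, hys⟩ := exists_norm_lt hs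
  refine (quotientNorm_le_of_mem (y := x' * y') ?_).trans ((norm_mul_le _ _).trans
    (mul_le_mul hxr.le hys.le (norm_nonneg _) ((norm_nonneg _).trans hxr.le)))
  have : x * y - x' * y' = x * (y - y') + (x - x') * y' := by
    rw [mul_sub, sub_mul]; abel
  rw [this]
  exact add_mem (mul_mem_rangeSubmodule hI _ hy) (mul_mem_rangeSubmodule' hI hx _)

-- Write `x⋆x = m + k j` with `‖m‖` close to the quotient norm of `x⋆x`. For `e` in an approximate
-- unit of the ideal, `‖x - x e‖² = ‖(1 - e) x⋆x (1 - e)‖ ≤ ‖m‖ + ‖j - e j‖`, and the last term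
-- tends to zero.
include hI in
theorem quotientNorm_sq_le (x : Y) : quotientNorm k x ^ 2 ≤ quotientNorm k (star x * x) := by
  refine le_of_forall_gt_imp_ge_of_dense fun r hr => ?_
  obtain ⟨m, hm, hmr⟩ := exists_norm_lt hr
  obtain ⟨j, hj⟩ := mem_rangeSubmodule.mp hm
  have uI := CStarAlgebra.increasingApproximateUnit I
  have nI := uI.neBot
  have lim : Tendsto (fun e : I => ‖m‖ + ‖j - e * j‖) (CStarAlgebra.approximateUnit I)
      (𝓝 (‖m‖ + ‖j - j‖)) :=
    ((tendsto_const_nhds.sub (uI.tendsto_mul_right j)).norm).const_add _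
  rw [sub_self, norm_zero, add_zero] at lim
  refine (ge_of_tendsto lim ?_).trans hmr.le
  filter_upwards [uI.eventually_nonneg, uI.eventually_norm] with e h0 h1
  have g0 : 0 ≤ k e := map_nonneg k h0
  have g1 : ‖k e‖ ≤ 1 := (NonUnitalStarAlgHom.norm_apply_le k e).trans h1
  have h2 : quotientNorm k x ≤ ‖x - x * k e‖ := by
    refine quotientNorm_le_of_mem ?_
    rw [sub_sub_cancel]
    exact mul_mem_rangeSubmodule hI _ (mem_rangeSubmodule.mpr ⟨e, rfl⟩)
  have h3 : ‖x - x * k e‖ ^ 2 = ‖star (x - x * k e) * (x - x * k e)‖ := by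
    rw [CStarRing.norm_star_mul_self, sq]
  -- The product `(1 - e)(m + k j)(1 - e)`, expanded so that no unit occurs.
  have h4 : star (x - x * k e) * (x - x * k e) =
      ((m - k e * m) - (m - k e * m) * k e) + (k (j - e * j) - k (j - e * j) * k e) := by
    have h5 : star x * x = m + k j := by rw [hj]; abel
    rw [star_sub, star_mul, g0.isSelfAdjoint.star_eq, map_sub, map_mul]
    have h6 : (star x - k e * star x) * (x - x * k e) =
      (star x * x - k e * (star x * x)) - (star x * x - k e * (star x * x)) * k e := by
      noncomm_ring
    rw [h6, h5]
    noncomm_ring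
  calc quotientNorm k x ^ 2 ≤ ‖x - x * k e‖ ^ 2 :=
        pow_le_pow_left₀ (norm_nonneg _) h2 2
    _ ≤ ‖(m - k e * m) - (m - k e * m) * k e‖ + ‖k (j - e * j) - k (j - e * j) * k e‖ := by
        rw [h3, h4]; exact norm_add_le _ _
    _ ≤ ‖m - k e * m‖ + ‖k (j - e * j)‖ :=
        add_le_add (norm_sub_mul_le _ g0 g1) (norm_sub_mul_le _ g0 g1)
    _ ≤ ‖m‖ + ‖j - e * j‖ :=
        add_le_add (norm_sub_mul_le' _ g0 g1) (NonUnitalStarAlgHom.norm_apply_le k _)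

/-- The quotient norm of a closed ideal is a C⋆-seminorm. -/
def quotientSeminorm : CStarSeminorm Y where
  toFun := quotientNorm k
  map_zero' := by rw [quotientNorm, Submodule.Quotient.mk_zero, norm_zero]
  add_le' x y := by
    rw [quotientNorm, Submodule.Quotient.mk_add]
    exact norm_add_le _ _
  neg' x := by rw [quotientNorm, Submodule.Quotient.mk_neg, norm_neg, quotientNorm]
  smul' c x := by
    rw [quotientNorm, Submodule.Quotient.mk_smul, norm_smul, quotientNorm]
  mul_le' := quotientNorm_mul_le hI
  star_mul_self' x := by
    refine le_antisymm ((quotientNorm_mul_le hI _ _).trans ?_) (quotientNorm_sq_le hI x)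
    rw [sq]
    refine mul_le_mul_of_nonneg_right ?_ (norm_nonneg _)
    have h1 := quotientNorm_sq_le hI (star x)
    have h2 := quotientNorm_mul_le hI (star (star x)) (star x)
    rw [star_star] at h1 h2
    have h3 : 0 ≤ quotientNorm k (star x) := norm_nonneg _
    have h4 : 0 ≤ quotientNorm k x := norm_nonneg _
    by_contra! h
    nlinarith

theorem quotientSeminorm_apply (y : Y) : quotientSeminorm hI y = quotientNorm k y := rfl

end Quotient

/-! ### Transport of C⋆-seminorms along homomorphisms -/

section Descend

variable {X X' : Type*} [NonUnitalRing X] [StarRing X] [Module ℂ X] [NonUnitalRing X'] [StarRing X']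
  [Module ℂ X']

theorem CStarSeminorm.congr (p : CStarSeminorm X) {x y : X} (h : p (x - y) = 0) : p x = p y := by
  have h1 := map_add_le_add p.toSeminorm (x - y) y
  have h2 := map_sub_le_add p.toSeminorm x (x - y)
  rw [sub_add_cancel] at h1
  rw [sub_sub_cancel] at h2
  have h3 : p.toSeminorm (x - y) = 0 := h
  rw [h3] at h1 h2
  exact le_antisymm (by simpa using h1) (by simpa using h2)

/-- The C⋆-seminorm induced on a quotient of a ⋆-algebra. -/
def CStarSeminorm.descend (p : CStarSeminorm X) (ρ : X →ₗ[ℂ] X') (hs : Function.Surjective ρ)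
    (hmul : ∀ x y, ρ (x * y) = ρ x * ρ y) (hstar : ∀ x, ρ (star x) = star (ρ x))
    (hk : ∀ x, ρ x = 0 → p x = 0) : CStarSeminorm X' :=
  let σ := Function.surjInv hs
  have hσ : ∀ x x', ρ x = x' → p (σ x') = p x := fun x x' h => p.congr (hk _ (by
    rw [map_sub, Function.surjInv_eq hs, h, sub_self]))
  have hr : ∀ x', ρ (σ x') = x' := Function.surjInv_eq hs
  { toFun := fun z => p (σ z)
    map_zero' := by rw [hσ 0 0 (map_zero ρ)]; exact map_zero p.toSeminorm
    add_le' := fun x y => by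
      rw [hσ (σ x + σ y) (x + y) (by rw [map_add, hr, hr])]
      exact map_add_le_add p.toSeminorm _ _
    neg' := fun x => by
      rw [hσ (-σ x) (-x) (by rw [map_neg, hr])]
      exact map_neg_eq_map p.toSeminorm _
    smul' := fun c x => by
      rw [hσ (c • σ x) (c • x) (by rw [map_smul, hr])]
      exact map_smul_eq_mul p.toSeminorm _ _
    mul_le' := fun x y => by
      rw [hσ (σ x * σ y) (x * y) (by rw [hmul, hr, hr])]
      exact p.mul_le _ _
    star_mul_self' := fun x => by
      rw [hσ (star (σ x) * σ x) (star x * x) (by rw [hmul, hstar, hr])]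
      exact p.star_mul_self _ }

theorem CStarSeminorm.descend_apply (p : CStarSeminorm X) (ρ : X →ₗ[ℂ] X')
    (hs : Function.Surjective ρ) (hmul : ∀ x y, ρ (x * y) = ρ x * ρ y)
    (hstar : ∀ x, ρ (star x) = star (ρ x)) (hk : ∀ x, ρ x = 0 → p x = 0) (x : X) :
    p.descend ρ hs hmul hstar hk (ρ x) = p x :=
  p.congr (hk _ (by rw [map_sub, Function.surjInv_eq hs, sub_self]))

/-- The pullback of a C⋆-seminorm. -/
def CStarSeminorm.pullback (p : CStarSeminorm X') (f : X →⋆ₙₐ[ℂ] X') : CStarSeminorm X where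
  toFun x := p (f x)
  map_zero' := by rw [map_zero]; exact map_zero p.toSeminorm
  add_le' x y := by rw [map_add]; exact map_add_le_add p.toSeminorm _ _
  neg' x := by rw [map_neg]; exact map_neg_eq_map p.toSeminorm _
  smul' c x := by rw [map_smul]; exact map_smul_eq_mul p.toSeminorm _ _
  mul_le' x y := by rw [map_mul]; exact p.mul_le _ _
  star_mul_self' x := by rw [map_mul, map_star]; exact p.star_mul_self _

theorem CStarSeminorm.pullback_apply (p : CStarSeminorm X') (f : X →⋆ₙₐ[ℂ] X') (x : X) :
    p.pullback f x = p (f x) := rfl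

end Descend

end CGamma

namespace CGamma

open Filter Topology
open NonUnitalStarAlgHom (id)

/-! ### Exactness of the maximal tensor product -/

section Exact

variable {A B C J : Type*} [NonUnitalCStarAlgebra A] [NonUnitalCStarAlgebra B]
  [NonUnitalCStarAlgebra C] [NonUnitalCStarAlgebra J]

theorem clm_mem_of_tmul_mem {E : Type*} [NonUnitalCStarAlgebra E] (f : MaxTensor A B →L[ℂ] E)
    {V : Submodule ℂ E} (hV : IsClosed (V : Set E)) (h : ∀ a b, f (tmul a b) ∈ V)
    (x : MaxTensor A B) : f x ∈ V := by
  refine (denseRange_ofAlg A B).induction_on (p := fun x : MaxTensor A B => f x ∈ V) x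
    (hV.preimage f.continuous) fun t => ?_
  induction t using TensorProduct.induction_on with
  | zero => simp
  | add x y hx hy => rw [map_add, map_add]; exact add_mem hx hy
  | tmul a b => exact h a b

theorem isClosed_rangeSubmodule {k : J →⋆ₙₐ[ℂ] A} (hk : Function.Injective k) :
    IsClosed (rangeSubmodule k : Set A) := by
  convert isClosed_range_hom hk
  exact LinearMap.coe_range _

variable {ι : J →⋆ₙₐ[ℂ] A} {π : A →⋆ₙₐ[ℂ] C}

theorem exists_mul_of_range_eq (h : Set.range ι = {a | π a = 0}) (a : A) (j : J) :
    ∃ j', ι j' = a * ι j := by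
  have hj : π (ι j) = 0 := h.subset ⟨j, rfl⟩
  have : a * ι j ∈ {a | π a = 0} := by
    rw [Set.mem_ofPred_eq, map_mul, hj, mul_zero]
  exact h.superset this

variable (B)

/-- The range of `J ⊗ B` is closed because the embedding is isometric, so the ideal property needs
to be checked only for products of elementary tensors. -/
theorem exists_tensor_mul (hι : Function.Injective ι) (hI : ∀ a j, ∃ j', ι j' = a * ι j)
    (x : MaxTensor A B) (y : MaxTensor J B) :
    ∃ y', tensorMap ι (id ℂ B) y' = x * tensorMap ι (id ℂ B) y := by
  set k := tensorMap ι (id ℂ B) with hk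
  have hc : IsClosed (rangeSubmodule k : Set (MaxTensor A B)) :=
    isClosed_rangeSubmodule (tensorMap_ideal_injective hι hI)
  have h1 : ∀ a b, tmul a b * k y ∈ rangeSubmodule k := fun a b => by
    have := clm_mem_of_tmul_mem ((ContinuousLinearMap.mul ℂ _ (tmul a b)).comp (homCLM k)) hc
      (fun j b' => by
        obtain ⟨j', hj'⟩ := hI a j
        rw [clm_comp_apply, homCLM_apply, ContinuousLinearMap.mul_apply', hk, tensorMap_tmul,
          homId_apply, tmul_mul_tmul, ← hj']
        refine mem_rangeSubmodule.mpr ⟨tmul j' (b * b'), ?_⟩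
        rw [tensorMap_tmul, homId_apply]) y
    rwa [clm_comp_apply, homCLM_apply, ContinuousLinearMap.mul_apply'] at this
  have := clm_mem_of_tmul_mem ((ContinuousLinearMap.mul ℂ _).flip (k y)) hc (fun a b => by
    rw [ContinuousLinearMap.flip_apply, ContinuousLinearMap.mul_apply']
    exact h1 a b) x
  rw [ContinuousLinearMap.flip_apply, ContinuousLinearMap.mul_apply'] at this
  exact mem_rangeSubmodule.mp this

variable (π) in
/-- The map `π ⊗ id` on algebraic tensor products. -/
def algTensorMap : A ⊗[ℂ] B →ₗ[ℂ] C ⊗[ℂ] B :=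
  TensorProduct.map (π : A →ₗ[ℂ] C) ((id ℂ B : B →⋆ₙₐ[ℂ] B) : B →ₗ[ℂ] B)

theorem algTensorMap_tmul (a : A) (b : B) : algTensorMap B π (a ⊗ₜ b) = π a ⊗ₜ b := rfl

theorem algTensorMap_mul (x y : A ⊗[ℂ] B) :
    algTensorMap B π (x * y) = algTensorMap B π x * algTensorMap B π y := by
  induction x using TensorProduct.induction_on with
  | zero => simp
  | add x x' hx hx' => rw [add_mul, map_add, map_add, add_mul, hx, hx']
  | tmul a b =>
    induction y using TensorProduct.induction_on with
    | zero => simp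
    | add y y' hy hy' => rw [mul_add, map_add, map_add, mul_add, hy, hy']
    | tmul a' b' =>
      simp only [Algebra.TensorProduct.tmul_mul_tmul, algTensorMap_tmul, map_mul]

theorem algTensorMap_star (x : A ⊗[ℂ] B) :
    algTensorMap B π (star x) = star (algTensorMap B π x) := by
  induction x using TensorProduct.induction_on with
  | zero => simp
  | add x x' hx hx' => rw [star_add, map_add, map_add, star_add, hx, hx']
  | tmul a b => simp only [TensorProduct.star_tmul, algTensorMap_tmul, map_star]

variable (hι : Function.Injective ι) (h : Set.range ι = {a | π a = 0}) (hπ : Function.Surjective π)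

include h hπ in
theorem exists_of_algTensorMap_eq_zero {x : A ⊗[ℂ] B} (hx : algTensorMap B π x = 0) :
    ∃ t, algTensorMap B ι t = x := by
  have hex : Function.Exact (ι : J →ₗ[ℂ] A) (π : A →ₗ[ℂ] C) := fun a =>
    ⟨fun ha => h.superset ha, fun ha => h.subset ha⟩
  exact (rTensor_exact B hex hπ x).mp hx

-- The quotient norm of `A ⊗ B` modulo `J ⊗ B` is a C⋆-seminorm. On algebraic tensors it vanishes on
-- the kernel of the map to the algebraic tensor product of `C` and `B`, by right exactness of the
-- algebraic tensor product. It therefore descends to a C⋆-seminorm there and is bounded by the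
-- maximal one.
include hι h hπ in
theorem quotientNorm_le_tensorMap (x : MaxTensor A B) :
    quotientNorm (tensorMap ι (id ℂ B)) x ≤ ‖tensorMap π (id ℂ B) x‖ := by
  have hI := exists_tensor_mul B hι (exists_mul_of_range_eq h)
  have hs : Function.Surjective (algTensorMap B π) :=
    TensorProduct.map_surjective hπ Function.surjective_id
  have hc : Continuous (quotientNorm (tensorMap ι (id ℂ B))) :=
    continuous_norm.comp (AddMonoidHomClass.continuous_of_bound
      (rangeSubmodule (tensorMap ι (id ℂ B))).mkQ 1 fun x => by
        rw [one_mul]; exact Submodule.Quotient.norm_mk_le _ x)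
  refine (denseRange_ofAlg A B).induction_on (p := fun x : MaxTensor A B =>
    quotientNorm (tensorMap ι (id ℂ B)) x ≤ ‖tensorMap π (id ℂ B) x‖) x
    (isClosed_le hc (continuous_hom _).norm) fun t => ?_
  have hk : ∀ t : A ⊗[ℂ] B, algTensorMap B π t = 0 →
      (quotientSeminorm hI).pullback (ofAlg A B) t = 0 := fun t ht => by
    obtain ⟨s, rfl⟩ := exists_of_algTensorMap_eq_zero B h hπ ht
    rw [CStarSeminorm.pullback_apply, quotientSeminorm_apply]
    refine le_antisymm ?_ (norm_nonneg _)
    refine (quotientNorm_le_of_mem (y := 0) ?_).trans_eq norm_zero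
    rw [sub_zero]
    exact mem_rangeSubmodule.mpr ⟨ofAlg J B s, tensorMap_ofAlg _ _ s⟩
  have h1 := le_maxSeminorm (((quotientSeminorm hI).pullback (ofAlg A B)).descend
    (algTensorMap B π) hs (algTensorMap_mul B) (algTensorMap_star B) hk) (algTensorMap B π t)
  rw [CStarSeminorm.descend_apply, CStarSeminorm.pullback_apply, quotientSeminorm_apply] at h1
  rw [tensorMap_ofAlg, norm_ofAlg (A := C) (B := B)]
  exact h1

include hι h hπ in
theorem range_tensorMap_eq :
    Set.range (tensorMap ι (id ℂ B)) = {x | tensorMap π (id ℂ B) x = 0} := by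
  refine Set.Subset.antisymm ?_ fun x hx => ?_
  · rintro _ ⟨y, rfl⟩
    have hz : (tensorMap π (id ℂ B)).comp (tensorMap ι (id ℂ B)) = 0 :=
      tensor_hom_ext fun j b => by
        have : π (ι j) = 0 := h.subset ⟨j, rfl⟩
        rw [hom_comp_apply, tensorMap_tmul, tensorMap_tmul, this, zero_tmul]
        rfl
    have := DFunLike.congr_fun hz y
    rw [hom_comp_apply] at this
    exact this
  · have hx' : tensorMap π (id ℂ B) x = 0 := hx
    have hc : IsClosed (rangeSubmodule (tensorMap ι (id ℂ B)) : Set (MaxTensor A B)) :=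
      isClosed_rangeSubmodule (tensorMap_ideal_injective hι (exists_mul_of_range_eq h))
    have h1 := quotientNorm_le_tensorMap B hι h hπ x
    rw [hx', norm_zero] at h1
    -- Quotient norm zero means that `x` is a limit of elements `x - yₙ` of the range, which is
    -- closed.
    have h2 : ∀ n : ℕ, ∃ y, x - y ∈ rangeSubmodule (tensorMap ι (id ℂ B)) ∧
        ‖y‖ < 1 / ((n : ℝ) + 1) := fun n => exists_norm_lt (h1.trans_lt (by positivity))
    choose y hy hn using h2
    have h3 : Tendsto y atTop (𝓝 0) :=
      squeeze_zero_norm (fun n => (hn n).le) tendsto_one_div_add_atTop_nhds_zero_nat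
    have h4 := hc.mem_of_tendsto ((tendsto_const_nhds (x := x)).sub h3) (.of_forall hy)
    rw [sub_zero] at h4
    exact mem_rangeSubmodule.mp h4

-- The induced map on the quotient is isometric, so its range is closed; it contains all elementary
-- tensors because `π` is surjective.
include hι h hπ in
theorem tensorMap_surjective : Function.Surjective (tensorMap π (id ℂ B)) := by
  set f := tensorMap π (id ℂ B) with hf
  set V := rangeSubmodule (tensorMap ι (id ℂ B)) with hV
  have hc : IsClosed (V : Set (MaxTensor A B)) :=
    isClosed_rangeSubmodule (tensorMap_ideal_injective hι (exists_mul_of_range_eq h))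
  have h0 : V ≤ LinearMap.ker (f : MaxTensor A B →ₗ[ℂ] MaxTensor C B) := fun x hx =>
    (range_tensorMap_eq B hι h hπ).subset (mem_rangeSubmodule.mp hx)
  have hle : ∀ x : MaxTensor A B ⧸ V, ‖x‖ ≤
      ‖V.liftQ (f : MaxTensor A B →ₗ[ℂ] MaxTensor C B) h0 x‖ := fun x => by
    obtain ⟨x, rfl⟩ := Submodule.Quotient.mk_surjective V x
    exact quotientNorm_le_tensorMap B hι h hπ x
  have hge : ∀ x : MaxTensor A B ⧸ V,
      ‖V.liftQ (f : MaxTensor A B →ₗ[ℂ] MaxTensor C B) h0 x‖ ≤ 1 * ‖x‖ := fun x => by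
    refine le_of_forall_gt_imp_ge_of_dense fun r hr => ?_
    rw [one_mul] at hr
    obtain ⟨y, rfl, hy⟩ := Submodule.Quotient.norm_mk_lt x (sub_pos.mpr hr)
    refine (NonUnitalStarAlgHom.norm_apply_le f y).trans (hy.le.trans_eq ?_)
    ring
  have hcl : IsClosed (Set.range (V.liftQ (f : MaxTensor A B →ₗ[ℂ] MaxTensor C B) h0)) :=
    (AddMonoidHomClass.antilipschitz_of_bound _ (K := 1) fun x => by
      rw [NNReal.coe_one, one_mul]; exact hle x).isClosed_range
      (AddMonoidHomClass.lipschitz_of_bound _ 1 hge).uniformContinuous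
  have hr : ∀ z, z ∈ LinearMap.range (V.liftQ (f : MaxTensor A B →ₗ[ℂ] MaxTensor C B) h0) :=
    fun z => clm_mem_of_tmul_mem (ContinuousLinearMap.id ℂ _) (by
      convert hcl
      exact LinearMap.coe_range _) (fun c b => by
        obtain ⟨a, rfl⟩ := hπ c
        refine ⟨Submodule.Quotient.mk (tmul a b), ?_⟩
        rw [Submodule.liftQ_apply]
        exact tensorMap_tmul _ _ a b) z
  intro z
  obtain ⟨x, hx⟩ := hr z
  obtain ⟨x, rfl⟩ := Submodule.Quotient.mk_surjective V x
  exact ⟨x, hx⟩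

/-! ### Exactness in the second tensor factor, by symmetry -/

include hι h in
theorem tensorMap_ideal_injective' : Function.Injective (tensorMap (id ℂ B) ι) :=
  tensorMap_injective_comm (tensorMap_ideal_injective hι (exists_mul_of_range_eq h))

include hι h hπ in
theorem range_tensorMap_eq' :
    Set.range (tensorMap (id ℂ B) ι) = {x | tensorMap (id ℂ B) π x = 0} := by
  have h1 := range_tensorMap_eq B hι h hπ
  refine Set.Subset.antisymm ?_ fun x hx => ?_
  · rintro _ ⟨y, rfl⟩
    have h2 : tensorMap π (id ℂ B) (tensorMap ι (id ℂ B) (tensorFlip B J y)) = 0 :=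
      h1.subset ⟨_, rfl⟩
    rw [← tensorFlip_tensorMap, ← tensorFlip_tensorMap] at h2
    have h3 := congrArg (tensorFlip C B) h2
    rwa [tensorFlip_tensorFlip, map_zero] at h3
  · have hx' : tensorMap (id ℂ B) π x = 0 := hx
    have h2 : tensorMap π (id ℂ B) (tensorFlip B A x) = 0 := by
      rw [← tensorFlip_tensorMap, hx', map_zero]
    obtain ⟨y, hy⟩ := h1.superset h2
    refine ⟨tensorFlip J B y, ?_⟩
    rw [← tensorFlip_tensorMap, hy, tensorFlip_tensorFlip]

include hι h hπ in
theorem tensorMap_surjective' : Function.Surjective (tensorMap (id ℂ B) π) := fun z => by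
  obtain ⟨x, hx⟩ := tensorMap_surjective B hι h hπ (tensorFlip B C z)
  refine ⟨tensorFlip A B x, ?_⟩
  rw [← tensorFlip_tensorMap, hx, tensorFlip_tensorFlip]

end Exact

/-! ### Exactness of the cotensor product -/

section CotensorExact

variable {Γ : Type*} [Group Γ]

/-! ### Degrees of elementary tensors for restricted coactions -/

section Restriction

variable {A B : Type*} [NonUnitalCStarAlgebra A] [NonUnitalCStarAlgebra B]
  {cA : CGammaStructure Γ A} {cB : CGammaStructure Γ B} {c : CGammaStructure Γ (Cotensor cA cB)}

theorem IsRestriction.left_eq (hc : IsRestriction cA cB c) {z : Cotensor cA cB} {ζ γ : Γ} {a : A}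
    {b : B} (ha : IsBihomogeneous cA ζ γ a) (h : cotensorIncl cA cB z = tmul a b) :
    c.left z = tmul (GroupCStar.of ζ) z := by
  refine tensorMap_cotensorIncl_injective cA cB _ ?_
  have := DFunLike.congr_fun hc.left z
  rw [hom_comp_apply, hom_comp_apply, hom_comp_apply] at this
  rw [this, h, tensorMap_tmul, tensorMap_tmul, ha.left, homId_apply, tensorAssoc_tmul,
    homId_apply, h]

theorem IsRestriction.right_eq (hc : IsRestriction cA cB c) {z : Cotensor cA cB} {γ η : Γ} {a : A}
    {b : B} (hb : IsBihomogeneous cB γ η b) (h : cotensorIncl cA cB z = tmul a b) :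
    c.right z = tmul z (GroupCStar.of η) := by
  refine tensorMap_cotensorIncl_injective' cA cB _ (tensorAssoc_injective A B (GroupCStar Γ) ?_)
  have := DFunLike.congr_fun hc.right z
  rw [hom_comp_apply, hom_comp_apply, hom_comp_apply] at this
  rw [this, h, tensorMap_tmul, tensorMap_tmul, hb.right, homId_apply, homId_apply, h,
    tensorAssoc_tmul]

end Restriction

variable {A₁ A₂ A₃ B₁ B₂ B₃ : Type*} [NonUnitalCStarAlgebra A₁] [NonUnitalCStarAlgebra A₂]
  [NonUnitalCStarAlgebra A₃] [NonUnitalCStarAlgebra B₁] [NonUnitalCStarAlgebra B₂]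
  [NonUnitalCStarAlgebra B₃]
  {a₁ : CGammaStructure Γ A₁} {a₂ : CGammaStructure Γ A₂} {a₃ : CGammaStructure Γ A₃}
  {b₁ : CGammaStructure Γ B₁} {b₂ : CGammaStructure Γ B₂} {b₃ : CGammaStructure Γ B₃}
  {s₁ : CGammaStructure Γ (Cotensor a₁ b₁)} {s₂ : CGammaStructure Γ (Cotensor a₂ b₂)}
  {s₃ : CGammaStructure Γ (Cotensor a₃ b₃)} {φ : A₁ →⋆ₙₐ[ℂ] A₂} {ψ : B₁ →⋆ₙₐ[ℂ] B₂}
  {φ' : A₂ →⋆ₙₐ[ℂ] A₃} {ψ' : B₂ →⋆ₙₐ[ℂ] B₃}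

theorem isMorphism_cotensorMap (hs₁ : IsRestriction a₁ b₁ s₁) (hs₂ : IsRestriction a₂ b₂ s₂)
    (hφ : IsMorphism a₁ a₂ φ) (hψ : IsMorphism b₁ b₂ ψ) :
    IsMorphism s₁ s₂ (cotensorMap hφ hψ) where
  left := hom_ext_of_dense (dense_span_cotensorTotal a₁ b₁) (by
    rintro z ⟨ζ, γ, η, a, b, ha, hb, h⟩
    have h' : cotensorIncl a₂ b₂ (cotensorMap hφ hψ z) = tmul (φ a) (ψ b) := by
      rw [cotensorIncl_cotensorMap, h, tensorMap_tmul]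
    rw [hom_comp_apply, hom_comp_apply, hs₁.left_eq ha h, tensorMap_tmul, homId_apply,
      hs₂.left_eq (ha.map hφ) h'])
  right := hom_ext_of_dense (dense_span_cotensorTotal a₁ b₁) (by
    rintro z ⟨ζ, γ, η, a, b, ha, hb, h⟩
    have h' : cotensorIncl a₂ b₂ (cotensorMap hφ hψ z) = tmul (φ a) (ψ b) := by
      rw [cotensorIncl_cotensorMap, h, tensorMap_tmul]
    rw [hom_comp_apply, hom_comp_apply, hs₁.right_eq hb h, tensorMap_tmul, homId_apply,
      hs₂.right_eq (hb.map hψ) h'])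

/-- Naturality of the projections, stated as compatibility with the retractions, is what makes the
sequence of cotensor products a retract of the sequence of tensor products. -/
theorem cotensorMap_retract (hφ : IsMorphism a₁ a₂ φ) (hψ : IsMorphism b₁ b₂ ψ)
    (x : MaxTensor A₁ B₁) : cotensorMap hφ hψ (cotensorRetract a₁ b₁ x) =
      cotensorRetract a₂ b₂ (tensorMap φ ψ x) :=
  cotensorIncl_injective a₂ b₂ (by
    rw [cotensorIncl_cotensorMap, cotensorIncl_retract, cotensorIncl_retract,
      cotensorProj_natural hφ hψ])

/-- Exactness passes from the maximal tensor products to the cotensor products. -/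
theorem isShortExact_cotensorMap (hs₁ : IsRestriction a₁ b₁ s₁) (hs₂ : IsRestriction a₂ b₂ s₂)
    (hs₃ : IsRestriction a₃ b₃ s₃) (hφ : IsMorphism a₁ a₂ φ) (hψ : IsMorphism b₁ b₂ ψ)
    (hφ' : IsMorphism a₂ a₃ φ') (hψ' : IsMorphism b₂ b₃ ψ')
    (hi : Function.Injective (tensorMap φ ψ))
    (hr : Set.range (tensorMap φ ψ) = {x | tensorMap φ' ψ' x = 0})
    (hs : Function.Surjective (tensorMap φ' ψ')) :
    IsShortExact s₁ s₂ s₃ (cotensorMap hφ hψ) (cotensorMap hφ' hψ') where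
  morphism_ι := isMorphism_cotensorMap hs₁ hs₂ hφ hψ
  morphism_π := isMorphism_cotensorMap hs₂ hs₃ hφ' hψ'
  ker_ι x hx := by
    refine cotensorIncl_injective a₁ b₁ (hi ?_)
    rw [← cotensorIncl_cotensorMap hφ hψ, hx, map_zero, map_zero, map_zero]
  range_ι := by
    refine Set.Subset.antisymm ?_ fun z hz => ?_
    · rintro _ ⟨x, rfl⟩
      refine cotensorIncl_injective a₃ b₃ ?_
      rw [cotensorIncl_cotensorMap, cotensorIncl_cotensorMap, map_zero]
      exact hr.subset ⟨_, rfl⟩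
    · have hz' : cotensorMap hφ' hψ' z = 0 := hz
      have h1 : tensorMap φ' ψ' (cotensorIncl a₂ b₂ z) = 0 := by
        rw [← cotensorIncl_cotensorMap hφ' hψ', hz', map_zero]
      obtain ⟨y, hy⟩ := hr.superset h1
      -- The preimage `y` need not lie in the cotensor product. Its projection does, and it is still
      -- a preimage since the projection is natural and fixes `z`.
      refine ⟨cotensorRetract a₁ b₁ y, ?_⟩
      rw [cotensorMap_retract, hy, cotensorRetract_incl]
  range_π := by
    refine Set.eq_univ_of_forall fun z => ?_
    obtain ⟨x, hx⟩ := hs (cotensorIncl a₃ b₃ z)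
    refine ⟨cotensorRetract a₂ b₂ x, ?_⟩
    rw [cotensorMap_retract, hx, cotensorRetract_incl]

end CotensorExact

end CGamma

end

theorem mainTheorem9 (Γ : Type u) [Group Γ] (D : Type w) [NonUnitalCStarAlgebra D]
    (cD : CGamma.CGammaStructure Γ D) :
    -- the cotensor products with `D` are `(ℂ,Γ)`-C⋆-algebras
    (∀ (X : Type v) [NonUnitalCStarAlgebra X] (cX : CGamma.CGammaStructure Γ X),
      (∃! c : CGamma.CGammaStructure Γ (CGamma.Cotensor cX cD), CGamma.IsRestriction cX cD c) ∧
      (∃! c : CGamma.CGammaStructure Γ (CGamma.Cotensor cD cX), CGamma.IsRestriction cD cX c)) ∧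
    -- the functors `- ⊗ D` and `D ⊗ -` are exact
    (∀ (J A C : Type v) [NonUnitalCStarAlgebra J] [NonUnitalCStarAlgebra A]
      [NonUnitalCStarAlgebra C] (cJ : CGamma.CGammaStructure Γ J) (cA : CGamma.CGammaStructure Γ A)
      (cC : CGamma.CGammaStructure Γ C) (ι : J →⋆ₙₐ[ℂ] A) (π : A →⋆ₙₐ[ℂ] C)
      (h : CGamma.IsShortExact cJ cA cC ι π),
      (∀ (sJ : CGamma.CGammaStructure Γ (CGamma.Cotensor cJ cD))
        (sA : CGamma.CGammaStructure Γ (CGamma.Cotensor cA cD))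
        (sC : CGamma.CGammaStructure Γ (CGamma.Cotensor cC cD)),
        CGamma.IsRestriction cJ cD sJ → CGamma.IsRestriction cA cD sA →
        CGamma.IsRestriction cC cD sC →
        CGamma.IsShortExact sJ sA sC
          (CGamma.cotensorMap h.morphism_ι (CGamma.IsMorphism.refl cD))
          (CGamma.cotensorMap h.morphism_π (CGamma.IsMorphism.refl cD))) ∧
      (∀ (sJ : CGamma.CGammaStructure Γ (CGamma.Cotensor cD cJ))
        (sA : CGamma.CGammaStructure Γ (CGamma.Cotensor cD cA))
        (sC : CGamma.CGammaStructure Γ (CGamma.Cotensor cD cC)),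
        CGamma.IsRestriction cD cJ sJ → CGamma.IsRestriction cD cA sA →
        CGamma.IsRestriction cD cC sC →
        CGamma.IsShortExact sJ sA sC
          (CGamma.cotensorMap (CGamma.IsMorphism.refl cD) h.morphism_ι)
          (CGamma.cotensorMap (CGamma.IsMorphism.refl cD) h.morphism_π))) := by
  refine ⟨fun X _ cX => ⟨CGamma.existsUnique_isRestriction cX cD,
    CGamma.existsUnique_isRestriction cD cX⟩, fun J A C _ _ _ cJ cA cC ι π h => ?_⟩
  have hι : Function.Injective ι := (injective_iff_map_eq_zero ι).mpr h.ker_ι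
  have hπ : Function.Surjective π := Set.range_eq_univ.mp h.range_π
  refine ⟨fun sJ sA sC hJ hA hC => ?_, fun sJ sA sC hJ hA hC => ?_⟩
  -- Any restricted structures may be used here, as exactness only involves the underlying maps and
  -- the degrees of elementary tensors.
  · exact CGamma.isShortExact_cotensorMap hJ hA hC _ _ _ _
      (CGamma.tensorMap_ideal_injective hι (CGamma.exists_mul_of_range_eq h.range_ι))
      (CGamma.range_tensorMap_eq D hι h.range_ι hπ)
      (CGamma.tensorMap_surjective D hι h.range_ι hπ)
  · exact CGamma.isShortExact_cotensorMap hJ hA hC _ _ _ _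
      (CGamma.tensorMap_ideal_injective' D hι h.range_ι)
      (CGamma.range_tensorMap_eq' D hι h.range_ι hπ)
      (CGamma.tensorMap_surjective' D hι h.range_ι hπ)
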